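/- Let $G$ be a finite simple graph. For vertices $x,y,z$, call $z$ \emph{between} $x$ and $y$ if there are a path from $z$ to $x$ that avoids the closed neighbourhood $N[y]$ and a path from $z$ to $y$ that avoids $N[x]$. The graph $G$ is \emph{AT-free} if it has no three vertices every two of which are joined by a path avoiding the closed neighbourhood of the third. An \emph{AT-free order} of $G$ is a linear order $<$ of its vertices such that, whenever $z$ is between $x$ and $y$, we have $x<z$ or $y<z$. The \emph{prism} of $G$ is obtained from two copies of the graph whose vertices are the basic words (the words of maximal length) of the language of all prefixes of AT-free orders of $G$, two words being adjacent when one is obtained from the other by transposing an adjacent pair, by joining the two copies of each word by an edge. \textbf{Theorem.} The AT-free orders of an AT-free graph can be generated as a Gray code in constant amortized time. More precisely, there are a program $P$ for a random access machine with unit-cost instructions (constants, $+$, truncated $-$, $\times$, indirect load and store, comparisons, and an instruction \emph{visit} which reports that the output array now holds the next order) and constants $c,d$ such that the following holds for every $n\ge 0$ and every AT-free graph $G$ on $n$ vertices, with $N$ the number of AT-free orders of $G$. Given $n$ and the adjacency matrix of $G$, the program $P$ halts after at most $c\cdot N$ steps in total (preprocessing included), using only numbers that are at most $(n+2)^d$,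 and the successive contents of the output array at the visits form a list of AT-free orders of $G$ such that 1. every AT-free order of $G$ occurs exactly once in the list, and nothing else occurs in it; 2. any two consecutive orders in the list differ by one or two adjacent transpositions; 3. if $n\ge 2$, the list follows a Hamiltonian cycle $p_0,p_1,\dots,p_{2N-1}$ of the prism: it consists of the orders underlying $p_0,p_2,p_4,\dots,p_{2N-2}$, in this sequence. -/

import Mathlib

/-! ### Asteroidal triples, betweenness and AT-free orders -/

namespace ATFreeGray

/-- There is a path from `z` to `x` all of whose vertices lie outside the closed neighbourhood
of `y`. -/
def JoinedAvoiding {V : Type*} (G : SimpleGraph V) (z x y : V) : Prop :=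
  ∃ p : G.Walk z x, ∀ v ∈ p.support, v ≠ y ∧ ¬ G.Adj y v

/-- Every two of the three vertices are joined by a path avoiding the closed neighbourhood of the
third. (The three vertices are then distinct and pairwise nonadjacent.) -/
def IsAsteroidalTriple {V : Type*} (G : SimpleGraph V) (x y z : V) : Prop :=
  JoinedAvoiding G x y z ∧ JoinedAvoiding G y z x ∧ JoinedAvoiding G x z y

/-- A graph without asteroidal triples. -/
def IsATFree {V : Type*} (G : SimpleGraph V) : Prop :=
  ∀ x y z : V, ¬ IsAsteroidalTriple G x y z

/-- `z` is between `x` and `y`. -/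
def Between {V : Type*} (G : SimpleGraph V) (x y z : V) : Prop :=
  JoinedAvoiding G z x y ∧ JoinedAvoiding G z y x

/-- A linear order of the vertices, written as the word that lists them from first to last, is an
AT-free order if no vertex that is between `x` and `y` precedes both `x` and `y`. -/
def IsATFreeOrder {V : Type*} [DecidableEq V] (G : SimpleGraph V) (w : List V) : Prop :=
  w.Nodup ∧ (∀ v, v ∈ w) ∧
    ∀ x y z, Between G x y z → w.idxOf x < w.idxOf z ∨ w.idxOf y < w.idxOf z

/-! ### The prism of a language -/

/-- The language of all prefixes of AT-free orders of `G`. -/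
def orderLanguage {V : Type*} [DecidableEq V] (G : SimpleGraph V) : Language V :=
  {u | ∃ w, IsATFreeOrder G w ∧ u <+: w}

/-- The basic words of a language are its words of maximal length. -/
def BasicWord {V : Type*} (L : Language V) : Type _ :=
  {u : List V // u ∈ L ∧ ∀ v ∈ L, v.length ≤ u.length}

instance {V : Type*} [DecidableEq V] (L : Language V) : DecidableEq (BasicWord L) :=
  inferInstanceAs (DecidableEq {u : List V // u ∈ L ∧ ∀ v ∈ L, v.length ≤ u.length})

/-- The words `u` and `v` differ by exchanging two distinct adjacent letters. -/
def AdjacentTransposition {V : Type*} (u v : List V) : Prop :=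
  ∃ (p s : List V) (a b : V), a ≠ b ∧ u = p ++ a :: b :: s ∧ v = p ++ b :: a :: s

/-- `v` is obtained from `u` by one or by two adjacent transpositions. -/
def OneOrTwoTranspositions {V : Type*} (u v : List V) : Prop :=
  AdjacentTransposition u v ∨ ∃ w, AdjacentTransposition u w ∧ AdjacentTransposition w v

/-- The graph on the basic words of `L` in which two words are adjacent when they differ by the
transposition of an adjacent pair. -/
def basicWordGraph {V : Type*} (L : Language V) : SimpleGraph (BasicWord L) where
  Adj u v := AdjacentTransposition u.1 v.1
  symm := by
    constructor
    rintro u v ⟨p, s, a, b, hab, hu, hv⟩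
    exact ⟨p, s, b, a, hab.symm, hv, hu⟩
  loopless := by
    constructor
    rintro u ⟨p, s, a, b, hab, hu, hv⟩
    rw [hu] at hv
    simp_all

/-- The prism: two copies of the basic word graph (labelled by `Bool`), with the two copies of
each basic word joined by an edge. -/
def prism {V : Type*} (L : Language V) : SimpleGraph (BasicWord L × Bool) :=
  (basicWordGraph L).boxProd (⊤ : SimpleGraph Bool)

/-! ### A random access machine with a step count

The machine has numbered registers and numbered arrays, all holding natural numbers. Every
elementary instruction and every test takes one step. A word bound `B` is imposed: an instruction
that would produce a number larger than `B` cannot be executed. -/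

/-- Programs. A program mentions finitely many registers and finitely many arrays. -/
inductive Prog where
  /-- do nothing -/
  | skip : Prog
  /-- `x := k` -/
  | const (x k : ℕ) : Prog
  /-- `x := y + z` -/
  | add (x y z : ℕ) : Prog
  /-- `x := y - z`, truncated at `0` -/
  | sub (x y z : ℕ) : Prog
  /-- `x := y * z` -/
  | mul (x y z : ℕ) : Prog
  /-- `x := a[y]` -/
  | load (x a y : ℕ) : Prog
  /-- `a[y] := x` -/
  | store (a y x : ℕ) : Prog
  /-- report that the output array, array number `1`, now holds the next object of the listing -/
  | visit : Prog
  /-- first `p`, then `q` -/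
  | seq (p q : Prog) : Prog
  /-- if `x < y` then `p` else `q` -/
  | branch (x y : ℕ) (p q : Prog) : Prog
  /-- while `x < y` do `p` -/
  | loop (x y : ℕ) (p : Prog) : Prog

/-- Machine states: `reg x` is the content of register `x`, and `arr a i` is entry `i` of
array `a`. -/
structure State where
  reg : ℕ → ℕ
  arr : ℕ → ℕ → ℕ

/-- Assign the value `v` to register `x`. -/
def State.setReg (s : State) (x v : ℕ) : State :=
  ⟨Function.update s.reg x v, s.arr⟩

/-- Assign the value `v` to entry `i` of array `a`. -/
def State.setArr (s : State) (a i v : ℕ) : State :=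
  ⟨s.reg, Function.update s.arr a (Function.update (s.arr a) i v)⟩

/-- `Exec B p s t l s'`: with word bound `B`, the program `p` started in state `s` halts after
exactly `t` steps in state `s'`, and `l` is the list of the contents of the output array at the
successive `visit` instructions. -/
inductive Exec (B : ℕ) : Prog → State → ℕ → List (ℕ → ℕ) → State → Prop where
  | skip (s : State) : Exec B Prog.skip s 1 [] s
  | const (s : State) (x k : ℕ) (h : k ≤ B) :
      Exec B (Prog.const x k) s 1 [] (s.setReg x k)
  | add (s : State) (x y z : ℕ) (h : s.reg y + s.reg z ≤ B) :
      Exec B (Prog.add x y z) s 1 [] (s.setReg x (s.reg y + s.reg z))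
  | sub (s : State) (x y z : ℕ) (h : s.reg y - s.reg z ≤ B) :
      Exec B (Prog.sub x y z) s 1 [] (s.setReg x (s.reg y - s.reg z))
  | mul (s : State) (x y z : ℕ) (h : s.reg y * s.reg z ≤ B) :
      Exec B (Prog.mul x y z) s 1 [] (s.setReg x (s.reg y * s.reg z))
  | load (s : State) (x a y : ℕ) (h : s.arr a (s.reg y) ≤ B) :
      Exec B (Prog.load x a y) s 1 [] (s.setReg x (s.arr a (s.reg y)))
  | store (s : State) (a y x : ℕ) (h : s.reg x ≤ B) :
      Exec B (Prog.store a y x) s 1 [] (s.setArr a (s.reg y) (s.reg x))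
  | visit (s : State) : Exec B Prog.visit s 1 [s.arr 1] s
  | seq {p q : Prog} {s₁ s₂ s₃ : State} {t₁ t₂ : ℕ} {l₁ l₂ : List (ℕ → ℕ)}
      (hp : Exec B p s₁ t₁ l₁ s₂) (hq : Exec B q s₂ t₂ l₂ s₃) :
      Exec B (Prog.seq p q) s₁ (t₁ + t₂) (l₁ ++ l₂) s₃
  | branch_true {x y : ℕ} {p q : Prog} {s₁ s₂ : State} {t : ℕ} {l : List (ℕ → ℕ)}
      (h : s₁.reg x < s₁.reg y) (hp : Exec B p s₁ t l s₂) :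
      Exec B (Prog.branch x y p q) s₁ (t + 1) l s₂
  | branch_false {x y : ℕ} {p q : Prog} {s₁ s₂ : State} {t : ℕ} {l : List (ℕ → ℕ)}
      (h : ¬ s₁.reg x < s₁.reg y) (hq : Exec B q s₁ t l s₂) :
      Exec B (Prog.branch x y p q) s₁ (t + 1) l s₂
  | loop_true {x y : ℕ} {p : Prog} {s₁ s₂ s₃ : State} {t₁ t₂ : ℕ} {l₁ l₂ : List (ℕ → ℕ)}
      (h : s₁.reg x < s₁.reg y) (hp : Exec B p s₁ t₁ l₁ s₂)
      (hl : Exec B (Prog.loop x y p) s₂ t₂ l₂ s₃) :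
      Exec B (Prog.loop x y p) s₁ (t₁ + t₂ + 1) (l₁ ++ l₂) s₃
  | loop_false {x y : ℕ} {p : Prog} {s : State} (h : ¬ s.reg x < s.reg y) :
      Exec B (Prog.loop x y p) s 1 [] s

open Classical in
/-- The input: register `0` holds the number `n` of vertices, array `0` holds the adjacency matrix
of `G` row by row, and everything else is `0`. -/
noncomputable def inputState {n : ℕ} (G : SimpleGraph (Fin n)) : State where
  reg x := if x = 0 then n else 0
  arr a k := if a = 0 ∧ ∃ i j : Fin n, G.Adj i j ∧ k = (i : ℕ) * n + (j : ℕ) then 1 else 0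

end ATFreeGray

/-!
Call a vertex of a set `T` *feasible* if it is not between two vertices of `T`. A word is an AT-free
order exactly if each letter is feasible for the suffix that it starts (`isATFreeOrder_iff`). The
only fact about AT-free graphs that is used is that a set with at least two vertices has a feasible
vertex other than any prescribed one (`exists_extreme_ne`); it comes from maximizing the component
of the prescribed vertex in `G - N[z]` and then a weight of all components of `G - N[z]`.
Everything else holds for an abstract relation with this property, `IsConvexBetweenness`.

**The cycle.** Two fixed-point free involutions of the prism are defined by recursion on words:
`move` acts at the even positions, and `tailMove` is `move` on the word without its first letter.
The cycle takes them in turn. For the letters of a word `l`, the recursion glues the cycles for the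
blocks of words with a fixed first letter, which form a star whose centre is the block of the *hub*,
the least feasible letter `h`. A block with first letter `g ≠ h` is linked to that of the hub by
exchanging `g` and `h` at both ends of one edge, namely the special edge of the cycle for the
remaining letters (`IsSpecial`). A block other than the hub's loses one edge and stays connected,
and in the hub's block each lost edge is replaced by a detour through another block. So all vertices
lie on one alternating cycle (`IsConvexBetweenness.linked`). Both involutions flip the sign
`prismSign`, hence every second vertex of the cycle has the sign of the first one, and these
vertices list every word exactly once. On suffixes of positive even length `move` never changes the
copy, so starting each pair of moves with the involution that acts on the suffixes of even length
makes consecutive listed words differ by one or two transpositions.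

**Amortization.** There are at least two choices for each letter but the last, so a suffix of length
`m` can be rearranged in at least `2 ^ (m - 1)` ways. If a suffix is determined by its set of
letters, as canonical suffixes are, then it occurs in at most a fraction `2 ^ (1 - m)` of all words
(`IsConvexBetweenness.ncard_mul_two_pow_le`). Polynomial work that is done on such suffixes only is
constant on average (`IsConvexBetweenness.sum_suffix_le`). The same lower bound on the number of
orders pays for a polynomial preprocessing.

**The program.** The preprocessing computes, in the manner of Floyd and Warshall, which vertices are
joined outside of each closed neighbourhood (`comp_tableProg`), and a first order greedily
(`comp_greedyProg`). To perform a move, the program looks for the position of the exchange from the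
end of the word; since a link at a position requires one two positions further on, and requires the
rest of the word to be semicanonical, it goes on only as long as a canonical suffix allows it
(`comp_scanProg`). The run stops when word and copy are those of the start, which is tested by
comparing the words from their ends (`comp_endProg`).

Registers `0`, `1`, `2` hold `n`, `1`, `0`; register `3` holds the copy; register `4` tells whether
to go on; the higher registers are for temporary use. Array `1` is the output, array `2` keeps the
first order, and array `3` is the table of paths.
-/

namespace ATFreeGray

/-! ### Extreme points of vertex sets in AT-free graphs -/

section Extreme

variable {V : Type*} {G : SimpleGraph V} {a b u v x y z : V}

theorem JoinedAvoiding.refl (h : v ≠ y) (h' : ¬ G.Adj y v) : JoinedAvoiding G v v y :=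
  ⟨SimpleGraph.Walk.nil, by simp [h, h']⟩

theorem JoinedAvoiding.symm (h : JoinedAvoiding G u v y) : JoinedAvoiding G v u y := by
  obtain ⟨p, hp⟩ := h
  exact ⟨p.reverse, by simpa using hp⟩

theorem JoinedAvoiding.trans (h : JoinedAvoiding G u v y) (h' : JoinedAvoiding G v x y) :
    JoinedAvoiding G u x y := by
  obtain ⟨p, hp⟩ := h
  obtain ⟨q, hq⟩ := h'
  refine ⟨p.append q, fun w hw => ?_⟩
  rcases (SimpleGraph.Walk.mem_support_append_iff _ _).1 hw with hw | hw
  exacts [hp w hw, hq w hw]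

theorem JoinedAvoiding.left (h : JoinedAvoiding G u v y) : u ≠ y ∧ ¬ G.Adj y u := by
  obtain ⟨p, hp⟩ := h
  exact hp u p.start_mem_support

theorem JoinedAvoiding.right (h : JoinedAvoiding G u v y) : v ≠ y ∧ ¬ G.Adj y v :=
  h.symm.left

theorem JoinedAvoiding.of_adj (hu : u ≠ y ∧ ¬ G.Adj y u) (hv : v ≠ y ∧ ¬ G.Adj y v)
    (h : G.Adj u v) : JoinedAvoiding G u v y :=
  ⟨SimpleGraph.Walk.cons h SimpleGraph.Walk.nil, by
    intro w hw
    simp only [SimpleGraph.Walk.support_cons, SimpleGraph.Walk.support_nil, List.mem_cons,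
      List.not_mem_nil, or_false] at hw
    rcases hw with rfl | rfl
    exacts [hu, hv]⟩

theorem JoinedAvoiding.of_mem_support (p : G.Walk u v) (hp : ∀ w ∈ p.support, w ≠ y ∧ ¬ G.Adj y w)
    (hx : x ∈ p.support) : JoinedAvoiding G u x y := by
  classical
  exact ⟨p.takeUntil x hx, fun w hw => hp w (p.support_takeUntil_subset_support hx hw)⟩

theorem not_between_self : ¬ Between G x x z := by
  rintro ⟨⟨p, hp⟩, -⟩
  exact (hp x p.end_mem_support).1 rfl

theorem Between.symm (h : Between G x y z) : Between G y x z := ⟨h.2, h.1⟩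

/-- The connected component of `v` in the graph without the closed neighbourhood of `z`; it is
empty if `v` lies in that neighbourhood. -/
noncomputable def avoidingComponent [Fintype V] (G : SimpleGraph V) (z v : V) : Finset V := by
  classical exact Finset.univ.filter fun u => JoinedAvoiding G v u z

theorem mem_avoidingComponent [Fintype V] :
    u ∈ avoidingComponent G z v ↔ JoinedAvoiding G v u z := by
  simp [avoidingComponent]

/-- If `z` is between `a` and `b`, then a component of `G - N[z]` other than that of `b` stays
connected in `G - N[b]`. -/
theorem JoinedAvoiding.shift (hz : Between G a b z) (hv : ¬ JoinedAvoiding G v b z)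
    (hu : JoinedAvoiding G v u z) : JoinedAvoiding G v u b := by
  obtain ⟨p, hp⟩ := hu
  refine ⟨p, fun w hw => ?_⟩
  have hvw : JoinedAvoiding G v w z := .of_mem_support p hp hw
  have hbz : b ≠ z ∧ ¬ G.Adj z b := by
    obtain ⟨h1, h2⟩ := hz.1.left
    exact ⟨h1.symm, fun h => h2 h.symm⟩
  refine ⟨?_, fun h => hv (hvw.trans (.of_adj hvw.right hbz h.symm))⟩
  rintro rfl
  exact hv hvw

variable [Fintype V]

theorem avoidingComponent_subset (hz : Between G a b z) (hv : ¬ JoinedAvoiding G v b z) :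
    avoidingComponent G z v ⊆ avoidingComponent G b v := by
  intro u hu
  rw [mem_avoidingComponent] at *
  exact hu.shift hz hv

/-- If `z` is between `a` and `b`, then the component of `a` in `G - N[z]` acquires `z` on passing
to `G - N[b]`. This is where AT-freeness enters. -/
theorem card_avoidingComponent_lt (hG : IsATFree G) (hz : Between G a b z)
    (hv : JoinedAvoiding G v a z) :
    (avoidingComponent G z v).card < (avoidingComponent G b v).card := by
  have hab : ¬ JoinedAvoiding G a b z := fun h => hG a b z ⟨h, hz.2.symm, hz.1.symm⟩
  have hvb : ¬ JoinedAvoiding G v b z := fun h => hab (hv.symm.trans h)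
  refine Finset.card_lt_card ((Finset.ssubset_iff_of_subset
    (avoidingComponent_subset hz hvb)).2 ⟨z, ?_, ?_⟩)
  · rw [mem_avoidingComponent]
    exact (hv.shift hz hvb).trans hz.1.symm
  · rw [mem_avoidingComponent]
    exact fun h => h.right.1 rfl

/-- A potential that weighs the large components of `G - N[z]` heavily. -/
noncomputable def componentWeight (G : SimpleGraph V) (z : V) : ℕ :=
  ∑ v, 3 ^ (avoidingComponent G z v).card

theorem avoidingComponent_eq (h : JoinedAvoiding G v u z) :
    avoidingComponent G z v = avoidingComponent G z u := by
  ext w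
  rw [mem_avoidingComponent, mem_avoidingComponent]
  exact ⟨h.symm.trans, h.trans⟩

/-- Passing from `z` to `b`, the loss on the component of `b` is outweighed by the gain on the
component of `a`, provided the latter is not the smaller one. -/
theorem componentWeight_lt (hG : IsATFree G) (hz : Between G a b z)
    (hle : (avoidingComponent G z b).card ≤ (avoidingComponent G z a).card) :
    componentWeight G z < componentWeight G b := by
  classical
  have hab : ¬ JoinedAvoiding G a b z := fun h => hG a b z ⟨h, hz.2.symm, hz.1.symm⟩
  have haz : JoinedAvoiding G a a z := by
    obtain ⟨h1, h2⟩ := hz.2.left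
    exact .refl h1.symm fun h => h2 h.symm
  set A := avoidingComponent G z a with hA
  set B := avoidingComponent G z b with hB
  have haA : a ∈ A := mem_avoidingComponent.2 haz
  have hdisj : Disjoint A B := by
    rw [Finset.disjoint_left]
    intro v hv hv'
    rw [mem_avoidingComponent] at hv hv'
    exact hab (hv.trans hv'.symm)
  -- The component of a vertex of `A` grows, which gains at least `2 * 3 ^ #A`; a vertex of `B`
  -- loses at most `3 ^ #B`, and no other vertex loses anything.
  have key : ∀ v, 3 ^ (avoidingComponent G z v).card + (if v ∈ A then 2 * 3 ^ A.card else 0) ≤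
      3 ^ (avoidingComponent G b v).card + (if v ∈ B then 3 ^ B.card else 0) := by
    intro v
    by_cases hvB : v ∈ B
    · have hvA : v ∉ A := fun h => Finset.disjoint_left.1 hdisj h hvB
      rw [mem_avoidingComponent] at hvB
      have hc : (avoidingComponent G z v).card = B.card := by
        rw [hB, avoidingComponent_eq hvB]
      rw [if_neg hvA, if_pos (mem_avoidingComponent.2 hvB), hc, add_zero]
      exact Nat.le_add_left _ _
    · by_cases hvA : v ∈ A
      · rw [if_pos hvA, if_neg hvB]
        rw [mem_avoidingComponent] at hvA
        have h1 := card_avoidingComponent_lt hG hz hvA.symm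
        have hc : (avoidingComponent G z v).card = A.card := by
          rw [hA, avoidingComponent_eq hvA]
        rw [hc] at h1 ⊢
        have h2 : 3 ^ (A.card + 1) ≤ 3 ^ (avoidingComponent G b v).card :=
          Nat.pow_le_pow_right (by norm_num) h1
        rw [pow_succ] at h2
        omega
      · rw [if_neg hvA, if_neg hvB, add_zero, add_zero]
        refine Nat.pow_le_pow_right (by norm_num) (Finset.card_le_card
          (avoidingComponent_subset hz fun h => hvB ?_))
        exact mem_avoidingComponent.2 h.symm
  have hsum := Finset.sum_le_sum fun v (_ : v ∈ Finset.univ) => key v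
  simp only [Finset.sum_add_distrib, Finset.sum_ite_mem, Finset.univ_inter, Finset.sum_const,
    smul_eq_mul] at hsum
  have h1 : B.card * 3 ^ B.card ≤ A.card * 3 ^ A.card :=
    Nat.mul_le_mul hle (Nat.pow_le_pow_right (by norm_num) hle)
  have h2 : 0 < A.card * 3 ^ A.card :=
    Nat.mul_pos (Finset.card_pos.2 ⟨a, haA⟩) (by positivity)
  have h3 : A.card * (2 * 3 ^ A.card) = 2 * (A.card * 3 ^ A.card) := by ring
  rw [h3] at hsum
  unfold componentWeight
  omega

/-- In an AT-free graph a set with at least two vertices has, apart from any given vertex `x`,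
a further vertex that is not between two vertices of the set. -/
theorem exists_extreme_ne (hG : IsATFree G) (X : Set V) (x : V) (hX : ∃ y ∈ X, y ≠ x) :
    ∃ z ∈ X, z ≠ x ∧ ∀ a ∈ X, ∀ b ∈ X, ¬ Between G a b z := by
  classical
  let S : Finset V := Finset.univ.filter fun y => y ∈ X ∧ y ≠ x
  let f : V → ℕ ×ₗ ℕ := fun z => toLex ((avoidingComponent G z x).card, componentWeight G z)
  obtain ⟨y, hy, hyx⟩ := hX
  obtain ⟨z, hz, hmax⟩ := S.exists_max_image f ⟨y, by simp [S, hy, hyx]⟩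
  have hz' : z ∈ X ∧ z ≠ x := by simpa [S] using hz
  -- The component of `x` cannot grow, and if it keeps its size then the weight cannot grow.
  have hcard : ∀ c ∈ X, c ≠ x →
      (avoidingComponent G c x).card ≤ (avoidingComponent G z x).card := by
    intro c hc hcx
    have := hmax c (by simp [S, hc, hcx])
    rw [Prod.Lex.toLex_le_toLex] at this
    rcases this with h | h
    exacts [h.le, h.1.le]
  have hweight : ∀ c ∈ X, c ≠ x →
      (avoidingComponent G z x).card ≤ (avoidingComponent G c x).card →
      componentWeight G c ≤ componentWeight G z := by
    intro c hc hcx hle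
    have := hmax c (by simp [S, hc, hcx])
    rw [Prod.Lex.toLex_le_toLex] at this
    rcases this with h | h
    · exact absurd h (not_lt.2 hle)
    · exact h.2
  refine ⟨z, hz'.1, hz'.2, fun a ha b hb hab => ?_⟩
  -- If the component of `x` contained `a`, then it would grow on passing from `z` to `b`.
  have step : ∀ a ∈ X, ∀ b ∈ X, Between G a b z → ¬ JoinedAvoiding G x a z := by
    intro a _ b hb hab hxa
    have hbx : b ≠ x := by
      rintro rfl
      exact hG a b z ⟨hxa.symm, hab.2.symm, hab.1.symm⟩
    exact absurd (card_avoidingComponent_lt hG hab hxa) (not_lt.2 (hcard b hb hbx))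
  have hxa := step a ha b hb hab
  have hxb := step b hb a ha hab.symm
  have hself : ∀ a b, Between G a b z → JoinedAvoiding G a a z := by
    intro a b hab
    obtain ⟨h1, h2⟩ := hab.2.left
    exact .refl h1.symm fun h => h2 h.symm
  have hax : a ≠ x := by rintro rfl; exact hxa (hself _ _ hab)
  have hbx : b ≠ x := by rintro rfl; exact hxb (hself _ _ hab.symm)
  -- So neither `a` nor `b` is in that component, which is not diminished on passing to either of
  -- them; passing away from the larger of the components of `a` and `b` increases the weight.
  rcases le_total (avoidingComponent G z b).card (avoidingComponent G z a).card with h | h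
  · exact absurd (componentWeight_lt hG hab h) (not_lt.2 (hweight b hb hbx
      (Finset.card_le_card (avoidingComponent_subset hab hxb))))
  · exact absurd (componentWeight_lt hG hab.symm h) (not_lt.2 (hweight a ha hax
      (Finset.card_le_card (avoidingComponent_subset hab.symm hxa))))

end Extreme

/-! ### Cycles of two alternating involutions -/

/-- Two involutions `f` and `g` of the finite set `S`, both of which flip the sign `ε`. The graph on
`S` formed by the edges `p — f p` and `p — g p` is a disjoint union of cycles. -/
structure AlternatingPair {α : Type*} (f g : α → α) (S : Set α) (ε : α → Bool) : Prop where
  finite : S.Finite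
  maps_left : ∀ p ∈ S, f p ∈ S
  maps_right : ∀ p ∈ S, g p ∈ S
  invol_left : ∀ p ∈ S, f (f p) = p
  invol_right : ∀ p ∈ S, g (g p) = p
  sign_left : ∀ p ∈ S, ε (f p) = !ε p
  sign_right : ∀ p ∈ S, ε (g p) = !ε p

namespace AlternatingPair

variable {α : Type*} {f g : α → α} {S : Set α} {ε : α → Bool} {p q : α}

theorem symm (h : AlternatingPair f g S ε) : AlternatingPair g f S ε :=
  ⟨h.1, h.3, h.2, h.5, h.4, h.7, h.6⟩

theorem iterate_mem (h : AlternatingPair f g S ε) (hp : p ∈ S) (i : ℕ) : (g ∘ f)^[i] p ∈ S := by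
  induction i with
  | zero => exact hp
  | succ i ih =>
    rw [Function.iterate_succ_apply']
    exact h.maps_right _ (h.maps_left _ ih)

theorem sign_iterate (h : AlternatingPair f g S ε) (hp : p ∈ S) (i : ℕ) :
    ε ((g ∘ f)^[i] p) = ε p := by
  induction i with
  | zero => rfl
  | succ i ih =>
    have hi := h.iterate_mem hp i
    rw [Function.iterate_succ_apply', Function.comp_apply, h.sign_right _ (h.maps_left _ hi),
      h.sign_left _ hi, ih, Bool.not_not]

/-- The two sides have different signs. -/
theorem iterate_ne (h : AlternatingPair f g S ε) (hp : p ∈ S) (i j : ℕ) :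
    (g ∘ f)^[i] p ≠ f ((g ∘ f)^[j] p) := by
  intro he
  have := congrArg ε he
  rw [h.sign_left _ (h.iterate_mem hp j), h.sign_iterate hp, h.sign_iterate hp] at this
  simp at this

theorem minimalPeriod_pos (h : AlternatingPair f g S ε) (hp : p ∈ S) :
    0 < Function.minimalPeriod (g ∘ f) p := by
  apply Function.minimalPeriod_pos_of_mem_periodicPts
  let F : S → S := fun x => ⟨g (f x), h.maps_right _ (h.maps_left _ x.2)⟩
  have hF : Function.Injective F := by
    rintro ⟨x, hx⟩ ⟨y, hy⟩ hxy
    have h1 : g (f x) = g (f y) := congrArg Subtype.val hxy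
    have h2 : f x = f y := by
      rw [← h.invol_right _ (h.maps_left _ hx), h1, h.invol_right _ (h.maps_left _ hy)]
    have h3 : x = y := by rw [← h.invol_left _ hx, h2, h.invol_left _ hy]
    exact Subtype.ext h3
  have hfin : Finite S := h.finite
  obtain ⟨k, hk, hk'⟩ := hF.mem_periodicPts ⟨p, hp⟩
  refine ⟨k, hk, ?_⟩
  have hval : ∀ i, ((F^[i] ⟨p, hp⟩ : S) : α) = (g ∘ f)^[i] p := by
    intro i
    induction i with
    | zero => rfl
    | succ i ih => rw [Function.iterate_succ_apply', Function.iterate_succ_apply', ← ih]; rfl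
  have := congrArg Subtype.val hk'
  rwa [hval] at this

/-- A cycle stays connected when one of its edges is removed. -/
theorem reflTransGen_of_removed_edge (h : AlternatingPair f g S ε) (hp : p ∈ S) :
    Relation.ReflTransGen (fun a b => a ∈ S ∧ (b = f a ∨ (b = g a ∧ a ≠ p ∧ a ≠ g p)))
      p (g p) := by
  set k := Function.minimalPeriod (g ∘ f) p with hk
  have hkpos : 0 < k := h.minimalPeriod_pos hp
  have hmem := h.iterate_mem hp
  -- Follow the cycle from `p` in the direction of `f`, all the way round.
  have key : ∀ j < k, Relation.ReflTransGen
      (fun a b => a ∈ S ∧ (b = f a ∨ (b = g a ∧ a ≠ p ∧ a ≠ g p))) p (f ((g ∘ f)^[j] p)) := by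
    intro j
    induction j with
    | zero => exact fun _ => .single ⟨hp, .inl rfl⟩
    | succ j ih =>
      intro hj
      refine ((ih (by omega)).tail (c := (g ∘ f)^[j + 1] p) ?_).tail ⟨hmem _, .inl rfl⟩
      refine ⟨h.maps_left _ (hmem j), .inr ⟨?_, (h.iterate_ne hp 0 j).symm, fun he => ?_⟩⟩
      · rw [Function.iterate_succ_apply']
        rfl
      · have : (g ∘ f)^[j + 1] p = p := by
          rw [Function.iterate_succ_apply', Function.comp_apply, he, h.invol_right _ hp]
        exact Function.not_isPeriodicPt_of_pos_of_lt_minimalPeriod (by omega) hj this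
  have hlast : f ((g ∘ f)^[k - 1] p) = g p := by
    have h1 : (g ∘ f)^[k] p = p := Function.isPeriodicPt_minimalPeriod (g ∘ f) p
    obtain ⟨m, hm⟩ : ∃ m, k = m + 1 := ⟨k - 1, by omega⟩
    rw [hm, Function.iterate_succ_apply', Function.comp_apply] at h1
    rw [hm, Nat.add_sub_cancel]
    conv_rhs => rw [← h1]
    rw [h.invol_right _ (h.maps_left _ (hmem m))]
  exact (congrArg _ hlast).mp (key (k - 1) (by omega))

/-- If the alternating cycles form a single cycle, then it is swept out by the iterates of `g ∘ f`
and their images under `f`. -/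
theorem exists_iterate (h : AlternatingPair f g S ε) (hp : p ∈ S)
    (hq : Relation.ReflTransGen (fun a b => b = f a ∨ b = g a) p q) :
    ∃ i < Function.minimalPeriod (g ∘ f) p, q = (g ∘ f)^[i] p ∨ q = f ((g ∘ f)^[i] p) := by
  set k := Function.minimalPeriod (g ∘ f) p with hk
  have hkpos : 0 < k := h.minimalPeriod_pos hp
  have hmem := h.iterate_mem hp
  have hper : (g ∘ f)^[k] p = p := Function.isPeriodicPt_minimalPeriod (g ∘ f) p
  have hsucc : ∀ i, g (f ((g ∘ f)^[i] p)) = (g ∘ f)^[i + 1] p := fun i => by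
    rw [Function.iterate_succ_apply']
    rfl
  induction hq with
  | refl => exact ⟨0, hkpos, .inl rfl⟩
  | tail _ hab ih =>
    obtain ⟨i, hi, rfl | rfl⟩ := ih
    · rcases hab with rfl | rfl
      · exact ⟨i, hi, .inr rfl⟩
      · rcases i with _ | i
        · refine ⟨k - 1, by omega, .inr ?_⟩
          have h1 := hsucc (k - 1)
          rw [Nat.sub_add_cancel hkpos, hper] at h1
          rw [← h.invol_right _ (h.maps_left _ (hmem (k - 1))), h1]
          rfl
        · refine ⟨i, by omega, .inr ?_⟩
          rw [← hsucc, h.invol_right _ (h.maps_left _ (hmem i))]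
    · rcases hab with rfl | rfl
      · exact ⟨i, hi, .inl (h.invol_left _ (hmem i))⟩
      · rw [hsucc]
        rcases Nat.lt_or_ge (i + 1) k with h1 | h1
        · exact ⟨i + 1, h1, .inl rfl⟩
        · refine ⟨0, hkpos, .inl ?_⟩
          rw [show i + 1 = k by omega, hper]
          rfl

end AlternatingPair

/-- The walk through the first terms of a sequence of vertices. -/
def walkOfSeq {X : Type*} {H : SimpleGraph X} :
    ∀ (v : ℕ → X) (_ : ∀ i, H.Adj (v i) (v (i + 1))) (k : ℕ), H.Walk (v 0) (v k)
  | _, _, 0 => SimpleGraph.Walk.nil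
  | v, h, k + 1 => SimpleGraph.Walk.cons (h 0)
      (walkOfSeq (fun i => v (i + 1)) (fun i => h (i + 1)) k)

section Walk

variable {X : Type*} {H : SimpleGraph X}

theorem length_walkOfSeq (v : ℕ → X) (h : ∀ i, H.Adj (v i) (v (i + 1))) (k : ℕ) :
    (walkOfSeq v h k).length = k := by
  induction k generalizing v with
  | zero => rfl
  | succ k ih => simp [walkOfSeq, ih]

theorem getVert_walkOfSeq (v : ℕ → X) (h : ∀ i, H.Adj (v i) (v (i + 1))) {k i : ℕ} (hi : i ≤ k) :
    (walkOfSeq v h k).getVert i = v i := by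
  induction k generalizing v i with
  | zero =>
    obtain rfl : i = 0 := by omega
    rfl
  | succ k ih =>
    rcases i with _ | i
    · simp
    · simp [walkOfSeq, ih (fun i => v (i + 1)) (fun i => h (i + 1)) (i := i) (by omega)]

/-- A closed sequence of successively adjacent vertices that repeats no vertex and contains all of
them is a Hamiltonian cycle. -/
theorem exists_isHamiltonianCycle [DecidableEq X] (v : ℕ → X) (h : ∀ i, H.Adj (v i) (v (i + 1)))
    {k : ℕ} (hk : 3 ≤ k) (hclosed : v k = v 0) (hinj : ∀ i < k, ∀ j < k, v i = v j → i = j)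
    (hsurj : ∀ x, ∃ i < k, v i = x) :
    ∃ p : H.Walk (v 0) (v 0), p.IsHamiltonianCycle ∧ p.length = k ∧
      ∀ i ≤ k, p.getVert i = v i := by
  obtain ⟨p, hlen, hget⟩ : ∃ p : H.Walk (v 0) (v 0), p.length = k ∧
      ∀ i ≤ k, p.getVert i = v i := by
    refine ⟨(walkOfSeq v h k).copy rfl hclosed, ?_, fun i hi => ?_⟩
    · rw [SimpleGraph.Walk.length_copy, length_walkOfSeq]
    · rw [SimpleGraph.Walk.getVert_copy, getVert_walkOfSeq v h hi]
  have hnil : ¬ p.Nil := by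
    rw [← SimpleGraph.Walk.length_eq_zero_iff]
    omega
  have htail : p.tail.length = k - 1 := by
    have := SimpleGraph.Walk.length_tail_add_one hnil
    omega
  have hget' : ∀ i < k, p.tail.getVert i = v (i + 1) := fun i hi => by
    rw [SimpleGraph.Walk.getVert_tail, hget _ (by omega)]
  have hpath : p.tail.IsPath := by
    rw [SimpleGraph.Walk.isPath_iff_injective_get_support]
    rintro ⟨i, hi⟩ ⟨j, hj⟩ hij
    simp only [List.get_eq_getElem, SimpleGraph.Walk.support_getElem_eq_getVert] at hij
    rw [SimpleGraph.Walk.length_support, htail] at hi hj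
    rw [hget' i (by omega), hget' j (by omega)] at hij
    apply Fin.ext
    change i = j
    by_cases h1 : i + 1 = k
    · by_cases h2 : j + 1 = k
      · omega
      · rw [h1, hclosed] at hij
        have := hinj 0 (by omega) (j + 1) (by omega) hij
        omega
    · by_cases h2 : j + 1 = k
      · rw [h2, hclosed] at hij
        have := hinj (i + 1) (by omega) 0 (by omega) hij
        omega
      · have := hinj (i + 1) (by omega) (j + 1) (by omega) hij
        omega
  refine ⟨p, ⟨SimpleGraph.Walk.isCycle_iff_isPath_tail_and_le_length.2 ⟨hpath, by omega⟩, ?_⟩,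
    hlen, hget⟩
  refine hpath.isHamiltonian_of_mem fun x => ?_
  obtain ⟨i, hi, rfl⟩ := hsurj x
  rw [SimpleGraph.Walk.mem_support_iff_exists_getVert]
  -- The tail of the walk visits `v 0` last.
  rcases i with _ | i
  · exact ⟨k - 1, by rw [hget' _ (by omega), Nat.sub_add_cancel (by omega), hclosed], by omega⟩
  · exact ⟨i, hget' i (by omega), by omega⟩

end Walk

/-! ### Feasible words of a convex betweenness -/

/-- A betweenness relation, `bt x y z` meaning that `z` is between `x` and `y`, for which every set
with at least two elements has an extreme element other than any prescribed one. -/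
structure IsConvexBetweenness {V : Type*} (bt : V → V → V → Prop) : Prop where
  not_self : ∀ x z, ¬ bt x x z
  exists_extreme : ∀ (X : Set V) (x : V), (∃ y ∈ X, y ≠ x) →
    ∃ z ∈ X, z ≠ x ∧ ∀ a ∈ X, ∀ b ∈ X, ¬ bt a b z

section Words

variable {V : Type*} (bt : V → V → V → Prop)

/-- The letter `z` of `l` is not between two letters of `l`: it may come first when the letters of
`l` are to be ordered. -/
def Feasible (l : List V) (z : V) : Prop :=
  z ∈ l ∧ ∀ x ∈ l, ∀ y ∈ l, ¬ bt x y z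

/-- Every letter is feasible for the suffix that it starts. -/
def FeasibleWord : List V → Prop
  | [] => True
  | x :: r => Feasible bt (x :: r) x ∧ FeasibleWord r

variable {bt}

theorem feasible_congr {l l' : List V} (h : ∀ v, v ∈ l ↔ v ∈ l') {z : V} :
    Feasible bt l z ↔ Feasible bt l' z := by
  simp only [Feasible, h]

theorem Feasible.mono {l l' : List V} (h : ∀ v ∈ l', v ∈ l) {z : V} (hz : Feasible bt l z)
    (hzl : z ∈ l') : Feasible bt l' z :=
  ⟨hzl, fun x hx y hy => hz.2 x (h x hx) y (h y hy)⟩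

theorem IsConvexBetweenness.exists_feasible_ne (hbt : IsConvexBetweenness bt) {l : List V} {x : V}
    (h : ∃ y ∈ l, y ≠ x) : ∃ z, z ≠ x ∧ Feasible bt l z := by
  obtain ⟨z, hz, hzx, he⟩ := hbt.exists_extreme {v | v ∈ l} x h
  exact ⟨z, hzx, hz, he⟩

theorem IsConvexBetweenness.feasible_singleton (hbt : IsConvexBetweenness bt) (x : V) :
    Feasible bt [x] x := by
  refine ⟨by simp, fun a ha b hb => ?_⟩
  obtain rfl : a = x := by simpa using ha
  obtain rfl : b = a := by simpa using hb
  exact hbt.not_self _ _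

theorem IsConvexBetweenness.exists_feasible (hbt : IsConvexBetweenness bt) {l : List V}
    (h : l ≠ []) : ∃ z, Feasible bt l z := by
  obtain ⟨a, r, rfl⟩ := List.exists_cons_of_ne_nil h
  by_cases h' : ∃ y ∈ a :: r, y ≠ a
  · obtain ⟨z, -, hz⟩ := hbt.exists_feasible_ne h'
    exact ⟨z, hz⟩
  · push Not at h'
    refine ⟨a, (feasible_congr fun v => ?_).1 (hbt.feasible_singleton a)⟩
    constructor
    · intro hv
      obtain rfl : v = a := by simpa using hv
      simp
    · intro hv
      simp [h' v hv]

theorem IsConvexBetweenness.feasible_pair (hbt : IsConvexBetweenness bt) {a b : V} (hab : a ≠ b) :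
    Feasible bt [a, b] a := by
  obtain ⟨z, hz, hf⟩ := hbt.exists_feasible_ne (l := [a, b]) (x := b) ⟨a, by simp, hab⟩
  obtain rfl : z = a := by simpa [hz] using hf.1
  exact hf

theorem mem_swap (x y : V) (r : List V) (v : V) : v ∈ x :: y :: r ↔ v ∈ y :: x :: r := by
  simp only [List.mem_cons]
  tauto

theorem mem_cons_cons_congr {r r' : List V} (h : r.Perm r') (x y : V) (v : V) :
    v ∈ x :: y :: r ↔ v ∈ x :: y :: r' := by
  simp only [List.mem_cons, h.mem_iff]

theorem feasibleWord_cons_congr {x : V} {r r' : List V} (h : r.Perm r')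
    (hx : FeasibleWord bt (x :: r)) (hr : FeasibleWord bt r') : FeasibleWord bt (x :: r') :=
  ⟨(feasible_congr fun v => by simp [h.mem_iff]).1 hx.1, hr⟩

theorem AdjacentTransposition.cons {u v : List V} (h : AdjacentTransposition u v) (x : V) :
    AdjacentTransposition (x :: u) (x :: v) := by
  obtain ⟨p, s, a, b, hab, rfl, rfl⟩ := h
  exact ⟨x :: p, s, a, b, hab, rfl, rfl⟩

variable [LinearOrder V] (bt)

/-- `h` is the hub of `l`, its least feasible letter. -/
def IsFirst (l : List V) (h : V) : Prop :=
  Feasible bt l h ∧ ∀ z, Feasible bt l z → h ≤ z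

/-- `g` is the greatest feasible letter of `l`. -/
def IsLast (l : List V) (g : V) : Prop :=
  Feasible bt l g ∧ ∀ z, Feasible bt l z → z ≤ g

/-- The first two letters of `x :: y :: r` may be exchanged, and one of them is the hub: the blocks
of words that start with `x` and with `y` are to be linked. -/
def Linkable (x y : V) (r : List V) : Prop :=
  Feasible bt (x :: y :: r) x ∧ Feasible bt (x :: y :: r) y ∧
    (IsFirst bt (x :: y :: r) x ∨ IsFirst bt (x :: y :: r) y)

/-- The canonical word of a set starts with its hub and its greatest feasible letter and continues
with the canonical word of the remaining set. -/
def Canonical : List V → Prop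
  | x :: y :: r => IsFirst bt (x :: y :: r) x ∧ IsLast bt (x :: y :: r) y ∧ Canonical r
  | _ => True

/-- The word is canonical, or becomes so when its first two letters are exchanged. -/
def SemiCanonical : List V → Prop
  | x :: y :: r => Canonical bt r ∧ ((IsFirst bt (x :: y :: r) x ∧ IsLast bt (x :: y :: r) y) ∨
      (IsFirst bt (x :: y :: r) y ∧ IsLast bt (x :: y :: r) x))
  | _ => True

/-- `(r, s)` is an end of the special edge of the cycle for the letters of `r`. If there are at
least two letters, this edge joins, in the copy `false`, the two semicanonical words; otherwise
it joins the two copies of the only word. -/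
def IsSpecial (r : List V) (s : Bool) : Prop :=
  r.length ≤ 1 ∨ (s = false ∧ SemiCanonical bt r)

open Classical in
/-- One of the two edges at a vertex of the cycle. At the outermost even position where a link
applies, two adjacent letters are exchanged; if there is none, the copy is changed. -/
noncomputable def move (s : Bool) : List V → List V × Bool
  | x :: y :: r => if Linkable bt x y r ∧ IsSpecial bt r s then (y :: x :: r, s)
      else (x :: y :: (move s r).1, (move s r).2)
  | l => (l, !s)

/-- The other edge at a vertex of the cycle: the edge `move` of the word without its first
letter. -/
noncomputable def tailMove (s : Bool) : List V → List V × Bool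
  | x :: l => (x :: (move bt s l).1, (move bt s l).2)
  | [] => ([], !s)

variable {bt}

theorem isFirst_congr {l l' : List V} (h : ∀ v, v ∈ l ↔ v ∈ l') {z : V} :
    IsFirst bt l z ↔ IsFirst bt l' z := by
  simp only [IsFirst, feasible_congr h]

theorem isLast_congr {l l' : List V} (h : ∀ v, v ∈ l ↔ v ∈ l') {z : V} :
    IsLast bt l z ↔ IsLast bt l' z := by
  simp only [IsLast, feasible_congr h]

theorem IsFirst.unique {l : List V} {a b : V} (ha : IsFirst bt l a) (hb : IsFirst bt l b) :
    a = b :=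
  le_antisymm (ha.2 _ hb.1) (hb.2 _ ha.1)

theorem IsLast.unique {l : List V} {a b : V} (ha : IsLast bt l a) (hb : IsLast bt l b) : a = b :=
  le_antisymm (hb.2 _ ha.1) (ha.2 _ hb.1)

theorem exists_isFirst {l : List V} (h : ∃ z, Feasible bt l z) : ∃ z, IsFirst bt l z := by
  classical
  obtain ⟨z, hz⟩ := h
  obtain ⟨m, hm, hmin⟩ := (l.toFinset.filter (Feasible bt l)).exists_min_image id
    ⟨z, by simp [hz, hz.1]⟩
  simp only [Finset.mem_filter, List.mem_toFinset, id_eq] at hm hmin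
  exact ⟨m, hm.2, fun z hz => hmin z ⟨hz.1, hz⟩⟩

theorem exists_isLast {l : List V} (h : ∃ z, Feasible bt l z) : ∃ z, IsLast bt l z := by
  classical
  obtain ⟨z, hz⟩ := h
  obtain ⟨m, hm, hmax⟩ := (l.toFinset.filter (Feasible bt l)).exists_max_image id
    ⟨z, by simp [hz, hz.1]⟩
  simp only [Finset.mem_filter, List.mem_toFinset, id_eq] at hm hmax
  exact ⟨m, hm.2, fun z hz => hmax z ⟨hz.1, hz⟩⟩

theorem IsConvexBetweenness.first_ne_last (hbt : IsConvexBetweenness bt) {l : List V}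
    (hl : l.Nodup) (h2 : 2 ≤ l.length) {a b : V} (ha : IsFirst bt l a) (hb : IsLast bt l b) :
    a ≠ b := by
  rintro rfl
  have hex : ∃ y ∈ l, y ≠ a := by
    by_contra! hall
    have : l ⊆ [a] := fun y hy => by simp [hall y hy]
    have := (List.subperm_of_subset hl this).length_le
    simp at this
    omega
  obtain ⟨z, hz, hf⟩ := hbt.exists_feasible_ne hex
  exact hz (le_antisymm (hb.2 _ hf) (ha.2 _ hf))

theorem Linkable.swap {x y : V} {r : List V} (h : Linkable bt x y r) : Linkable bt y x r :=
  ⟨(feasible_congr (mem_swap x y r)).1 h.2.1, (feasible_congr (mem_swap x y r)).1 h.1,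
    h.2.2.symm.imp (isFirst_congr (mem_swap x y r)).1 (isFirst_congr (mem_swap x y r)).1⟩

theorem linkable_congr {x y : V} {r r' : List V} (h : r.Perm r') :
    Linkable bt x y r ↔ Linkable bt x y r' := by
  simp only [Linkable, feasible_congr (mem_cons_cons_congr h x y),
    isFirst_congr (mem_cons_cons_congr h x y)]

theorem Canonical.semiCanonical : ∀ {l : List V}, Canonical bt l → SemiCanonical bt l
  | [], _ => trivial
  | [_], _ => trivial
  | _ :: _ :: _, h => ⟨h.2.2, .inl ⟨h.1, h.2.1⟩⟩

theorem SemiCanonical.swap {x y : V} {r : List V} (h : SemiCanonical bt (x :: y :: r)) :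
    SemiCanonical bt (y :: x :: r) :=
  ⟨h.1, h.2.symm.imp
    (fun h => ⟨(isFirst_congr (mem_swap x y r)).1 h.1, (isLast_congr (mem_swap x y r)).1 h.2⟩)
    (fun h => ⟨(isFirst_congr (mem_swap x y r)).1 h.1, (isLast_congr (mem_swap x y r)).1 h.2⟩)⟩

theorem SemiCanonical.linkable {x y : V} {r : List V} (h : SemiCanonical bt (x :: y :: r)) :
    Linkable bt x y r := by
  rcases h.2 with h | h
  · exact ⟨h.1.1, h.2.1, .inl h.1⟩
  · exact ⟨h.2.1, h.1.1, .inr h.1⟩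

theorem SemiCanonical.isSpecial {x y : V} {r : List V} (h : SemiCanonical bt (x :: y :: r)) :
    IsSpecial bt r false :=
  .inr ⟨rfl, h.1.semiCanonical⟩

theorem move_of_semiCanonical {x y : V} {r : List V} (h : SemiCanonical bt (x :: y :: r)) :
    move bt false (x :: y :: r) = (y :: x :: r, false) := by
  rw [move, if_pos ⟨h.linkable, h.isSpecial⟩]

theorem move_perm (s : Bool) : ∀ l : List V, (move bt s l).1.Perm l
  | [] => List.Perm.refl _
  | [_] => List.Perm.refl _
  | x :: y :: r => by
    rw [move]
    split_ifs
    · exact List.Perm.swap _ _ _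
    · exact ((move_perm s r).cons _).cons _

theorem tailMove_perm (s : Bool) : ∀ l : List V, (tailMove bt s l).1.Perm l
  | [] => List.Perm.refl _
  | _ :: _ => (move_perm s _).cons _

theorem feasibleWord_swap {x y : V} {r : List V} (h : FeasibleWord bt (x :: y :: r))
    (hl : Linkable bt x y r) : FeasibleWord bt (y :: x :: r) :=
  ⟨hl.swap.1, h.1.mono (fun v hv => by simp at hv ⊢; tauto) (by simp), h.2.2⟩

theorem feasibleWord_move (s : Bool) :
    ∀ l : List V, FeasibleWord bt l → FeasibleWord bt (move bt s l).1
  | [], h => h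
  | [_], h => h
  | x :: y :: r, h => by
    rw [move]
    split_ifs with hc
    · exact feasibleWord_swap h hc.1
    · exact feasibleWord_cons_congr ((move_perm s r).symm.cons y) h
        (feasibleWord_cons_congr (move_perm s r).symm h.2 (feasibleWord_move s r h.2.2))

theorem feasibleWord_tailMove (s : Bool) :
    ∀ l : List V, FeasibleWord bt l → FeasibleWord bt (tailMove bt s l).1
  | [], h => h
  | _ :: _, h => feasibleWord_cons_congr (move_perm s _).symm h (feasibleWord_move s _ h.2)

theorem isSpecial_move_of_isSpecial {s : Bool} :
    ∀ {l : List V}, IsSpecial bt l s → IsSpecial bt (move bt s l).1 (move bt s l).2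
  | [], _ => .inl (by simp [move])
  | [_], _ => .inl (by simp [move])
  | x :: y :: r, h => by
    rcases h with h | ⟨rfl, h⟩
    · simp at h
    · rw [move_of_semiCanonical h]
      exact .inr ⟨rfl, h.swap⟩

/-- A move is an involution: it does not affect whether an outer link applies, since it keeps the
set of letters and the special edge. -/
theorem move_move (s : Bool) : ∀ l : List V, move bt (move bt s l).2 (move bt s l).1 = (l, s)
  | [] => by simp [move]
  | [_] => by simp [move]
  | x :: y :: r => by
    have ih := move_move s r
    rw [move]
    split_ifs with hc
    · rw [move, if_pos ⟨hc.1.swap, hc.2⟩]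
    · rw [move, if_neg, ih]
      rintro ⟨h1, h2⟩
      have h3 := isSpecial_move_of_isSpecial h2
      rw [ih] at h3
      exact hc ⟨(linkable_congr (move_perm s r)).1 h1, h3⟩

theorem tailMove_tailMove (s : Bool) (l : List V) :
    tailMove bt (tailMove bt s l).2 (tailMove bt s l).1 = (l, s) := by
  rcases l with _ | ⟨x, l⟩
  · simp [tailMove]
  · simp [tailMove, move_move]

/-! ### The effect of a move -/

/-- The parity of the number of inversions of a word. -/
def inversionParity : List V → Bool
  | [] => false
  | x :: r => xor (decide (Odd (r.countP (· < x)))) (inversionParity r)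

theorem inversionParity_swap {x y : V} (h : x ≠ y) (r : List V) :
    inversionParity (y :: x :: r) = !inversionParity (x :: y :: r) := by
  rcases lt_or_gt_of_ne h with h' | h' <;>
    simp [inversionParity, h', h'.not_gt, Nat.odd_add_one] <;>
    by_cases h1 : Odd (r.countP (· < x)) <;> by_cases h2 : Odd (r.countP (· < y)) <;>
    simp [h1, h2, ← Nat.not_odd_iff_even]

/-- The parity of the word and of the copy together: a two-colouring of the prism. -/
def prismSign (p : List V × Bool) : Bool := xor (inversionParity p.1) p.2

theorem prismSign_cons {x : V} {p q : List V × Bool} (h : q.1.Perm p.1)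
    (hs : prismSign q = !prismSign p) : prismSign (x :: q.1, q.2) = !prismSign (x :: p.1, p.2) := by
  simp only [prismSign, inversionParity, h.countP_eq] at hs ⊢
  rw [Bool.xor_assoc, hs, Bool.xor_assoc]
  simp

theorem prismSign_move (s : Bool) :
    ∀ l : List V, l.Nodup → prismSign (move bt s l) = !prismSign (l, s)
  | [], _ => by simp [move, prismSign]
  | [_], _ => by simp [move, prismSign]
  | x :: y :: r, h => by
    have hxy : x ≠ y := by
      rintro rfl
      simp at h
    rw [move]
    split_ifs
    · simp only [prismSign, inversionParity_swap hxy]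
      simp
    · have h1 := prismSign_move s r (List.nodup_cons.1 (List.nodup_cons.1 h).2).2
      have h2 : prismSign (y :: (move bt s r).1, (move bt s r).2) = !prismSign (y :: r, s) :=
        prismSign_cons (p := (r, s)) (move_perm s r) h1
      exact prismSign_cons (p := (y :: r, s)) (q := (y :: (move bt s r).1, (move bt s r).2))
        ((move_perm s r).cons y) h2

theorem prismSign_tailMove (s : Bool) {l : List V} (h : l.Nodup) :
    prismSign (tailMove bt s l) = !prismSign (l, s) := by
  rcases l with _ | ⟨x, l⟩
  · simp [tailMove, prismSign]
  · exact prismSign_cons (p := (l, s)) (move_perm s l) (prismSign_move s l (List.nodup_cons.1 h).2)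

/-- A move changes the copy or exchanges two adjacent letters. -/
theorem move_eq_or (s : Bool) : ∀ l : List V, l.Nodup →
    move bt s l = (l, !s) ∨ (AdjacentTransposition l (move bt s l).1 ∧ (move bt s l).2 = s)
  | [], _ => .inl rfl
  | [_], _ => .inl rfl
  | x :: y :: r, h => by
    have hxy : x ≠ y := by
      rintro rfl
      simp at h
    rw [move]
    split_ifs
    · exact .inr ⟨⟨[], r, x, y, hxy, rfl, rfl⟩, rfl⟩
    · refine (move_eq_or s r (List.nodup_cons.1 (List.nodup_cons.1 h).2).2).imp (fun h => ?_)
        fun h => ⟨(h.1.cons y).cons x, h.2⟩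
      rw [h]

theorem tailMove_eq_or (s : Bool) {l : List V} (h : l.Nodup) :
    tailMove bt s l = (l, !s) ∨
      (AdjacentTransposition l (tailMove bt s l).1 ∧ (tailMove bt s l).2 = s) := by
  rcases l with _ | ⟨x, l⟩
  · exact .inl rfl
  · refine (move_eq_or (bt := bt) s l (List.nodup_cons.1 h).2).imp (fun h => ?_)
      fun h => ⟨h.1.cons x, h.2⟩
    simp [tailMove, h]

theorem IsConvexBetweenness.linkable_pair (hbt : IsConvexBetweenness bt) {a b : V} (hab : a ≠ b) :
    Linkable bt a b [] := by
  have ha := hbt.feasible_pair hab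
  have hb := (feasible_congr (mem_swap b a [])).1 (hbt.feasible_pair hab.symm)
  obtain ⟨z, hz⟩ := exists_isFirst ⟨a, ha⟩
  refine ⟨ha, hb, ?_⟩
  have : z = a ∨ z = b := by simpa using hz.1.1
  rcases this with rfl | rfl
  exacts [.inl hz, .inr hz]

/-- On words of positive even length a move always exchanges two letters. -/
theorem IsConvexBetweenness.move_snd (hbt : IsConvexBetweenness bt) (s : Bool) :
    ∀ l : List V, l.Nodup → Even l.length → l ≠ [] → (move bt s l).2 = s
  | [], _, _, h => absurd rfl h
  | [_], _, h, _ => by simp at h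
  | x :: y :: r, h, he, _ => by
    rw [move]
    split_ifs with hc
    · rfl
    · refine hbt.move_snd s r (List.nodup_cons.1 (List.nodup_cons.1 h).2).2
        (by simpa [Nat.even_add_one] using he) ?_
      rintro rfl
      exact hc ⟨hbt.linkable_pair (by rintro rfl; simp at h), .inl (by simp)⟩

end Words

/-! ### The two kinds of moves form a single cycle -/

section Connectivity

variable {V : Type*} [LinearOrder V] {bt : V → V → V → Prop}

variable (bt) in
/-- The vertices of the prism over the feasible words with the letters of `l`. -/
def prismVertices (l : List V) : Set (List V × Bool) := {p | p.1.Perm l ∧ FeasibleWord bt p.1}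

variable (bt) in
/-- The relation of being joined by a sequence of moves. -/
def Linked : List V × Bool → List V × Bool → Prop :=
  Relation.ReflTransGen fun p q => q = move bt p.2 p.1 ∨ q = tailMove bt p.2 p.1

theorem alternatingPair {l : List V} (hl : l.Nodup) :
    AlternatingPair (fun p => move bt p.2 p.1) (fun p => tailMove bt p.2 p.1)
      (prismVertices bt l) prismSign where
  finite := by
    refine Set.Finite.subset (l.permutations.finite_toSet.prod (Set.finite_univ (α := Bool))) ?_
    rintro ⟨w, s⟩ hp
    exact ⟨List.mem_permutations.2 hp.1, trivial⟩
  maps_left p hp := ⟨(move_perm _ _).trans hp.1, feasibleWord_move _ _ hp.2⟩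
  maps_right p hp := ⟨(tailMove_perm _ _).trans hp.1, feasibleWord_tailMove _ _ hp.2⟩
  invol_left p _ := move_move p.2 p.1
  invol_right p _ := tailMove_tailMove p.2 p.1
  sign_left p hp := prismSign_move _ _ (hp.1.nodup_iff.2 hl)
  sign_right p hp := prismSign_tailMove _ (hp.1.nodup_iff.2 hl)

theorem Linked.symm {p q : List V × Bool} (h : Linked bt p q) : Linked bt q p := by
  have : Std.Symm fun p q : List V × Bool =>
      q = move bt p.2 p.1 ∨ q = tailMove bt p.2 p.1 := by
    refine ⟨fun a b hab => ?_⟩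
    rcases hab with rfl | rfl
    · exact .inl (move_move _ _).symm
    · exact .inr (tailMove_tailMove _ _).symm
  exact Relation.ReflTransGen.stdSymm.symm _ _ h

/-- Every set of letters has a canonical word, and this word is feasible. -/
theorem IsConvexBetweenness.exists_canonical (hbt : IsConvexBetweenness bt) :
    ∀ (k : ℕ) (l : List V), l.length = k → l.Nodup →
      ∃ r, r.Perm l ∧ Canonical bt r ∧ FeasibleWord bt r := by
  intro k
  induction k using Nat.strong_induction_on with
  | _ k ih =>
    intro l hk hl
    rcases l with _ | ⟨x, _ | ⟨y, t⟩⟩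
    · exact ⟨[], .refl _, trivial, trivial⟩
    · exact ⟨[x], .refl _, trivial, hbt.feasible_singleton x, trivial⟩
    · set l := x :: y :: t with hldef
      have hex := hbt.exists_feasible (l := l) (by simp [hldef])
      obtain ⟨a, ha⟩ := exists_isFirst hex
      obtain ⟨b, hb⟩ := exists_isLast hex
      have hab := hbt.first_ne_last hl (by simp [hldef]) ha hb
      have hbmem : b ∈ l.erase a := (List.mem_erase_of_ne hab.symm).2 hb.1.1
      have hperm : l.Perm (a :: b :: (l.erase a).erase b) :=
        (List.perm_cons_erase ha.1.1).trans ((List.perm_cons_erase hbmem).cons a)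
      have hlen := hperm.length_eq
      simp only [List.length_cons] at hlen
      obtain ⟨r, hr, hc, hf⟩ := ih _ (by omega) ((l.erase a).erase b) rfl
        ((hl.erase a).erase b)
      have hperm' : (a :: b :: r).Perm l := ((hr.cons b).cons a).trans hperm.symm
      have hmem : ∀ v, v ∈ l ↔ v ∈ a :: b :: r := fun v => hperm'.mem_iff.symm
      refine ⟨a :: b :: r, hperm', ⟨(isFirst_congr hmem).1 ha, (isLast_congr hmem).1 hb, hc⟩,
        (feasible_congr hmem).1 ha.1, ?_, hf⟩
      exact ((feasible_congr hmem).1 hb.1).mono (fun v hv => List.mem_cons_of_mem _ hv) (by simp)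

theorem Canonical.eq_of_perm : ∀ {r r' : List V}, Canonical bt r → Canonical bt r' →
    r.Perm r' → r = r'
  | [], _, _, _, h => (List.nil_perm.1 h).symm
  | [_], _, _, _, h => (List.singleton_perm.1 h)
  | x :: y :: r, r', hr, hr', h => by
    rcases r' with _ | ⟨x', _ | ⟨y', r'⟩⟩
    · simp at h
    · simp at h
    · have hmem : ∀ v, v ∈ x :: y :: r ↔ v ∈ x' :: y' :: r' := fun v => h.mem_iff
      obtain rfl := ((isFirst_congr hmem).1 hr.1).unique hr'.1
      obtain rfl := ((isLast_congr hmem).1 hr.2.1).unique hr'.2.1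
      rw [Canonical.eq_of_perm hr.2.2 hr'.2.2 (h.cons_inv.cons_inv)]

/-- A set of letters has only one special edge. -/
theorem IsSpecial.eq_or_eq_move {r r' : List V} {s s' : Bool} (h : IsSpecial bt r s)
    (h' : IsSpecial bt r' s') (hp : r.Perm r') : (r', s') = (r, s) ∨ (r', s') = move bt s r := by
  rcases r with _ | ⟨x, _ | ⟨y, r⟩⟩
  · obtain rfl := List.nil_perm.1 hp
    cases s <;> cases s' <;> simp [move]
  · obtain rfl := List.singleton_perm.1 hp
    cases s <;> cases s' <;> simp [move]
  · rcases r' with _ | ⟨x', _ | ⟨y', r'⟩⟩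
    · simp at hp
    · simp at hp
    obtain ⟨rfl, hc⟩ := h.resolve_left (by simp)
    obtain ⟨rfl, hc'⟩ := h'.resolve_left (by simp)
    have hmem : ∀ v, v ∈ x' :: y' :: r' ↔ v ∈ x :: y :: r := fun v => hp.mem_iff.symm
    have aux : ∀ {x y : V} {r : List V}, SemiCanonical bt (x :: y :: r) →
        (x :: y :: r).Perm (x' :: y' :: r') → x = x' → y = y' → r = r' := by
      rintro x y r h hp rfl rfl
      exact h.1.eq_of_perm hc'.1 hp.cons_inv.cons_inv
    rw [move_of_semiCanonical hc]
    have hcases : (x = x' ∧ y = y') ∨ (y = x' ∧ x = y') := by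
      rcases hc.2 with h1 | h1 <;> rcases hc'.2 with h2 | h2 <;>
        have e1 := h1.1.unique ((isFirst_congr hmem).1 h2.1) <;>
        have e2 := h1.2.unique ((isLast_congr hmem).1 h2.2) <;> tauto
    rcases hcases with ⟨e1, e2⟩ | ⟨e1, e2⟩
    · left
      rw [aux hc hp e1 e2, e1, e2]
    · right
      rw [aux hc.swap ((List.Perm.swap x y r).trans hp) e1 e2, e1, e2]

/-- In a block of words that start with a letter other than the hub, the links to other blocks
replace a single edge of the cycle of that block. So the block stays connected. -/
theorem linked_cons_of_ne {x h : V} {t : List V} (hxt : (x :: t).Nodup)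
    (hh : IsFirst bt (x :: t) h) (hxh : x ≠ h)
    (ih : ∀ p ∈ prismVertices bt t, ∀ q ∈ prismVertices bt t, Linked bt p q)
    {p q : List V × Bool} (hp : p ∈ prismVertices bt t) (hq : q ∈ prismVertices bt t) :
    Linked bt (x :: p.1, p.2) (x :: q.1, q.2) := by
  have ht : t.Nodup := (List.nodup_cons.1 hxt).2
  have alt := alternatingPair (bt := bt) ht
  have hmove : ∀ a : List V × Bool,
      Linked bt (x :: a.1, a.2) (x :: (move bt a.2 a.1).1, (move bt a.2 a.1).2) :=
    fun a => .single (.inr rfl)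
  have hne : ∀ a ∈ prismVertices bt t, ∃ y r, a.1 = y :: r := by
    rintro ⟨a, s⟩ ha
    rcases a with _ | ⟨y, r⟩
    · have : t = [] := List.nil_perm.1 ha.1
      subst this
      have := hh.1.1
      simp [hxh.symm] at this
    · exact ⟨y, r, rfl⟩
  have htail : ∀ (y : V) (r : List V) (s : Bool), ¬ (Linkable bt x y r ∧ IsSpecial bt r s) →
      Linked bt (x :: y :: r, s) (x :: (tailMove bt s (y :: r)).1, (tailMove bt s (y :: r)).2) := by
    intro y r s hc
    refine .single (.inl ?_)
    simp only [move, if_neg hc, tailMove]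
  -- Since `x` is not the hub, only words that continue with the hub are linked to another block.
  have hhub : ∀ (y : V) (r : List V), (y :: r).Perm t → Linkable bt x y r → y = h := by
    intro y r hr hlk
    have hmem : ∀ v, v ∈ x :: y :: r ↔ v ∈ x :: t := fun v => (hr.cons x).mem_iff
    rcases hlk.2.2 with h1 | h1
    · exact absurd (((isFirst_congr hmem).1 h1).unique hh) hxh
    · exact ((isFirst_congr hmem).1 h1).unique hh
  have hstep : ∀ a ∈ prismVertices bt t,
      Linked bt (x :: a.1, a.2) (x :: (tailMove bt a.2 a.1).1, (tailMove bt a.2 a.1).2) := by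
    intro a ha
    by_cases hc : ∃ y r, a.1 = y :: r ∧ Linkable bt x y r ∧ IsSpecial bt r a.2
    · -- The edge at `a` is removed; the rest of the cycle of the block makes up for it.
      obtain ⟨y, r, har, hlk, hsp⟩ := hc
      refine Relation.ReflTransGen.lift' (fun b : List V × Bool => (x :: b.1, b.2)) ?_ _ _
        (alt.reflTransGen_of_removed_edge ha)
      rintro b c ⟨hb, hbc⟩
      change Linked bt (x :: b.1, b.2) (x :: c.1, c.2)
      rcases hbc with rfl | ⟨rfl, hba, hba'⟩
      · exact hmove b
      · obtain ⟨y', r', hbr⟩ := hne b hb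
        obtain ⟨b, s'⟩ := b
        simp only at hbr
        subst hbr
        refine htail y' r' s' ?_
        rintro ⟨hlk', hsp'⟩
        obtain ⟨a, s⟩ := a
        simp only at har hsp
        subst har
        have hy := hhub y r ha.1 hlk
        have hy' := hhub y' r' hb.1 hlk'
        subst hy
        subst hy'
        have hperm : r.Perm r' := (ha.1.trans hb.1.symm).cons_inv
        rcases hsp.eq_or_eq_move hsp' hperm with he | he
        · rw [Prod.mk.injEq] at he
          exact hba (by rw [he.1, he.2])
        · refine hba' ?_
          simp only [tailMove]
          rw [← he]
    · obtain ⟨y, r, har⟩ := hne a ha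
      obtain ⟨a, s⟩ := a
      simp only at har
      subst har
      exact htail y r s fun h => hc ⟨y, r, rfl, h⟩
  have main : ∀ q, Linked bt p q →
      q ∈ prismVertices bt t ∧ Linked bt (x :: p.1, p.2) (x :: q.1, q.2) := by
    intro q hpq
    induction hpq with
    | refl => exact ⟨hp, .refl⟩
    | tail _ hab ih =>
      obtain ⟨ha, hlk⟩ := ih
      rcases hab with rfl | rfl
      · exact ⟨alt.maps_left _ ha, hlk.trans (hmove _)⟩
      · exact ⟨alt.maps_right _ ha, hlk.trans (hstep _ ha)⟩
  exact (main q (ih p hp q hq)).2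

/-- In the block of the hub every removed edge is replaced by a detour through another block. -/
theorem linked_cons_hub {h : V} {t : List V} (hht : (h :: t).Nodup) (hh : IsFirst bt (h :: t) h)
    (htne : t ≠ [])
    (ih : ∀ t' : List V, t'.length = t.length → t'.Nodup →
      ∀ p ∈ prismVertices bt t', ∀ q ∈ prismVertices bt t', Linked bt p q)
    {p q : List V × Bool} (hp : p ∈ prismVertices bt t) (hq : q ∈ prismVertices bt t) :
    Linked bt (h :: p.1, p.2) (h :: q.1, q.2) := by
  have ht : t.Nodup := (List.nodup_cons.1 hht).2
  have alt := alternatingPair (bt := bt) ht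
  have hstep : ∀ a ∈ prismVertices bt t,
      Linked bt (h :: a.1, a.2) (h :: (tailMove bt a.2 a.1).1, (tailMove bt a.2 a.1).2) := by
    rintro ⟨a, s⟩ ⟨hat, haf⟩
    rcases a with _ | ⟨y, r⟩
    · exact absurd (List.nil_perm.1 hat) htne
    simp only at hat haf
    by_cases hc : Linkable bt h y r ∧ IsSpecial bt r s
    · -- The detour goes to the block of `y`, along the special edge, and back.
      have hnd : (h :: y :: r).Nodup := (hat.cons h).nodup_iff.2 hht
      have hyh : y ≠ h := by
        rintro rfl
        simp at hnd
      have hmem : ∀ v, v ∈ h :: t ↔ v ∈ y :: h :: r := fun v =>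
        ((hat.symm.cons h).trans (List.Perm.swap y h r)).mem_iff
      have hfh : Feasible bt (h :: r) h :=
        ((feasible_congr hmem).1 hh.1).mono (fun v hv => List.mem_cons_of_mem _ hv) (by simp)
      have hnd' : (y :: h :: r).Nodup := (List.Perm.swap y h r).nodup_iff.1 hnd
      have hin : (h :: r, s) ∈ prismVertices bt (h :: r) := ⟨.refl _, hfh, haf.2⟩
      have hin' : (h :: (move bt s r).1, (move bt s r).2) ∈ prismVertices bt (h :: r) :=
        ⟨(move_perm s r).cons h, feasibleWord_cons_congr (move_perm s r).symm
          (x := h) ⟨hfh, haf.2⟩ (feasibleWord_move s r haf.2)⟩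
      have h1 : Linked bt (h :: y :: r, s) (y :: h :: r, s) := by
        refine .single (.inl ?_)
        simp only [move, if_pos hc]
      have h2 : Linked bt (y :: h :: r, s) (y :: h :: (move bt s r).1, (move bt s r).2) :=
        linked_cons_of_ne hnd' ((isFirst_congr hmem).1 hh) hyh
          (ih _ (by simpa using hat.length_eq) (List.nodup_cons.1 hnd').2) hin hin'
      have hc' : Linkable bt y h (move bt s r).1 ∧
          IsSpecial bt (move bt s r).1 (move bt s r).2 :=
        ⟨(linkable_congr (move_perm s r).symm).1 hc.1.swap, isSpecial_move_of_isSpecial hc.2⟩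
      have h3 : Linked bt (y :: h :: (move bt s r).1, (move bt s r).2)
          (h :: y :: (move bt s r).1, (move bt s r).2) := by
        refine .single (.inl ?_)
        simp only
        rw [move, if_pos hc']
      exact (h1.trans h2).trans h3
    · refine .single (.inl ?_)
      simp only [move, if_neg hc, tailMove]
  have main : ∀ q, Linked bt p q →
      q ∈ prismVertices bt t ∧ Linked bt (h :: p.1, p.2) (h :: q.1, q.2) := by
    intro q hpq
    induction hpq with
    | refl => exact ⟨hp, .refl⟩
    | tail _ hab ih =>
      obtain ⟨ha, hlk⟩ := ih
      rcases hab with rfl | rfl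
      · exact ⟨alt.maps_left _ ha, hlk.trans (.single (.inr rfl))⟩
      · exact ⟨alt.maps_right _ ha, hlk.trans (hstep _ ha)⟩
  exact (main q (ih t rfl ht p hp q hq)).2

theorem linked_of_length_le_one {l : List V} (hl : l.length ≤ 1) {p q : List V × Bool}
    (hp : p ∈ prismVertices bt l) (hq : q ∈ prismVertices bt l) : Linked bt p q := by
  obtain ⟨w, s⟩ := p
  obtain ⟨w', s'⟩ := q
  have hw : w = l ∧ w' = l := by
    rcases l with _ | ⟨x, _ | ⟨y, t⟩⟩
    · exact ⟨List.perm_nil.1 hp.1, List.perm_nil.1 hq.1⟩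
    · exact ⟨List.perm_singleton.1 hp.1, List.perm_singleton.1 hq.1⟩
    · simp at hl
  obtain ⟨rfl, rfl⟩ := hw
  by_cases hs : s = s'
  · subst hs
    exact .refl
  · have hs' : s' = !s := by
      cases s <;> cases s' <;> simp_all
    subst hs'
    refine .single (.inl ?_)
    rcases w' with _ | ⟨x, _ | ⟨y, t⟩⟩
    · rfl
    · rfl
    · simp at hl

/-- Any two vertices of the prism are joined by a sequence of moves. -/
theorem IsConvexBetweenness.linked (hbt : IsConvexBetweenness bt) :
    ∀ (k : ℕ) (l : List V), l.length = k → l.Nodup →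
      ∀ p ∈ prismVertices bt l, ∀ q ∈ prismVertices bt l, Linked bt p q := by
  intro k
  induction k with
  | zero => exact fun l hk _ p hp q hq => linked_of_length_le_one (by omega) hp hq
  | succ k ih =>
    intro l hk hl p hp q hq
    by_cases hk0 : k = 0
    · exact linked_of_length_le_one (by omega) hp hq
    obtain ⟨h, hh⟩ := exists_isFirst (hbt.exists_feasible (l := l) (by rintro rfl; simp at hk))
    set t := l.erase h with ht
    have hperm : l.Perm (h :: t) := List.perm_cons_erase hh.1.1
    have hlen : t.length = k := by
      have := hperm.length_eq
      simp only [List.length_cons] at this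
      omega
    have hht : (h :: t).Nodup := hperm.nodup_iff.1 hl
    have hh' : IsFirst bt (h :: t) h := (isFirst_congr fun v => hperm.mem_iff).1 hh
    -- Every block is linked to that of the hub, at the canonical word of the remaining letters.
    have key : ∀ p ∈ prismVertices bt l, ∃ a ∈ prismVertices bt t,
        Linked bt p (h :: a.1, a.2) := by
      rintro ⟨w, s⟩ ⟨hw, hwf⟩
      rcases w with _ | ⟨x, w⟩
      · have := hw.length_eq
        simp at this
        omega
      simp only at hw hwf
      by_cases hxh : x = h
      · subst hxh
        exact ⟨(w, s), ⟨(hw.trans hperm).cons_inv, hwf.2⟩, .refl⟩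
      · have hhw : h ∈ w := by
          have := hw.mem_iff.2 hh.1.1
          simpa [Ne.symm hxh] using this
        have hnd : (x :: w).Nodup := hw.nodup_iff.2 hl
        have hwp : w.Perm (h :: w.erase h) := List.perm_cons_erase hhw
        obtain ⟨c, hc, hcc, hcf⟩ := hbt.exists_canonical _ (w.erase h) rfl
          ((List.nodup_cons.1 hnd).2.erase h)
        have hcw : (h :: c).Perm w := (hc.cons h).trans hwp.symm
        have hmem : ∀ v, v ∈ l ↔ v ∈ x :: h :: c := fun v =>
          ((hcw.cons x).trans hw).mem_iff.symm
        have hhf : Feasible bt (h :: c) h := ((feasible_congr hmem).1 hh.1).mono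
          (fun v hv => List.mem_cons_of_mem _ hv) (by simp)
        have hlk : Linkable bt x h c :=
          ⟨(feasible_congr fun v => (hcw.cons x).mem_iff.symm).1 hwf.1,
          (feasible_congr hmem).1 hh.1, .inr ((isFirst_congr hmem).1 hh)⟩
        have hsp : IsSpecial bt c false := .inr ⟨rfl, hcc.semiCanonical⟩
        have hwlen : w.length = k := by
          have := hw.length_eq
          simp only [List.length_cons] at this
          omega
        have h1 : Linked bt (x :: w, s) (x :: h :: c, false) :=
          linked_cons_of_ne (t := w) (p := (w, s)) (q := (h :: c, false)) hnd
            ((isFirst_congr fun v => hw.mem_iff.symm).1 hh) hxh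
            (ih w hwlen (List.nodup_cons.1 hnd).2) ⟨.refl _, hwf.2⟩ ⟨hcw, hhf, hcf⟩
        have hfw : FeasibleWord bt (x :: h :: c) := ⟨hlk.1, hhf, hcf⟩
        refine ⟨(x :: c, false), ⟨?_, (feasibleWord_swap hfw hlk).2⟩, h1.trans (.single (.inl ?_))⟩
        · exact (((List.Perm.swap x h c).trans ((hcw.cons x).trans hw)).trans hperm).cons_inv
        · simp only
          rw [move, if_pos ⟨hlk, hsp⟩]
    obtain ⟨a, ha, hpa⟩ := key p hp
    obtain ⟨b, hb, hqb⟩ := key q hq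
    refine (hpa.trans (linked_cons_hub hht hh' ?_ ?_ ha hb)).trans hqb.symm
    · rintro h0
      rw [h0] at hlen
      exact hk0 hlen.symm
    · exact fun t' ht' => ih t' (ht'.trans hlen)

end Connectivity

/-! ### Counting words by their suffixes -/

section Counting

variable {V : Type*} {bt : V → V → V → Prop}

variable (bt) in
/-- The feasible words with the letters of `l`. -/
def feasibleWords (l : List V) : Set (List V) := {w | w.Perm l ∧ FeasibleWord bt w}

theorem feasibleWords_finite (l : List V) : (feasibleWords bt l).Finite :=
  l.permutations.finite_toSet.subset fun _ hw => List.mem_permutations.2 hw.1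

theorem feasibleWord_append_congr {p r r' : List V} (h : r.Perm r')
    (hpr : FeasibleWord bt (p ++ r)) (hr : FeasibleWord bt r') : FeasibleWord bt (p ++ r') := by
  induction p with
  | nil => exact hr
  | cons x p ih =>
    exact feasibleWord_cons_congr (h.append_left p) hpr (ih hpr.2)

theorem FeasibleWord.drop {w : List V} (h : FeasibleWord bt w) (j : ℕ) :
    FeasibleWord bt (w.drop j) := by
  induction j generalizing w with
  | zero => exact h
  | succ j ih =>
    rcases w with _ | ⟨x, w⟩
    · exact h
    · exact ih h.2

variable [LinearOrder V]

/-- As long as at least two letters remain, there are at least two choices for the next one. -/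
theorem IsConvexBetweenness.exists_many_words (hbt : IsConvexBetweenness bt) :
    ∀ (k : ℕ) (l : List V), l.length = k → l.Nodup →
      ∃ F : Finset (List V), F.card = 2 ^ (k - 1) ∧ ↑F ⊆ feasibleWords bt l := by
  intro k
  induction k with
  | zero =>
    intro l hk hl
    obtain rfl := List.length_eq_zero_iff.1 hk
    refine ⟨{[]}, by simp, fun w hw => ?_⟩
    obtain rfl : w = [] := by simpa using hw
    exact ⟨.refl _, trivial⟩
  | succ k ih =>
    intro l hk hl
    have hext : ∀ a, Feasible bt l a → ∃ F : Finset (List V), F.card = 2 ^ (k - 1) ∧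
        ∀ w ∈ F, (∃ r, w = a :: r) ∧ w ∈ feasibleWords bt l := by
      intro a ha
      have hperm := List.perm_cons_erase ha.1
      have hlen := hperm.length_eq
      simp only [List.length_cons] at hlen
      obtain ⟨F, hF, hF'⟩ := ih (l.erase a) (by omega) (hl.erase a)
      refine ⟨F.image (a :: ·), ?_, fun w hw => ?_⟩
      · rw [Finset.card_image_of_injective _ (List.cons_injective), hF]
      · obtain ⟨r, hr, rfl⟩ := Finset.mem_image.1 hw
        obtain ⟨hr1, hr2⟩ := hF' hr
        have hp : (a :: r).Perm l := (hr1.cons a).trans hperm.symm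
        exact ⟨⟨r, rfl⟩, hp, (feasible_congr fun v => hp.mem_iff.symm).1 ha, hr2⟩
    have hex := hbt.exists_feasible (l := l) (by rintro rfl; simp at hk)
    obtain ⟨a, ha⟩ := exists_isFirst hex
    obtain ⟨F, hF, hF'⟩ := hext a ha.1
    rcases Nat.eq_zero_or_pos k with rfl | hkpos
    · exact ⟨F, by simpa using hF, fun w hw => (hF' w hw).2⟩
    · obtain ⟨b, hb⟩ := exists_isLast hex
      have hab := hbt.first_ne_last hl (by omega) ha hb
      obtain ⟨F', hF1, hF1'⟩ := hext b hb.1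
      have hdisj : Disjoint F F' := by
        rw [Finset.disjoint_left]
        intro w hw hw'
        obtain ⟨⟨r, rfl⟩, -⟩ := hF' w hw
        obtain ⟨⟨r', hr'⟩, -⟩ := hF1' _ hw'
        exact hab (List.cons.inj hr').1
      refine ⟨F ∪ F', ?_, fun w hw => ?_⟩
      · rw [Finset.card_union_of_disjoint hdisj, hF, hF1, Nat.add_sub_cancel, ← two_mul,
          ← pow_succ', Nat.sub_add_cancel hkpos]
      · rcases Finset.mem_union.1 hw with h | h
        exacts [(hF' w h).2, (hF1' w h).2]

theorem IsConvexBetweenness.two_pow_le_ncard (hbt : IsConvexBetweenness bt) {l : List V}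
    (hl : l.Nodup) : 2 ^ (l.length - 1) ≤ (feasibleWords bt l).ncard := by
  obtain ⟨F, hF, hF'⟩ := hbt.exists_many_words _ l rfl hl
  rw [← hF, ← Set.ncard_coe_finset]
  exact Set.ncard_le_ncard hF' (feasibleWords_finite l)

/-- If a suffix is determined by its set of letters, then the words with such a suffix of length
`m` make up at most a fraction `2 ^ (1 - m)` of all words. -/
theorem IsConvexBetweenness.ncard_mul_two_pow_le (hbt : IsConvexBetweenness bt) {l : List V}
    (hl : l.Nodup) {Q : List V → Prop} (hQ : ∀ r r', Q r → Q r' → r.Perm r' → r = r') (j : ℕ) :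
    {w ∈ feasibleWords bt l | Q (w.drop j)}.ncard * 2 ^ (l.length - j - 1) ≤
      (feasibleWords bt l).ncard := by
  classical
  have hfin := feasibleWords_finite (bt := bt) l
  have hfin' : {w ∈ feasibleWords bt l | Q (w.drop j)}.Finite := hfin.subset fun w hw => hw.1
  rw [Set.ncard_eq_toFinset_card _ hfin, Set.ncard_eq_toFinset_card _ hfin']
  have hF : ∀ w : List V, w ∈ feasibleWords bt l → ∃ F : Finset (List V),
      F.card = 2 ^ (l.length - j - 1) ∧ ↑F ⊆ feasibleWords bt (w.drop j) := by
    intro w hw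
    exact hbt.exists_many_words _ (w.drop j) (by rw [List.length_drop, hw.1.length_eq])
      ((hw.1.nodup_iff.2 hl).sublist (List.drop_sublist _ _))
  choose! F hF1 hF2 using hF
  have hcard : (hfin'.toFinset.sigma F).card =
      hfin'.toFinset.card * 2 ^ (l.length - j - 1) := by
    rw [Finset.card_sigma, Finset.sum_const_nat]
    intro w hw
    exact hF1 w ((hfin'.mem_toFinset.1 hw).1)
  rw [← hcard]
  -- Replace the suffix of `w` by the word `f`. The pair is recovered from the result, because the
  -- suffix of `w` is determined by its letters.
  refine Finset.card_le_card_of_injOn (fun x => x.1.take j ++ x.2) ?_ ?_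
  · rintro ⟨w, f⟩ hwf
    rw [Finset.mem_coe, Finset.mem_sigma] at hwf
    obtain ⟨hw, hf⟩ := hwf
    have hw' := (hfin'.mem_toFinset.1 hw).1
    obtain ⟨hf1, hf2⟩ := hF2 w hw' hf
    rw [Finset.mem_coe, hfin.mem_toFinset]
    refine ⟨?_, ?_⟩
    · refine ((hf1.append_left _).trans ?_).trans hw'.1
      rw [List.take_append_drop]
    · refine feasibleWord_append_congr hf1.symm ?_ hf2
      rw [List.take_append_drop]
      exact hw'.2
  · rintro ⟨w, f⟩ hwf ⟨w', f'⟩ hwf' he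
    rw [Finset.mem_coe, Finset.mem_sigma] at hwf hwf'
    obtain ⟨hw, hf⟩ := hwf
    obtain ⟨hw', hf'⟩ := hwf'
    obtain ⟨hw1, hw2⟩ := hfin'.mem_toFinset.1 hw
    obtain ⟨hw1', hw2'⟩ := hfin'.mem_toFinset.1 hw'
    simp only at he hf hf'
    have hlen : (w.take j).length = (w'.take j).length := by
      rw [List.length_take, List.length_take, hw1.1.length_eq, hw1'.1.length_eq]
    obtain ⟨h1, h2⟩ := List.append_inj he hlen
    have hperm : (w.drop j).Perm (w'.drop j) := by
      rw [← List.perm_append_left_iff (w.take j), List.take_append_drop]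
      conv_rhs => rw [h1, List.take_append_drop]
      exact hw1.1.trans hw1'.1.symm
    have hww : w = w' := by
      rw [← List.take_append_drop j w, h1, hQ _ _ hw2 hw2' hperm, List.take_append_drop]
    subst hww
    rw [h2]

/-- The constant `C` bounds the sums of `c m / 2 ^ m`. -/
def GeometricBound (c : ℕ → ℕ) (C : ℕ) : Prop :=
  ∀ M : ℕ, ∑ m ∈ Finset.range M, (c m : ℝ) / 2 ^ m ≤ C

theorem exists_geometricBound (K k : ℕ) :
    ∃ C, GeometricBound (fun m => K * (m + 1) ^ k) C := by
  have h1 : Summable fun m : ℕ => (m : ℝ) ^ k * (1 / 2 : ℝ) ^ m :=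
    summable_pow_mul_geometric_of_norm_lt_one k (by norm_num)
  have h2 := ((summable_nat_add_iff 1).2 h1).mul_left (2 * K : ℝ)
  obtain ⟨C, hC⟩ := exists_nat_ge (∑' m : ℕ, (2 * K : ℝ) * (((m + 1 : ℕ) : ℝ) ^ k *
    (1 / 2 : ℝ) ^ (m + 1)))
  refine ⟨C, fun M => le_trans ?_ hC⟩
  refine le_trans (le_of_eq ?_) (h2.sum_le_tsum (Finset.range M) fun i _ => by positivity)
  refine Finset.sum_congr rfl fun m _ => ?_
  rw [pow_succ (1 / 2 : ℝ) m, one_div, inv_pow]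
  push_cast
  field_simp

theorem GeometricBound.le {c : ℕ → ℕ} {C : ℕ} (h : GeometricBound c C) (n : ℕ) :
    c n ≤ C * 2 ^ n := by
  have h1 := h (n + 1)
  rw [Finset.sum_range_succ] at h1
  have h2 : 0 ≤ ∑ m ∈ Finset.range n, (c m : ℝ) / 2 ^ m :=
    Finset.sum_nonneg fun i _ => by positivity
  have h3 : (c n : ℝ) / 2 ^ n ≤ C := by linarith
  rw [div_le_iff₀ (by positivity)] at h3
  exact_mod_cast h3

/-- Work of amount `c m` that is done on the words with a suffix of length `m - a` determined by
its set of letters takes constant amortized time. -/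
theorem IsConvexBetweenness.sum_suffix_le (hbt : IsConvexBetweenness bt) {l : List V}
    (hl : l.Nodup) {Q : List V → Prop} (hQ : ∀ r r', Q r → Q r' → r.Perm r' → r = r')
    [DecidablePred Q] {c : ℕ → ℕ} {C : ℕ} (hc : GeometricBound c C) (a : ℕ) :
    ∑ w ∈ (feasibleWords_finite (bt := bt) l).toFinset, ∑ i ∈ Finset.range (l.length + 1),
      (if Q (w.drop (i + a)) then c (l.length - i) else 0) ≤
        C * 2 ^ (a + 1) * (feasibleWords bt l).ncard := by
  classical
  set N := (feasibleWords bt l).ncard with hN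
  set n := l.length with hn
  rw [Finset.sum_comm]
  have hterm : ∀ i ∈ Finset.range (n + 1),
      ((∑ w ∈ (feasibleWords_finite (bt := bt) l).toFinset,
        (if Q (w.drop (i + a)) then c (n - i) else 0) : ℕ) : ℝ) ≤
          (2 ^ (a + 1) * N) * ((c (n - i) : ℝ) / 2 ^ (n - i)) := by
    intro i _
    have h1 := hbt.ncard_mul_two_pow_le hl hQ (i + a)
    have h2 : ∑ w ∈ (feasibleWords_finite (bt := bt) l).toFinset,
        (if Q (w.drop (i + a)) then c (n - i) else 0) =
        {w ∈ feasibleWords bt l | Q (w.drop (i + a))}.ncard * c (n - i) := by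
      rw [← Finset.sum_filter, Finset.sum_const, smul_eq_mul]
      congr 1
      rw [← Set.ncard_coe_finset]
      congr 1
      ext w
      simp
    rw [h2]
    set A := {w ∈ feasibleWords bt l | Q (w.drop (i + a))}.ncard
    have h3 : A * 2 ^ (n - i) ≤ 2 ^ (a + 1) * N := by
      calc A * 2 ^ (n - i) ≤ A * (2 ^ (n - (i + a) - 1) * 2 ^ (a + 1)) := by
            rw [← pow_add]
            exact Nat.mul_le_mul_left _ (Nat.pow_le_pow_right (by norm_num) (by omega))
        _ = 2 ^ (a + 1) * (A * 2 ^ (n - (i + a) - 1)) := by ring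
        _ ≤ 2 ^ (a + 1) * N := Nat.mul_le_mul_left _ h1
    have h4 : (A : ℝ) * 2 ^ (n - i) ≤ 2 ^ (a + 1) * N := by exact_mod_cast h3
    rw [mul_div_assoc', le_div_iff₀ (by positivity)]
    push_cast
    calc (A : ℝ) * c (n - i) * 2 ^ (n - i) = (A * 2 ^ (n - i)) * c (n - i) := by ring
      _ ≤ _ := mul_le_mul_of_nonneg_right h4 (by positivity)
  have hsum : ((∑ i ∈ Finset.range (n + 1),
      ∑ w ∈ (feasibleWords_finite (bt := bt) l).toFinset,
        (if Q (w.drop (i + a)) then c (n - i) else 0) : ℕ) : ℝ) ≤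
          (2 ^ (a + 1) * N) * C := by
    rw [Nat.cast_sum]
    refine (Finset.sum_le_sum hterm).trans ?_
    rw [← Finset.mul_sum]
    refine mul_le_mul_of_nonneg_left ?_ (by positivity)
    have := Finset.sum_range_reflect (fun m => (c m : ℝ) / 2 ^ m) (n + 1)
    simp only [Nat.add_sub_cancel] at this
    rw [this]
    exact hc (n + 1)
  have : ((2 ^ (a + 1) * N) * C : ℝ) = ((C * 2 ^ (a + 1) * N : ℕ) : ℝ) := by
    push_cast
    ring
  rw [this] at hsum
  exact_mod_cast hsum

end Counting

/-! ### The listing of the AT-free orders -/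

section Listing

variable {V : Type*} [LinearOrder V] {bt : V → V → V → Prop}

variable (bt) in
/-- The first of the two moves that lead from one listed word to the next. For words of length
`n` it always exchanges two letters. -/
noncomputable def firstMove (n : ℕ) (p : List V × Bool) : List V × Bool :=
  if Even n then move bt p.2 p.1 else tailMove bt p.2 p.1

variable (bt) in
/-- The second of the two moves that lead from one listed word to the next. -/
noncomputable def secondMove (n : ℕ) (p : List V × Bool) : List V × Bool :=
  if Even n then tailMove bt p.2 p.1 else move bt p.2 p.1

variable (bt) in
/-- The vertex that is reached from `p` after `2 * i` steps along the cycle. -/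
noncomputable def evenVertex (n : ℕ) (p : List V × Bool) (i : ℕ) : List V × Bool :=
  (secondMove bt n ∘ firstMove bt n)^[i] p

variable (bt) in
/-- The number of words that are listed when the cycle is followed from `p`. -/
noncomputable def cyclePeriod (n : ℕ) (p : List V × Bool) : ℕ :=
  Function.minimalPeriod (secondMove bt n ∘ firstMove bt n) p

theorem alternatingPair_moves {l : List V} (hl : l.Nodup) (n : ℕ) :
    AlternatingPair (firstMove bt n) (secondMove bt n) (prismVertices bt l) prismSign := by
  unfold firstMove secondMove
  by_cases h : Even n
  · simpa only [if_pos h] using alternatingPair hl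
  · simpa only [if_neg h] using (alternatingPair hl).symm

theorem firstMove_or (n : ℕ) (p : List V × Bool) (hp : p.1.Nodup) :
    firstMove bt n p = (p.1, !p.2) ∨
      (AdjacentTransposition p.1 (firstMove bt n p).1 ∧ (firstMove bt n p).2 = p.2) := by
  unfold firstMove
  split_ifs
  exacts [move_eq_or _ _ hp, tailMove_eq_or _ hp]

theorem secondMove_or (n : ℕ) (p : List V × Bool) (hp : p.1.Nodup) :
    secondMove bt n p = (p.1, !p.2) ∨
      (AdjacentTransposition p.1 (secondMove bt n p).1 ∧ (secondMove bt n p).2 = p.2) := by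
  unfold secondMove
  split_ifs
  exacts [tailMove_eq_or _ hp, move_eq_or _ _ hp]

/-- The first move acts on a suffix of positive even length, so it does not change the copy. -/
theorem IsConvexBetweenness.firstMove_transposition (hbt : IsConvexBetweenness bt) {n : ℕ}
    (hn : 2 ≤ n) (p : List V × Bool) (hp : p.1.Nodup) (hlen : p.1.length = n) :
    AdjacentTransposition p.1 (firstMove bt n p).1 := by
  have h : (firstMove bt n p).2 = p.2 := by
    unfold firstMove
    split_ifs with he
    · exact hbt.move_snd _ _ hp (hlen ▸ he) (by rintro h; simp [h] at hlen; omega)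
    · obtain ⟨w, s⟩ := p
      rcases w with _ | ⟨x, w⟩
      · simp at hlen
        omega
      · simp only [tailMove]
        simp only [List.length_cons] at hlen
        refine hbt.move_snd _ _ (List.nodup_cons.1 hp).2 ?_ ?_
        · by_contra h'
          exact he (hlen ▸ Nat.even_add_one.2 h')
        · rintro rfl
          simp at hlen
          omega
  rcases firstMove_or (bt := bt) n p hp with h' | h'
  · rw [h'] at h
    simp at h
  · exact h'.1

variable {l : List V} {n : ℕ} {p : List V × Bool}

theorem evenVertex_mem (hl : l.Nodup) (hp : p ∈ prismVertices bt l) (i : ℕ) :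
    evenVertex bt n p i ∈ prismVertices bt l :=
  (alternatingPair_moves hl n).iterate_mem hp i

theorem evenVertex_succ (i : ℕ) :
    evenVertex bt n p (i + 1) = secondMove bt n (firstMove bt n (evenVertex bt n p i)) := by
  simp only [evenVertex, Function.iterate_succ_apply', Function.comp_apply]

theorem evenVertex_period : evenVertex bt n p (cyclePeriod bt n p) = p :=
  Function.isPeriodicPt_minimalPeriod _ _

theorem cyclePeriod_pos (hl : l.Nodup) (hp : p ∈ prismVertices bt l) : 0 < cyclePeriod bt n p :=
  (alternatingPair_moves hl n).minimalPeriod_pos hp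

theorem evenVertex_ne {i : ℕ} (hi : 0 < i) (hik : i < cyclePeriod bt n p) :
    evenVertex bt n p i ≠ p :=
  Function.not_isPeriodicPt_of_pos_of_lt_minimalPeriod hi.ne' hik

theorem evenVertex_injOn {i j : ℕ} (hi : i < cyclePeriod bt n p) (hj : j < cyclePeriod bt n p)
    (h : evenVertex bt n p i = evenVertex bt n p j) : i = j :=
  Function.iterate_injOn_Iio_minimalPeriod hi hj h

theorem eq_of_fst_eq_of_sign_eq {p q : List V × Bool} (h : p.1 = q.1)
    (hs : prismSign p = prismSign q) : p = q := by
  obtain ⟨w, s⟩ := p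
  obtain ⟨w', s'⟩ := q
  simp only at h
  subst h
  simpa [prismSign] using hs

/-- The even vertices have the same sign, so they differ in their words. -/
theorem evenVertex_fst_injOn (hl : l.Nodup) (hp : p ∈ prismVertices bt l) {i j : ℕ}
    (hi : i < cyclePeriod bt n p) (hj : j < cyclePeriod bt n p)
    (h : (evenVertex bt n p i).1 = (evenVertex bt n p j).1) : i = j := by
  have alt := alternatingPair_moves (bt := bt) hl n
  exact evenVertex_injOn hi hj (eq_of_fst_eq_of_sign_eq h
    ((alt.sign_iterate hp i).trans (alt.sign_iterate hp j).symm))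

theorem firstMove_fst_injOn (hl : l.Nodup) (hp : p ∈ prismVertices bt l) {i j : ℕ}
    (hi : i < cyclePeriod bt n p) (hj : j < cyclePeriod bt n p)
    (h : (firstMove bt n (evenVertex bt n p i)).1 = (firstMove bt n (evenVertex bt n p j)).1) :
    i = j := by
  have alt := alternatingPair_moves (bt := bt) hl n
  have hi' := evenVertex_mem (n := n) hl hp i
  have hj' := evenVertex_mem (n := n) hl hp j
  have h1 := eq_of_fst_eq_of_sign_eq h (by
    rw [alt.sign_left _ hi', alt.sign_left _ hj']
    exact congrArg _ ((alt.sign_iterate hp i).trans (alt.sign_iterate hp j).symm))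
  exact evenVertex_injOn hi hj (by rw [← alt.invol_left _ hi', h1, alt.invol_left _ hj'])

theorem IsConvexBetweenness.exists_vertex (hbt : IsConvexBetweenness bt) (hl : l.Nodup)
    (hp : p ∈ prismVertices bt l) {q : List V × Bool} (hq : q ∈ prismVertices bt l) :
    ∃ i < cyclePeriod bt n p,
      q = evenVertex bt n p i ∨ q = firstMove bt n (evenVertex bt n p i) := by
  refine (alternatingPair_moves hl n).exists_iterate hp
    (Relation.ReflTransGen.mono (fun a b hab => ?_) _ _ (hbt.linked _ l rfl hl p hp q hq))
  unfold firstMove secondMove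
  split_ifs
  exacts [hab, hab.symm]

/-- Each word underlies exactly one of the even vertices, because these have the same sign. -/
theorem IsConvexBetweenness.exists_evenVertex (hbt : IsConvexBetweenness bt) (hl : l.Nodup)
    (hp : p ∈ prismVertices bt l) {w : List V} (hw : w ∈ feasibleWords bt l) :
    ∃ i < cyclePeriod bt n p, (evenVertex bt n p i).1 = w := by
  have alt := alternatingPair_moves (bt := bt) hl n
  obtain ⟨s, hs⟩ : ∃ s, prismSign (w, s) = prismSign p := by
    by_cases h : prismSign (w, false) = prismSign p
    · exact ⟨_, h⟩
    · refine ⟨true, ?_⟩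
      rw [← Bool.not_eq_eq_eq_not.2 (Bool.eq_not_of_ne h)]
      simp [prismSign]
  obtain ⟨i, hi, h | h⟩ := hbt.exists_vertex (n := n) hl hp (q := (w, s)) hw
  · exact ⟨i, hi, by rw [← h]⟩
  · have h1 := alt.sign_left _ (evenVertex_mem (n := n) hl hp i)
    rw [← h, hs, show prismSign (evenVertex bt n p i) = prismSign p from
      alt.sign_iterate hp i] at h1
    simp at h1

variable (bt) in
/-- The words that are listed when the cycle is followed from `p`. -/
noncomputable def listing (n : ℕ) (p : List V × Bool) : List (List V) :=
  (List.range (cyclePeriod bt n p)).map fun i => (evenVertex bt n p i).1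

theorem nodup_listing (hl : l.Nodup) (hp : p ∈ prismVertices bt l) : (listing bt n p).Nodup := by
  refine List.Nodup.map_on (fun i hi j hj h => ?_) List.nodup_range
  exact evenVertex_fst_injOn hl hp (List.mem_range.1 hi) (List.mem_range.1 hj) h

theorem IsConvexBetweenness.mem_listing (hbt : IsConvexBetweenness bt) (hl : l.Nodup)
    (hp : p ∈ prismVertices bt l) {w : List V} :
    w ∈ listing bt n p ↔ w ∈ feasibleWords bt l := by
  rw [listing, List.mem_map]
  constructor
  · rintro ⟨i, -, rfl⟩
    exact evenVertex_mem hl hp i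
  · intro hw
    obtain ⟨i, hi, h⟩ := hbt.exists_evenVertex (n := n) hl hp hw
    exact ⟨i, List.mem_range.2 hi, h⟩

theorem IsConvexBetweenness.cyclePeriod_eq (hbt : IsConvexBetweenness bt) (hl : l.Nodup)
    (hp : p ∈ prismVertices bt l) : cyclePeriod bt n p = (feasibleWords bt l).ncard := by
  classical
  have h : feasibleWords bt l = ↑(listing bt n p).toFinset := by
    ext w
    simp [hbt.mem_listing hl hp]
  rw [h, Set.ncard_coe_finset, List.toFinset_card_of_nodup (nodup_listing hl hp), listing,
    List.length_map, List.length_range]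

theorem IsConvexBetweenness.isChain_listing (hbt : IsConvexBetweenness bt) (hl : l.Nodup)
    (hp : p ∈ prismVertices bt l) (hn : l.length = n) :
    (listing bt n p).IsChain OneOrTwoTranspositions := by
  have alt := alternatingPair_moves (bt := bt) hl n
  by_cases h2 : 2 ≤ n
  · rw [listing, List.isChain_map, List.isChain_iff_getElem]
    intro i hi
    simp only [List.getElem_range, evenVertex_succ]
    have hi' := evenVertex_mem (n := n) hl hp i
    have h1 := hbt.firstMove_transposition h2 _ (hi'.1.nodup_iff.2 hl)
      (hi'.1.length_eq.trans hn)
    have hf := alt.maps_left _ hi'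
    rcases secondMove_or (bt := bt) n _ (hf.1.nodup_iff.2 hl) with h | h
    · left
      rw [h]
      exact h1
    · exact .inr ⟨_, h1, h.1⟩
  · -- There is only one word.
    have hlen : (listing bt n p).length ≤ 1 := by
      have hsub : (listing bt n p) ⊆ [l] := by
        intro w hw
        have hw' := ((hbt.mem_listing hl hp).1 hw).1
        rcases l with _ | ⟨x, _ | ⟨y, t⟩⟩
        · simp [List.perm_nil.1 hw']
        · simp [List.perm_singleton.1 hw']
        · simp at hn
          omega
      exact (List.subperm_of_subset (nodup_listing hl hp) hsub).length_le
    rcases h : listing bt n p with _ | ⟨a, _ | ⟨b, t⟩⟩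
    · exact List.isChain_nil
    · exact List.isChain_singleton _
    · rw [h] at hlen
      simp at hlen

end Listing

/-! ### The Hamiltonian cycle of the prism -/

section Prism

variable {n : ℕ} {G : SimpleGraph (Fin n)}

theorem isConvexBetweenness_between (hG : IsATFree G) : IsConvexBetweenness (Between G) :=
  ⟨fun _ _ => not_between_self, exists_extreme_ne hG⟩

theorem feasibleWord_iff_idxOf {V : Type*} [DecidableEq V] {bt : V → V → V → Prop} :
    ∀ {w : List V}, w.Nodup → (FeasibleWord bt w ↔ ∀ x ∈ w, ∀ y ∈ w, ∀ z ∈ w, bt x y z →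
      w.idxOf x < w.idxOf z ∨ w.idxOf y < w.idxOf z)
  | [], _ => by simp [FeasibleWord]
  | a :: w, h => by
    have hnd := List.nodup_cons.1 h
    have ih := feasibleWord_iff_idxOf (bt := bt) hnd.2
    have hidx : ∀ v ∈ w, (a :: w).idxOf v = w.idxOf v + 1 := fun v hv =>
      List.idxOf_cons_ne _ (by rintro rfl; exact hnd.1 hv)
    constructor
    · rintro ⟨hf, hw⟩ x hx y hy z hz hb
      rcases List.mem_cons.1 hz with rfl | hz
      · exact absurd hb (hf.2 x hx y hy)
      rw [hidx z hz]
      rcases List.mem_cons.1 hx with rfl | hx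
      · exact .inl (by simp)
      rcases List.mem_cons.1 hy with rfl | hy
      · exact .inr (by simp)
      rw [hidx x hx, hidx y hy]
      simpa using ih.1 hw x hx y hy z hz hb
    · intro hall
      refine ⟨⟨by simp, fun x hx y hy hb => ?_⟩, ih.2 fun x hx y hy z hz hb => ?_⟩
      · simpa using hall x hx y hy a (by simp) hb
      · have := hall x (.tail _ hx) y (.tail _ hy) z (.tail _ hz) hb
        rw [hidx x hx, hidx y hy, hidx z hz] at this
        simpa using this

theorem isATFreeOrder_iff {w : List (Fin n)} :
    IsATFreeOrder G w ↔ w ∈ feasibleWords (Between G) (List.finRange n) := by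
  constructor
  · rintro ⟨h1, h2, h3⟩
    refine ⟨(List.perm_ext_iff_of_nodup h1 (List.nodup_finRange n)).2 fun v => by simp [h2 v], ?_⟩
    exact (feasibleWord_iff_idxOf h1).2 fun x _ y _ z _ hb => h3 x y z hb
  · rintro ⟨h1, h2⟩
    have hnd := h1.nodup_iff.2 (List.nodup_finRange n)
    have hmem : ∀ v, v ∈ w := fun v => h1.mem_iff.2 (List.mem_finRange v)
    exact ⟨hnd, hmem, fun x y z hb =>
      (feasibleWord_iff_idxOf hnd).1 h2 x (hmem x) y (hmem y) z (hmem z) hb⟩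

theorem IsATFreeOrder.length_eq {w : List (Fin n)} (h : IsATFreeOrder G w) : w.length = n := by
  simpa using (isATFreeOrder_iff.1 h).1.length_eq

theorem IsATFreeOrder.isBasicWord {w : List (Fin n)} (h : IsATFreeOrder G w) :
    w ∈ orderLanguage G ∧ ∀ v ∈ orderLanguage G, v.length ≤ w.length := by
  refine ⟨⟨w, h, List.prefix_rfl⟩, ?_⟩
  rintro v ⟨w', hw', hv⟩
  exact hv.length_le.trans (hw'.length_eq.trans h.length_eq.symm).le

theorem BasicWord.isATFreeOrder (u : BasicWord (orderLanguage G)) : IsATFreeOrder G u.1 := by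
  obtain ⟨u, ⟨w, hw, hu⟩, hmax⟩ := u
  have := hmax w ⟨w, hw, List.prefix_rfl⟩
  have h : u = w := hu.eq_of_length_le this
  subst h
  exact hw

/-- The vertex of the prism with the given word and copy. -/
def toPrismVertex (p : List (Fin n) × Bool)
    (hp : p ∈ prismVertices (Between G) (List.finRange n)) : BasicWord (orderLanguage G) × Bool :=
  (⟨p.1, (isATFreeOrder_iff.2 hp).isBasicWord⟩, p.2)

theorem prism_adj_of_move {p q : List (Fin n) × Bool}
    (hp : p ∈ prismVertices (Between G) (List.finRange n))
    (hq : q ∈ prismVertices (Between G) (List.finRange n))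
    (h : q = (p.1, !p.2) ∨ (AdjacentTransposition p.1 q.1 ∧ q.2 = p.2)) :
    (prism (orderLanguage G)).Adj (toPrismVertex p hp) (toPrismVertex q hq) := by
  rw [prism, SimpleGraph.boxProd_adj]
  rcases h with rfl | ⟨h1, h2⟩
  · exact .inr ⟨by simp [toPrismVertex], rfl⟩
  · exact .inl ⟨h1, h2.symm⟩

/-- The listing consists of the words underlying every second vertex of a Hamiltonian cycle. -/
theorem exists_prism_cycle (hG : IsATFree G) (hn : 2 ≤ n) {p : List (Fin n) × Bool}
    (hp : p ∈ prismVertices (Between G) (List.finRange n)) :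
    ∃ (u : BasicWord (orderLanguage G) × Bool) (c : (prism (orderLanguage G)).Walk u u),
      c.IsHamiltonianCycle ∧
      listing (Between G) n p =
        (List.range (c.length / 2)).map fun i => (c.getVert (2 * i)).1.1 := by
  have hbt := isConvexBetweenness_between hG
  have hl := List.nodup_finRange n
  have alt := alternatingPair_moves (bt := Between G) hl n
  set k := cyclePeriod (Between G) n p with hk
  let seq : ℕ → List (Fin n) × Bool := fun m =>
    if Even m then evenVertex (Between G) n p (m / 2)
    else firstMove (Between G) n (evenVertex (Between G) n p (m / 2))
  have hseq : ∀ m, seq m ∈ prismVertices (Between G) (List.finRange n) := by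
    intro m
    simp only [seq]
    split_ifs
    · exact evenVertex_mem hl hp _
    · exact alt.maps_left _ (evenVertex_mem hl hp _)
  have heven : ∀ i, seq (2 * i) = evenVertex (Between G) n p i := fun i => by simp [seq]
  have hodd : ∀ i, seq (2 * i + 1) = firstMove (Between G) n (evenVertex (Between G) n p i) := by
    intro i
    have h2 : (2 * i + 1) / 2 = i := by omega
    simp [seq, h2]
  have hadj : ∀ m, (prism (orderLanguage G)).Adj (toPrismVertex (seq m) (hseq m))
      (toPrismVertex (seq (m + 1)) (hseq (m + 1))) := by
    intro m
    apply prism_adj_of_move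
    have hnd := (hseq m).1.nodup_iff.2 hl
    rcases Nat.even_or_odd' m with ⟨i, rfl | rfl⟩
    · have := firstMove_or (bt := Between G) n _ hnd
      rw [heven] at this ⊢
      rwa [hodd]
    · have := secondMove_or (bt := Between G) n _ hnd
      rw [show 2 * i + 1 + 1 = 2 * (i + 1) by ring, heven, evenVertex_succ]
      rwa [hodd] at this ⊢
  have hkcard : 2 ≤ k := by
    rw [hk, hbt.cyclePeriod_eq hl hp]
    have h1 := hbt.two_pow_le_ncard hl
    rw [List.length_finRange] at h1
    refine le_trans ?_ h1
    calc 2 = 2 ^ 1 := rfl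
      _ ≤ 2 ^ (n - 1) := Nat.pow_le_pow_right (by norm_num) (by omega)
  have hval : ∀ i j, toPrismVertex (seq i) (hseq i) = toPrismVertex (seq j) (hseq j) →
      seq i = seq j := by
    intro i j h
    have h1 := congrArg (fun x => (x.1.1, x.2)) h
    exact h1
  obtain ⟨c, hc, hlen, hget⟩ := exists_isHamiltonianCycle
    (fun m => toPrismVertex (seq m) (hseq m)) hadj (k := 2 * k) (by omega)
    (by
      have h : seq (2 * k) = seq 0 := by
        rw [show (0 : ℕ) = 2 * 0 from rfl, heven, heven, hk, evenVertex_period]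
        rfl
      simp only [toPrismVertex, h])
    (by
      intro i hi j hj hij
      have h := hval i j hij
      rcases Nat.even_or_odd' i with ⟨a, rfl | rfl⟩ <;>
        rcases Nat.even_or_odd' j with ⟨b, rfl | rfl⟩
      · rw [heven, heven] at h
        have := evenVertex_injOn (by omega) (by omega) h
        omega
      · rw [heven, hodd] at h
        exact absurd h (alt.iterate_ne hp a b)
      · rw [heven, hodd] at h
        exact absurd h.symm (alt.iterate_ne hp b a)
      · rw [hodd, hodd] at h
        have := firstMove_fst_injOn hl hp (by omega) (by omega) (congrArg Prod.fst h)
        omega)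
    (by
      rintro ⟨u, s⟩
      obtain ⟨i, hi, h | h⟩ := hbt.exists_vertex (n := n) hl hp (q := (u.1, s))
        (isATFreeOrder_iff.1 u.isATFreeOrder)
      · refine ⟨2 * i, by omega, Prod.ext (Subtype.ext ?_) ?_⟩ <;> simp [toPrismVertex, heven, ← h]
      · refine ⟨2 * i + 1, by omega, Prod.ext (Subtype.ext ?_) ?_⟩ <;>
          simp [toPrismVertex, hodd, ← h])
  refine ⟨_, c, hc, ?_⟩
  rw [hlen, Nat.mul_div_cancel_left _ (by norm_num), listing, ← hk]
  refine List.map_congr_left fun i hi => ?_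
  rw [hget _ (by have := List.mem_range.1 hi; omega)]
  simp [toPrismVertex, heven]

end Prism

/-! ### Reasoning about programs -/

section Machine

variable {B : ℕ} {p q : Prog} {s s' : State} {T T' : ℕ} {Q Q' : State → Prop}

@[simp] theorem State.setReg_reg (s : State) (x v y : ℕ) :
    (s.setReg x v).reg y = if y = x then v else s.reg y := by
  simp [State.setReg, Function.update_apply]

@[simp] theorem State.setReg_arr (s : State) (x v : ℕ) : (s.setReg x v).arr = s.arr := rfl

@[simp] theorem State.setArr_reg (s : State) (a i v : ℕ) : (s.setArr a i v).reg = s.reg := rfl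

@[simp] theorem State.setArr_arr (s : State) (a i v b j : ℕ) :
    (s.setArr a i v).arr b j = if b = a ∧ j = i then v else s.arr b j := by
  by_cases hb : b = a
  · subst hb
    simp [State.setArr, Function.update_apply]
  · simp [State.setArr, hb]

/-- Started in state `s`, the program `p` halts within `T` steps, without a visit, in a state that
satisfies `Q`. -/
def Comp (B : ℕ) (p : Prog) (s : State) (T : ℕ) (Q : State → Prop) : Prop :=
  ∃ t s', t ≤ T ∧ Exec B p s t [] s' ∧ Q s'

theorem Comp.mono (h : Comp B p s T Q) (hT : T ≤ T') (hQ : ∀ s', Q s' → Q' s') :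
    Comp B p s T' Q' := by
  obtain ⟨t, s', ht, he, hs⟩ := h
  exact ⟨t, s', ht.trans hT, he, hQ _ hs⟩

theorem Comp.seq {T₁ T₂ : ℕ} {Q₁ : State → Prop} (hp : Comp B p s T₁ Q₁)
    (hq : ∀ s₁, Q₁ s₁ → Comp B q s₁ T₂ Q) (hT : T₁ + T₂ ≤ T := by omega) :
    Comp B (Prog.seq p q) s T Q := by
  obtain ⟨t, s₁, ht, he, hs⟩ := hp
  obtain ⟨t', s', ht', he', hs'⟩ := hq s₁ hs
  exact ⟨t + t', s', by omega, Exec.seq he he', hs'⟩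

theorem Comp.skip (hQ : Q s) (hT : 1 ≤ T := by omega) : Comp B Prog.skip s T Q :=
  ⟨1, s, hT, Exec.skip s, hQ⟩

theorem Comp.const {x k : ℕ} (h : k ≤ B) (hQ : Q (s.setReg x k)) (hT : 1 ≤ T := by omega) :
    Comp B (Prog.const x k) s T Q :=
  ⟨1, _, hT, Exec.const s x k h, hQ⟩

theorem Comp.add {x y z : ℕ} (h : s.reg y + s.reg z ≤ B) (hQ : Q (s.setReg x (s.reg y + s.reg z)))
    (hT : 1 ≤ T := by omega) : Comp B (Prog.add x y z) s T Q :=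
  ⟨1, _, hT, Exec.add s x y z h, hQ⟩

theorem Comp.sub {x y z : ℕ} (h : s.reg y - s.reg z ≤ B) (hQ : Q (s.setReg x (s.reg y - s.reg z)))
    (hT : 1 ≤ T := by omega) : Comp B (Prog.sub x y z) s T Q :=
  ⟨1, _, hT, Exec.sub s x y z h, hQ⟩

theorem Comp.mul {x y z : ℕ} (h : s.reg y * s.reg z ≤ B) (hQ : Q (s.setReg x (s.reg y * s.reg z)))
    (hT : 1 ≤ T := by omega) : Comp B (Prog.mul x y z) s T Q :=
  ⟨1, _, hT, Exec.mul s x y z h, hQ⟩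

theorem Comp.load {x a y : ℕ} (h : s.arr a (s.reg y) ≤ B) (hQ : Q (s.setReg x (s.arr a (s.reg y))))
    (hT : 1 ≤ T := by omega) : Comp B (Prog.load x a y) s T Q :=
  ⟨1, _, hT, Exec.load s x a y h, hQ⟩

theorem Comp.store {a y x : ℕ} (h : s.reg x ≤ B) (hQ : Q (s.setArr a (s.reg y) (s.reg x)))
    (hT : 1 ≤ T := by omega) : Comp B (Prog.store a y x) s T Q :=
  ⟨1, _, hT, Exec.store s a y x h, hQ⟩

theorem Comp.branch {x y : ℕ} (hp : s.reg x < s.reg y → Comp B p s T Q)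
    (hq : ¬ s.reg x < s.reg y → Comp B q s T Q) (hT : T + 1 ≤ T' := by omega) :
    Comp B (Prog.branch x y p q) s T' Q := by
  by_cases h : s.reg x < s.reg y
  · obtain ⟨t, s', ht, he, hs⟩ := hp h
    exact ⟨t + 1, s', by omega, Exec.branch_true h he, hs⟩
  · obtain ⟨t, s', ht, he, hs⟩ := hq h
    exact ⟨t + 1, s', by omega, Exec.branch_false h he, hs⟩

theorem Comp.const_seq {x k : ℕ} (h : k ≤ B) (hq : Comp B q (s.setReg x k) T Q) :
    Comp B (Prog.seq (Prog.const x k) q) s (T + 1) Q :=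
  (Comp.const (T := 1) (Q := (· = s.setReg x k)) h rfl).seq (by rintro _ rfl; exact hq)

theorem Comp.add_seq {x y z : ℕ} (h : s.reg y + s.reg z ≤ B)
    (hq : Comp B q (s.setReg x (s.reg y + s.reg z)) T Q) :
    Comp B (Prog.seq (Prog.add x y z) q) s (T + 1) Q :=
  (Comp.add (T := 1) (Q := (· = s.setReg x (s.reg y + s.reg z))) h rfl).seq
    (by rintro _ rfl; exact hq)

theorem Comp.sub_seq {x y z : ℕ} (h : s.reg y - s.reg z ≤ B)
    (hq : Comp B q (s.setReg x (s.reg y - s.reg z)) T Q) :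
    Comp B (Prog.seq (Prog.sub x y z) q) s (T + 1) Q :=
  (Comp.sub (T := 1) (Q := (· = s.setReg x (s.reg y - s.reg z))) h rfl).seq
    (by rintro _ rfl; exact hq)

theorem Comp.mul_seq {x y z : ℕ} (h : s.reg y * s.reg z ≤ B)
    (hq : Comp B q (s.setReg x (s.reg y * s.reg z)) T Q) :
    Comp B (Prog.seq (Prog.mul x y z) q) s (T + 1) Q :=
  (Comp.mul (T := 1) (Q := (· = s.setReg x (s.reg y * s.reg z))) h rfl).seq
    (by rintro _ rfl; exact hq)

theorem Comp.load_seq {x a y : ℕ} (h : s.arr a (s.reg y) ≤ B)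
    (hq : Comp B q (s.setReg x (s.arr a (s.reg y))) T Q) :
    Comp B (Prog.seq (Prog.load x a y) q) s (T + 1) Q :=
  (Comp.load (T := 1) (Q := (· = s.setReg x (s.arr a (s.reg y)))) h rfl).seq
    (by rintro _ rfl; exact hq)

theorem Comp.store_seq {a y x : ℕ} (h : s.reg x ≤ B)
    (hq : Comp B q (s.setArr a (s.reg y) (s.reg x)) T Q) :
    Comp B (Prog.seq (Prog.store a y x) q) s (T + 1) Q :=
  (Comp.store (T := 1) (Q := (· = s.setArr a (s.reg y) (s.reg x))) h rfl).seq
    (by rintro _ rfl; exact hq)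

/-- A loop with invariant `I k` before round `k`, of which there are at most `N`; round `k`,
including its test, takes at most `C k` steps. -/
theorem Comp.loop {x y : ℕ} {I : ℕ → State → Prop} {C : ℕ → ℕ} {N : ℕ}
    (hbody : ∀ k s, I k s → s.reg x < s.reg y →
      k < N ∧ ∃ c, c + 1 ≤ C k ∧ Comp B p s c (I (k + 1)))
    (hI : I 0 s) (hQ : ∀ k s, I k s → ¬ s.reg x < s.reg y → Q s)
    (hT : ∑ k ∈ Finset.range N, C k + 1 ≤ T) : Comp B (Prog.loop x y p) s T Q := by
  have key : ∀ (m k : ℕ) (s : State), k + m = N → I k s →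
      Comp B (Prog.loop x y p) s (∑ j ∈ Finset.range m, C (k + j) + 1) Q := by
    intro m
    induction m with
    | zero =>
      intro k s hk hs
      by_cases h : s.reg x < s.reg y
      · have := (hbody k s hs h).1
        omega
      · exact ⟨1, s, by simp, Exec.loop_false h, hQ k s hs h⟩
    | succ m ih =>
      intro k s hk hs
      by_cases h : s.reg x < s.reg y
      · obtain ⟨-, c, hc, t, s', ht, he, hs'⟩ := hbody k s hs h
        obtain ⟨t', s'', ht', he', hs''⟩ := ih (k + 1) s' (by omega) hs'
        refine ⟨t + t' + 1, s'', ?_, Exec.loop_true h he he', hs''⟩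
        have hsum : ∑ j ∈ Finset.range (m + 1), C (k + j) =
            ∑ j ∈ Finset.range m, C (k + 1 + j) + C k := by
          rw [Finset.sum_range_succ']
          exact congrArg (· + C k)
            (Finset.sum_congr rfl fun j _ => by rw [add_assoc, add_comm 1 j])
        rw [hsum]
        omega
      · exact ⟨1, s, by omega, Exec.loop_false h, hQ k s hs h⟩
  have := key N 0 s (by omega) hI
  simp only [Nat.zero_add] at this
  exact this.mono hT fun _ h => h

/-- A loop that counts register `x` up to the value `e` of register `y`. -/
theorem Comp.forLoop {x y e c b : ℕ} {I : ℕ → State → Prop}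
    (hreg : ∀ k s, I k s → s.reg x = k ∧ s.reg y = e)
    (hb : b ≤ e)
    (hbody : ∀ k s, b ≤ k → k < e → I k s → Comp B p s c (I (k + 1)))
    (hI : I b s) (hQ : ∀ s, I e s → Q s)
    (hT : (e - b) * (c + 1) + 1 ≤ T) : Comp B (Prog.loop x y p) s T Q := by
  refine Comp.loop (I := fun k s => b + k ≤ e ∧ I (b + k) s) (C := fun _ => c + 1) (N := e - b)
    ?_ ⟨hb, hI⟩ ?_ ?_
  · rintro k s ⟨hk, hs⟩ h
    rw [(hreg _ _ hs).1, (hreg _ _ hs).2] at h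
    refine ⟨by omega, c, le_rfl, (hbody _ s (by omega) h hs).mono le_rfl fun s' hs' => ?_⟩
    exact ⟨by omega, hs'⟩
  · rintro k s ⟨hk, hs⟩ h
    rw [(hreg _ _ hs).1, (hreg _ _ hs).2] at h
    obtain rfl : b + k = e := by omega
    exact hQ s hs
  · simpa using hT

/-- The states agree on all arrays and on the registers below `b`. -/
def Frame (b : ℕ) (s s' : State) : Prop := s'.arr = s.arr ∧ ∀ r < b, s'.reg r = s.reg r

theorem Frame.refl (b : ℕ) (s : State) : Frame b s s := ⟨rfl, fun _ _ => rfl⟩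

theorem Frame.setReg {b x v : ℕ} (h : Frame b s s') (hx : b ≤ x) : Frame b s (s'.setReg x v) :=
  ⟨h.1, fun r hr => by rw [State.setReg_reg, if_neg (by omega), h.2 r hr]⟩

theorem Frame.trans {b b' : ℕ} {s'' : State} (h : Frame b s s') (h' : Frame b' s' s'')
    (hb : b ≤ b') : Frame b s s'' :=
  ⟨h'.1.trans h.1, fun r hr => (h'.2 r (by omega)).trans (h.2 r hr)⟩

/-- The word bound `B` suffices for all numbers that occur for a graph with `n` vertices. -/
structure LargeBound (B n : ℕ) : Prop where
  lin : 4 * n + 8 ≤ B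
  sq : n * n + 4 * n ≤ B
  cube : n * n * n ≤ B

theorem largeBound (n : ℕ) : LargeBound ((n + 2) ^ 3) n := by
  constructor <;> nlinarith [sq_nonneg n, Nat.zero_le (n ^ 3)]

theorem index_lt {n x y z : ℕ} (hx : x < n) (hy : y < n) (hz : z < n) :
    (x * n + y) * n + z < n * n * n := by
  have h1 : x * n + y + 1 ≤ n * n := by nlinarith
  nlinarith

theorem pair_lt {n x y : ℕ} (hx : x < n) (hy : y < n) : x * n + y < n * n := by
  nlinarith

theorem pair_inj {n x y x' y' : ℕ} (hy : y < n) (hy' : y' < n) (h : x * n + y = x' * n + y') :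
    x = x' ∧ y = y' := by
  have hn : 0 < n := by omega
  have h1 : (x * n + y) / n = x := by
    rw [mul_comm, Nat.mul_add_div hn, Nat.div_eq_of_lt hy, add_zero]
  have h2 : (x' * n + y') / n = x' := by
    rw [mul_comm, Nat.mul_add_div hn, Nat.div_eq_of_lt hy', add_zero]
  obtain rfl : x = x' := by rw [← h1, ← h2, h]
  exact ⟨rfl, by omega⟩

end Machine

/-! ### Feasibility tests -/

section Feasibility

variable {n : ℕ} {G : SimpleGraph (Fin n)} {B : ℕ} {s s' : State}

/-- Betweenness of vertices that are given as natural numbers. -/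
def natBetween (G : SimpleGraph (Fin n)) (x y z : ℕ) : Prop :=
  ∃ (hx : x < n) (hy : y < n) (hz : z < n), Between G ⟨x, hx⟩ ⟨y, hy⟩ ⟨z, hz⟩

/-- The number `z` is not between two entries of the word `W 0, …, W (n - 1)` from position `i`
on. -/
def FeasibleFrom (G : SimpleGraph (Fin n)) (W : ℕ → ℕ) (i z : ℕ) : Prop :=
  ∀ a, i ≤ a → a < n → ∀ b, i ≤ b → b < n → ¬ natBetween G (W a) (W b) z

/-- The constants are loaded, array `3` holds the table from which betweenness can be read off, and
the entries of the output array are vertices. The entry of the table for a path from `z` to `x`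
that avoids the closed neighbourhood of `y` has index `(y * n + z) * n + x`. -/
structure Ready (G : SimpleGraph (Fin n)) (s : State) : Prop where
  reg_zero : s.reg 0 = n
  reg_one : s.reg 1 = 1
  reg_two : s.reg 2 = 0
  le_one : ∀ k, s.arr 3 k ≤ 1
  table : ∀ x y z, x < n → y < n → z < n →
    (0 < s.arr 3 ((y * n + z) * n + x) * s.arr 3 ((x * n + z) * n + y) ↔ natBetween G x y z)
  word_lt : ∀ a < n, s.arr 1 a < n

theorem Ready.frame {b : ℕ} (h : Ready G s) (hf : Frame b s s') (hb : 3 ≤ b) : Ready G s' where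
  reg_zero := (hf.2 0 (by omega)).trans h.reg_zero
  reg_one := (hf.2 1 (by omega)).trans h.reg_one
  reg_two := (hf.2 2 (by omega)).trans h.reg_two
  le_one := hf.1 ▸ h.le_one
  table := hf.1 ▸ h.table
  word_lt := hf.1 ▸ h.word_lt

/-- Look up whether the vertex in register `v` is between the vertices in registers `15` and `17`;
register `19` becomes positive if it is. -/
def lookupProg (v : ℕ) : Prog :=
  .seq (.mul 18 17 0) <| .seq (.add 18 18 v) <| .seq (.mul 18 18 0) <| .seq (.add 18 18 15) <|
  .seq (.load 19 3 18) <|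
  .seq (.mul 18 15 0) <| .seq (.add 18 18 v) <| .seq (.mul 18 18 0) <| .seq (.add 18 18 17) <|
  .seq (.load 20 3 18) <|
  .mul 19 19 20

/-- Test whether the vertex in register `v` is not between two entries of the output array from
the position in register `i` on; the answer goes to register `13`. -/
def feasProg (i v : ℕ) : Prog :=
  .seq (.const 13 1) <| .seq (.add 14 i 2) <|
  .loop 14 0 <| .seq (.load 15 1 14) <| .seq (.add 16 i 2) <| .seq
    (.loop 16 0 <| .seq (.load 17 1 16) <| .seq (lookupProg v) <|
      .seq (.branch 2 19 (.const 13 0) .skip) <|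
      .add 16 16 1)
    (.add 14 14 1)

theorem comp_lookupProg (hB : LargeBound B n) (hs : Ready G s) {rv x y z : ℕ} (hrv : rv < 13)
    (hx : s.reg 15 = x) (hy : s.reg 17 = y) (hv : s.reg rv = z) (hxn : x < n) (hyn : y < n)
    (hz : z < n) : Comp B (lookupProg rv) s 11 fun s' => Frame 18 s s' ∧
      (0 < s'.reg 19 ↔ natBetween G x y z) := by
  have hl := hB.lin
  have hsq := hB.sq
  have hcube := hB.cube
  have hr0 := hs.reg_zero
  have i1 := index_lt hyn hz hxn
  have i2 := index_lt hxn hz hyn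
  have p1 := pair_lt hyn hz
  have p2 := pair_lt hxn hz
  have m1 := Nat.mul_lt_mul_of_pos_right p1 (show 0 < n by omega)
  have m2 := Nat.mul_lt_mul_of_pos_right p2 (show 0 < n by omega)
  have l1 := hs.le_one ((y * n + z) * n + x)
  have l2 := hs.le_one ((x * n + z) * n + y)
  have l3 := Nat.mul_le_mul l1 l2
  have htab := hs.table x y z hxn hyn hz
  have hv18 : rv ≠ 18 := by omega
  have hv19 : rv ≠ 19 := by omega
  refine Comp.mul_seq ?_ <| Comp.add_seq ?_ <| Comp.mul_seq ?_ <|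
    Comp.add_seq ?_ <| Comp.load_seq ?_ <| Comp.mul_seq ?_ <| Comp.add_seq ?_ <|
    Comp.mul_seq ?_ <| Comp.add_seq ?_ <| Comp.load_seq ?_ <| Comp.mul ?_ ⟨?_, ?_⟩
  rotate_right 2
  · iterate 11 refine Frame.setReg ?_ (by omega)
    exact Frame.refl _ _
  · simp [hr0, hx, hy, hv, hv18, hv19, ← htab]
  all_goals
    simp [hr0, hx, hy, hv, hv18, hv19]
    omega

theorem forall_lt_succ_iff {i b : ℕ} {P : ℕ → Prop} (hb : i ≤ b) :
    (∀ c, i ≤ c → c < b + 1 → P c) ↔ (∀ c, i ≤ c → c < b → P c) ∧ P b := by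
  constructor
  · exact fun h => ⟨fun c h1 h2 => h c h1 (by omega), h b hb (by omega)⟩
  · rintro ⟨h1, h2⟩ c h3 h4
    rcases Nat.lt_or_eq_of_le (Nat.le_of_lt_succ h4) with h5 | rfl
    exacts [h1 c h3 h5, h2]

theorem comp_feasProg_inner (hB : LargeBound B n) (hs : Ready G s) {rv i a z : ℕ}
    (hrv : rv < 13) (hv : s.reg rv = z) (hz : z < n) (hin : i ≤ n) (han : a < n)
    (h14 : s.reg 14 = a) (h15 : s.reg 15 = s.arr 1 a) (h16 : s.reg 16 = i) (h13 : s.reg 13 ≤ 1) :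
    Comp B (.loop 16 0 <| .seq (.load 17 1 16) <| .seq (lookupProg rv) <|
      .seq (.branch 2 19 (.const 13 0) .skip) <| .add 16 16 1) s ((n - i) * 20 + 1)
      fun s' => Frame 13 s s' ∧ s'.reg 14 = a ∧ s'.reg 13 ≤ 1 ∧ (0 < s'.reg 13 ↔
        0 < s.reg 13 ∧ ∀ b, i ≤ b → b < n → ¬ natBetween G (s.arr 1 a) (s.arr 1 b) z) := by
  have hl := hB.lin
  set W := s.arr 1 with hW
  refine Comp.forLoop (e := n) (c := 19) (b := i) (I := fun b s' => Frame 13 s s' ∧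
    s'.reg 14 = a ∧ s'.reg 15 = W a ∧ s'.reg 16 = b ∧ s'.reg 13 ≤ 1 ∧ (0 < s'.reg 13 ↔
      0 < s.reg 13 ∧ ∀ b', i ≤ b' → b' < b → ¬ natBetween G (W a) (W b') z)) ?_ hin ?_ ?_ ?_
      (by omega)
  · rintro b s' ⟨hf', -, -, hb, -⟩
    exact ⟨hb, (hs.frame hf' (by omega)).reg_zero⟩
  · rintro b s' hib hbn ⟨hf', g14, g15, g16, g13, gP⟩
    have hr := hs.frame hf' (by omega)
    have harr : s'.arr 1 = W := congrFun hf'.1 1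
    have hWa : W a < n := hs.word_lt a han
    have hWb : W b < n := hs.word_lt b hbn
    refine Comp.load_seq (T := 18) ?_ ?_
    · rw [harr, g16]
      omega
    rw [harr, g16]
    have hf1 : Frame 17 s' (s'.setReg 17 (W b)) := (Frame.refl _ _).setReg le_rfl
    refine (comp_lookupProg hB (hr.frame hf1 (by omega)) hrv (x := W a) (y := W b) (z := z)
      (by simp [g15]) (by simp) ?_ hWa hWb hz).seq (T₂ := 5) ?_
    · rw [hf1.2 rv (by omega), hf'.2 rv hrv, hv]
    rintro s₁ ⟨hf2, hbet⟩
    have hf3 := hf1.trans hf2 (by omega)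
    have hf4 := hf'.trans hf3 (by omega)
    have hr' := hs.frame hf4 (by omega)
    have e13 := hf3.2 13 (by omega)
    have e14 := hf3.2 14 (by omega)
    have e15 := hf3.2 15 (by omega)
    have e16 := hf3.2 16 (by omega)
    refine Comp.seq (T₁ := 2) (T₂ := 1) (Q₁ := fun s'' => Frame 13 s s'' ∧
      s''.reg 14 = a ∧ s''.reg 15 = W a ∧ s''.reg 16 = b ∧ s''.reg 13 ≤ 1 ∧ (0 < s''.reg 13 ↔
        0 < s.reg 13 ∧ ∀ b', i ≤ b' → b' < b + 1 → ¬ natBetween G (W a) (W b') z)) ?_ ?_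
    · simp only [forall_lt_succ_iff hib]
      refine Comp.branch (T := 1) (fun h => ?_) (fun h => ?_)
      · rw [hr'.reg_two, hbet] at h
        refine Comp.const (by omega) ⟨hf4.setReg le_rfl, ?_⟩
        simp [e14, e15, e16, g14, g15, g16, h]
      · rw [hr'.reg_two, hbet] at h
        refine Comp.skip ⟨hf4, ?_⟩
        simp only [e13, e14, e15, e16, g14, g15, g16, h, gP, g13, not_false_eq_true, and_true]
    · rintro s'' ⟨f1, f2, f3, f4, f5, f6⟩
      have hr1' := (hs.frame f1 (by omega)).reg_one
      refine Comp.add (by omega) ⟨f1.setReg (by omega), ?_⟩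
      simp [f2, f3, f4, f5, f6, hr1']
  · refine ⟨Frame.refl _ _, h14, h15, h16, h13, ?_⟩
    constructor
    · exact fun h => ⟨h, fun b' h1 h2 => by omega⟩
    · exact fun h => h.1
  · rintro s' ⟨f1, f2, f3, f4, f5, f6⟩
    exact ⟨f1, f2, f5, f6⟩

theorem comp_feasProg (hB : LargeBound B n) (hs : Ready G s) {ri rv i z : ℕ} (hri : ri < 13)
    (hrv : rv < 13) (hi : s.reg ri = i) (hv : s.reg rv = z) (hin : i ≤ n) (hz : z < n) :
    Comp B (feasProg ri rv) s (30 * (n - i + 1) ^ 2) fun s' => Frame 13 s s' ∧ s'.reg 13 ≤ 1 ∧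
      (0 < s'.reg 13 ↔ FeasibleFrom G (s.arr 1) i z) := by
  have hl := hB.lin
  set W := s.arr 1 with hW
  have hr2 := hs.reg_two
  have h13 : ri ≠ 13 := by omega
  have h15 : ri ≠ 15 := by omega
  refine Comp.mono (T := ((n - i) * ((n - i) * 20 + 5) + 1) + 1 + 1) ?_ ?_ fun _ h => h
  · refine Comp.const_seq (by omega) <| Comp.add_seq ?_ ?_
    · simp [hi, hr2, h13]
      omega
    refine Comp.forLoop (e := n) (c := (n - i) * 20 + 4) (b := i) (I := fun a s' => Frame 13 s s' ∧
      s'.reg 14 = a ∧ s'.reg 13 ≤ 1 ∧ (0 < s'.reg 13 ↔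
        ∀ a', i ≤ a' → a' < a → ∀ b, i ≤ b → b < n → ¬ natBetween G (W a') (W b) z))
        ?_ hin ?_ ?_ ?_ le_rfl
    · rintro a s' ⟨hf', hb, -⟩
      exact ⟨hb, (hs.frame hf' (by omega)).reg_zero⟩
    · rintro a s' hia han ⟨hf', g14, g13, gP⟩
      have hr := hs.frame hf' (by omega)
      have harr : s'.arr 1 = W := congrFun hf'.1 1
      have hWa : W a < n := hs.word_lt a han
      have hri' : s'.reg ri = i := (hf'.2 ri hri).trans hi
      refine Comp.load_seq ?_ <| Comp.add_seq ?_ ?_ (T := (n - i) * 20 + 2)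
      · rw [g14, harr]
        omega
      · simp [hri', hr.reg_two, h15]
        omega
      simp only [forall_lt_succ_iff hia]
      rw [g14, harr]
      set s₁ := (s'.setReg 15 (W a)).setReg 16
        ((s'.setReg 15 (W a)).reg ri + (s'.setReg 15 (W a)).reg 2) with hs₁
      have hf1 : Frame 13 s' s₁ := ((Frame.refl _ _).setReg (by omega)).setReg (by omega)
      have hW1 : s₁.arr 1 = W := by rw [hf1.1, harr]
      refine (comp_feasProg_inner (s := s₁) (rv := rv) (i := i) (a := a) (z := z) hB
        (hr.frame hf1 (by omega)) hrv
        ((hf1.2 rv hrv).trans ((hf'.2 rv hrv).trans hv)) hz hin han (by simp [hs₁, g14])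
        (by rw [hW1]; simp [hs₁]) (by simp [hs₁, hri', hr.reg_two, h15])
        (by simpa [hs₁] using g13)).seq (T₂ := 1) ?_
      rintro s'' ⟨f1, f2, f3, f4⟩
      have hf2 := (hf'.trans hf1 le_rfl).trans f1 le_rfl
      have hr1 := (hs.frame hf2 (by omega)).reg_one
      refine Comp.add (by rw [f2, hr1]; omega) ⟨hf2.setReg (by omega), by simp [f2, hr1], ?_, ?_⟩
      · simpa using f3
      · have e13 : s₁.reg 13 = s'.reg 13 := by simp [hs₁]
        rw [e13, gP, hW1] at f4
        simpa using f4
    · refine ⟨((Frame.refl 13 s).setReg (by omega)).setReg (by omega), ?_⟩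
      simp [hi, hr2, h13]
      intro a' h1 h2
      omega
    · rintro s' ⟨f1, f2, f3, f4⟩
      exact ⟨f1, f3, f4⟩
  · nlinarith

end Feasibility

/-! ### The least and the greatest feasible letter -/

section Hub

variable {n : ℕ} {G : SimpleGraph (Fin n)} {B : ℕ} {s s' : State}

/-- Find the least and the greatest feasible entry of the output array from the position in
register `i` on; they go to the registers `9` and `10`. -/
def hubProg (i : ℕ) : Prog :=
  .seq (.add 9 0 2) <| .seq (.const 10 0) <| .seq (.add 11 i 2) <|
  .loop 11 0 <| .seq (.load 12 1 11) <| .seq (feasProg i 12) <|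
    .seq (.branch 2 13
      (.seq (.branch 12 9 (.add 9 12 2) .skip) (.branch 10 12 (.add 10 12 2) .skip)) .skip) <|
    .add 11 11 1

/-- The bounds `h` and `g` are attained and hold for the feasible entries at the positions from `i`
to `p - 1`, or they have the initial values `n` and `0`. -/
def HubInvariant (G : SimpleGraph (Fin n)) (W : ℕ → ℕ) (i p h g : ℕ) : Prop :=
  (∀ a, i ≤ a → a < p → FeasibleFrom G W i (W a) → h ≤ W a ∧ W a ≤ g) ∧
  (h = n ∨ ∃ a, i ≤ a ∧ a < p ∧ FeasibleFrom G W i (W a) ∧ W a = h) ∧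
  (g = 0 ∨ ∃ a, i ≤ a ∧ a < p ∧ FeasibleFrom G W i (W a) ∧ W a = g)

theorem HubInvariant.skip {W : ℕ → ℕ} {i p h g : ℕ} (hI : HubInvariant G W i p h g)
    (hp : ¬ FeasibleFrom G W i (W p)) : HubInvariant G W i (p + 1) h g := by
  refine ⟨fun a h1 h2 hf => ?_, hI.2.1.imp_right ?_, hI.2.2.imp_right ?_⟩
  · rcases Nat.lt_or_eq_of_le (Nat.le_of_lt_succ h2) with h3 | rfl
    exacts [hI.1 a h1 h3 hf, absurd hf hp]
  all_goals
    rintro ⟨a, h1, h2, h3⟩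
    exact ⟨a, h1, by omega, h3⟩

theorem HubInvariant.update {W : ℕ → ℕ} {i p h g : ℕ} (hI : HubInvariant G W i p h g)
    (hip : i ≤ p) (hp : FeasibleFrom G W i (W p)) :
    HubInvariant G W i (p + 1) (min h (W p)) (max g (W p)) := by
  refine ⟨fun a h1 h2 hf => ?_, ?_, ?_⟩
  · rcases Nat.lt_or_eq_of_le (Nat.le_of_lt_succ h2) with h3 | rfl
    · have := hI.1 a h1 h3 hf
      omega
    · omega
  · rcases le_total h (W p) with h1 | h1
    · rw [min_eq_left h1]
      refine hI.2.1.imp_right ?_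
      rintro ⟨a, h1, h2, h3⟩
      exact ⟨a, h1, by omega, h3⟩
    · rw [min_eq_right h1]
      exact .inr ⟨p, hip, by omega, hp, rfl⟩
  · rcases le_total (W p) g with h1 | h1
    · rw [max_eq_left h1]
      refine hI.2.2.imp_right ?_
      rintro ⟨a, h1, h2, h3⟩
      exact ⟨a, h1, by omega, h3⟩
    · rw [max_eq_right h1]
      exact .inr ⟨p, hip, by omega, hp, rfl⟩

theorem comp_hubProg (hB : LargeBound B n) (hs : Ready G s) {ri i : ℕ} (hri : ri < 9)
    (hi : s.reg ri = i) (hin : i ≤ n)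
    (hex : ∃ a, i ≤ a ∧ a < n ∧ FeasibleFrom G (s.arr 1) i (s.arr 1 a)) :
    Comp B (hubProg ri) s (40 * (n - i + 1) ^ 3) fun s' => Frame 9 s s' ∧
      (∃ a, i ≤ a ∧ a < n ∧ FeasibleFrom G (s.arr 1) i (s.arr 1 a) ∧ s.arr 1 a = s'.reg 9) ∧
      (∃ a, i ≤ a ∧ a < n ∧ FeasibleFrom G (s.arr 1) i (s.arr 1 a) ∧ s.arr 1 a = s'.reg 10) ∧
      ∀ a, i ≤ a → a < n → FeasibleFrom G (s.arr 1) i (s.arr 1 a) →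
        s'.reg 9 ≤ s.arr 1 a ∧ s.arr 1 a ≤ s'.reg 10 := by
  have hl := hB.lin
  set W := s.arr 1 with hW
  have hr0 := hs.reg_zero
  have hr2 := hs.reg_two
  have h9 : ri ≠ 9 := by omega
  have h10 : ri ≠ 10 := by omega
  set c := 30 * (n - i + 1) ^ 2 + 8 with hc
  refine Comp.mono (T := ((n - i) * (c + 1) + 1) + 1 + 1 + 1) ?_ ?_ fun _ h => h
  · refine Comp.add_seq ?_ <| Comp.const_seq (by omega) <| Comp.add_seq ?_ ?_
    · rw [hr0, hr2]
      omega
    · simp [hi, hr2, h9, h10]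
      omega
    refine Comp.forLoop (e := n) (c := c) (b := i) (I := fun p s' => Frame 9 s s' ∧
      s'.reg 11 = p ∧ s'.reg 9 ≤ n ∧ s'.reg 10 ≤ n ∧
      HubInvariant G W i p (s'.reg 9) (s'.reg 10)) ?_ hin ?_ ?_ ?_ le_rfl
    · rintro p s' ⟨hf', hp, -⟩
      exact ⟨hp, (hs.frame hf' (by omega)).reg_zero⟩
    · rintro p s' hip hpn ⟨hf', g11, g9, g10, gI⟩
      have hr := hs.frame hf' (by omega)
      have harr : s'.arr 1 = W := congrFun hf'.1 1
      have hWp : W p < n := hs.word_lt p hpn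
      refine Comp.load_seq ?_ ?_ (T := 30 * (n - i + 1) ^ 2 + 7)
      · rw [g11, harr]
        omega
      rw [g11, harr]
      have hf1 : Frame 12 s' (s'.setReg 12 (W p)) := (Frame.refl _ _).setReg (by omega)
      refine (comp_feasProg hB (hr.frame hf1 (by omega)) (ri := ri) (rv := 12) (i := i)
        (z := W p) (by omega) (by omega) ?_ (by simp) hin hWp).seq (T₂ := 7) ?_
      · rw [hf1.2 ri (by omega), hf'.2 ri hri, hi]
      rintro s₁ ⟨hf2, -, hfeas⟩
      have hf3 : Frame 12 s' s₁ := hf1.trans hf2 (by omega)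
      have hf4 : Frame 9 s s₁ := hf'.trans hf3 (by omega)
      have hr' := hs.frame hf4 (by omega)
      have e9 := hf3.2 9 (by omega)
      have e10 := hf3.2 10 (by omega)
      have e11 := hf3.2 11 (by omega)
      have e12 : s₁.reg 12 = W p := by rw [hf2.2 12 (by omega)]; simp
      have r2 := hr'.reg_two
      rw [State.setReg_arr, harr] at hfeas
      refine Comp.seq (T₁ := 6) (T₂ := 1) (Q₁ := fun s'' => Frame 9 s s'' ∧ s''.reg 11 = p ∧
        s''.reg 9 ≤ n ∧ s''.reg 10 ≤ n ∧
        HubInvariant G W i (p + 1) (s''.reg 9) (s''.reg 10)) ?_ ?_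
      · refine Comp.branch (T := 5) (fun h => ?_) (fun h => ?_)
        · rw [r2, hfeas] at h
          have hup := gI.update hip h
          refine Comp.seq (T₁ := 2) (T₂ := 2) (Q₁ := fun s'' => Frame 9 s s'' ∧
            s''.reg 11 = p ∧ s''.reg 12 = W p ∧ s''.reg 10 = s'.reg 10 ∧
            s''.reg 9 = min (s'.reg 9) (W p)) ?_ ?_
          · refine Comp.branch (T := 1) (fun h => ?_) (fun h => ?_)
            · rw [e12, e9] at h
              refine Comp.add (by rw [e12, r2]; omega) ⟨hf4.setReg le_rfl, ?_⟩
              simp [e10, e11, e12, r2, g11, h.le]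
            · rw [e12, e9] at h
              exact Comp.skip ⟨hf4, by rw [e11, g11], e12, e10, by rw [e9]; omega⟩
          · rintro s₂ ⟨f1, f2, f3, f4, f5⟩
            have r2' := (hs.frame f1 (by omega)).reg_two
            refine Comp.branch (T := 1) (fun h => ?_) (fun h => ?_)
            · rw [f3, f4] at h
              refine Comp.add (by rw [f3, r2']; omega) ⟨f1.setReg (by omega), ?_⟩
              rw [max_eq_right h.le] at hup
              simp only [State.setReg_reg]
              simp [f2, f3, f5, r2', hup]
              omega
            · rw [f3, f4] at h
              rw [max_eq_left (by omega)] at hup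
              refine Comp.skip ⟨f1, f2, by omega, by omega, ?_⟩
              rw [f4, f5]
              exact hup
        · rw [r2, hfeas] at h
          refine Comp.skip ⟨hf4, by rw [e11, g11], by omega, by omega, ?_⟩
          rw [e9, e10]
          exact gI.skip h
      · rintro s'' ⟨f1, f2, f3, f4, f5⟩
        have r1 := (hs.frame f1 (by omega)).reg_one
        refine Comp.add (by rw [f2, r1]; omega) ⟨f1.setReg (by omega), ?_⟩
        simp only [State.setReg_reg]
        simp [f2, f3, f4, f5, r1]
    · refine ⟨(((Frame.refl 9 s).setReg (by omega)).setReg (by omega)).setReg (by omega), ?_⟩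
      simp only [State.setReg_reg]
      simp [hi, hr0, hr2, h9, h10]
      exact ⟨fun a h1 h2 => by omega, .inl rfl, .inl rfl⟩
    · rintro s' ⟨f1, f2, f3, f4, f5, f6, f7⟩
      obtain ⟨a, ha1, ha2, ha3⟩ := hex
      have hWa : W a < n := hs.word_lt a ha2
      have hb := f5 a ha1 ha2 ha3
      refine ⟨f1, f6.resolve_left (by omega), ?_, f5⟩
      rcases f7 with h | h
      · exact ⟨a, ha1, ha2, ha3, by omega⟩
      · exact h
  · rw [hc]
    generalize n - i = m
    nlinarith [sq_nonneg m, Nat.zero_le (m ^ 3)]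

end Hub

/-! ### Finding the position of a move from the end of the word -/

section Scan

variable {V : Type*} [LinearOrder V] {bt : V → V → V → Prop} {s : Bool} {w : List V}

variable (bt) in
/-- The letters at the positions `i` and `i + 1` may be exchanged, and the rest of the word is
special. -/
def LinkAt (s : Bool) (w : List V) (i : ℕ) : Prop :=
  ∃ x y r, w.drop i = x :: y :: r ∧ Linkable bt x y r ∧ IsSpecial bt r s

/-- `w'` is obtained from `w` by exchanging the letters at the positions `i` and `i + 1`. -/
def SwappedAt (i : ℕ) (w w' : List V) : Prop :=
  ∃ p x y r, p.length = i ∧ w = p ++ x :: y :: r ∧ w' = p ++ y :: x :: r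

variable (bt) in
/-- The move that acts on the positions of the parity of `c`. -/
noncomputable def parityMove (c : ℕ) (p : List V × Bool) : List V × Bool :=
  if Even c then move bt p.2 p.1 else tailMove bt p.2 p.1

theorem firstMove_eq_parityMove (n : ℕ) : firstMove bt n = parityMove bt (n + 2) := by
  funext p
  simp [firstMove, parityMove, Nat.even_add]

theorem secondMove_eq_parityMove (n : ℕ) : secondMove bt n = parityMove bt (n + 3) := by
  funext p
  have h3 : ¬ Even 3 := by decide
  by_cases h : Even n <;> simp [secondMove, parityMove, Nat.even_add, h, h3]

theorem linkAt_cons {x : V} {i : ℕ} : LinkAt bt s (x :: w) (i + 1) ↔ LinkAt bt s w i := by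
  rw [LinkAt, LinkAt, List.drop_succ_cons]

/-- A link requires a link two positions further on. -/
theorem LinkAt.add_two {i : ℕ} (h : LinkAt bt s w i) (hi : i + 4 ≤ w.length) :
    LinkAt bt s w (i + 2) := by
  obtain ⟨x, y, r, hw, -, hr⟩ := h
  have hdrop : w.drop (i + 2) = r := by
    rw [← List.drop_drop, hw]
    rfl
  have hlen : r.length = w.length - (i + 2) := by rw [← hdrop, List.length_drop]
  rcases r with _ | ⟨x', _ | ⟨y', r⟩⟩
  · simp at hlen
    omega
  · simp at hlen
    omega
  · obtain ⟨rfl, hc⟩ := hr.resolve_left (by simp)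
    exact ⟨x', y', r, hdrop, hc.linkable, hc.isSpecial⟩

theorem LinkAt.lt {i : ℕ} (h : LinkAt bt s w i) : i + 2 ≤ w.length := by
  obtain ⟨x, y, r, hw, -⟩ := h
  have := congrArg List.length hw
  simp only [List.length_drop, List.length_cons] at this
  omega

theorem LinkAt.add_mul_two {i : ℕ} (h : LinkAt bt s w i) {k : ℕ} (hk : i + 2 * k + 2 ≤ w.length) :
    LinkAt bt s w (i + 2 * k) := by
  induction k with
  | zero => exact h
  | succ k ih => exact (ih (by omega)).add_two (by omega)

theorem move_of_linkAt : ∀ (k : ℕ) (w : List V), LinkAt bt s w (2 * k) →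
    (k = 0 ∨ ¬ LinkAt bt s w (2 * k - 2)) →
      ∃ w', SwappedAt (2 * k) w w' ∧ move bt s w = (w', s)
  | 0, w, ⟨x, y, r, hw, h⟩, _ => by
    simp only [Nat.mul_zero, List.drop_zero] at hw
    subst hw
    exact ⟨_, ⟨[], x, y, r, rfl, rfl, rfl⟩, by rw [move, if_pos h]; rfl⟩
  | k + 1, w, h, hk => by
    replace hk := hk.resolve_left (by omega)
    have hlen := h.lt
    rcases w with _ | ⟨x, _ | ⟨y, r⟩⟩
    · simp at hlen
    · simp at hlen
    rw [show 2 * (k + 1) = 2 * k + 1 + 1 by ring, linkAt_cons, linkAt_cons] at h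
    have h0 : ¬ (Linkable bt x y r ∧ IsSpecial bt r s) := by
      intro hc
      have h0 : LinkAt bt s (x :: y :: r) 0 := ⟨x, y, r, rfl, hc⟩
      refine hk ?_
      have := h0.add_mul_two (k := k) (by omega)
      rwa [show 0 + 2 * k = 2 * (k + 1) - 2 by omega] at this
    obtain ⟨w', ⟨p, a, b, q, hp, rfl, rfl⟩, hm⟩ := move_of_linkAt k r h (by
      rcases k with _ | k
      · exact .inl rfl
      · right
        rw [show 2 * (k + 1 + 1) - 2 = (2 * (k + 1) - 2) + 1 + 1 by omega, linkAt_cons,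
          linkAt_cons] at hk
        exact hk)
    refine ⟨x :: y :: (p ++ b :: a :: q), ⟨x :: y :: p, a, b, q, ?_, rfl, rfl⟩, ?_⟩
    · simp [hp]
      ring
    · rw [move, if_neg h0, hm]

theorem move_of_not_linkAt : ∀ (w : List V), (∀ k, ¬ LinkAt bt s w (2 * k)) →
    move bt s w = (w, !s)
  | [], _ => rfl
  | [_], _ => rfl
  | x :: y :: r, h => by
    have h0 : ¬ (Linkable bt x y r ∧ IsSpecial bt r s) := fun hc => h 0 ⟨x, y, r, rfl, hc⟩
    rw [move, if_neg h0, move_of_not_linkAt r fun k hk => h (k + 1) ?_]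
    rwa [show 2 * (k + 1) = 2 * k + 1 + 1 by ring, linkAt_cons, linkAt_cons]

theorem parityMove_of_linkAt {c i : ℕ} (hc : Even c ↔ Even i) (hi : LinkAt bt s w i)
    (hi' : i < 2 ∨ ¬ LinkAt bt s w (i - 2)) :
    ∃ w', SwappedAt i w w' ∧ parityMove bt c (w, s) = (w', s) := by
  rcases Nat.even_or_odd' i with ⟨k, rfl | rfl⟩
  · rw [parityMove, if_pos (hc.2 (by simp))]
    exact move_of_linkAt k w hi (hi'.imp_left fun h => by omega)
  · rw [parityMove, if_neg (fun h => by simpa using hc.1 h)]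
    have hlen := hi.lt
    rcases w with _ | ⟨x, w⟩
    · simp at hlen
    rw [linkAt_cons] at hi
    obtain ⟨w', ⟨p, a, b, q, hp, rfl, rfl⟩, hm⟩ := move_of_linkAt k w hi (by
      rcases k with _ | k
      · exact .inl rfl
      · right
        have := hi'.resolve_left (by omega)
        rwa [show 2 * (k + 1) + 1 - 2 = (2 * (k + 1) - 2) + 1 by omega, linkAt_cons] at this)
    refine ⟨x :: (p ++ b :: a :: q), ⟨x :: p, a, b, q, by simp [hp], rfl, rfl⟩, ?_⟩
    simp only [tailMove, hm]

theorem parityMove_of_not_linkAt {d : ℕ} (hd : d = 2 ∨ d = 3)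
    (h : w.length < d ∨ ¬ LinkAt bt s w (w.length - d)) :
    parityMove bt (w.length + d) (w, s) = (w, !s) := by
  -- By heredity, no position of the same parity as the last one carries a link.
  have hnone : ∀ i, (Even i ↔ Even (w.length + d)) → ¬ LinkAt bt s w i := by
    intro i hi hlk
    have hlen := hlk.lt
    rcases h with h | h
    · have hw2 : w.length = 2 ∧ d = 3 ∧ i = 0 := by omega
      obtain ⟨h1, rfl, rfl⟩ := hw2
      rw [h1] at hi
      simp at hi
      exact absurd hi (by decide)
    · have hle : i + d ≤ w.length := by
        by_contra hlt
        have : d = 3 ∧ w.length = i + 2 := by omega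
        obtain ⟨rfl, h1⟩ := this
        have h3 : ¬ Even 3 := by decide
        simp only [Nat.even_add, h3, h1, even_two] at hi
        tauto
      have heven : Even (w.length - d - i) := by
        rw [Nat.even_sub (by omega), Nat.even_sub (by omega), hi, Nat.even_add]
      obtain ⟨k, hk⟩ := heven
      refine h ?_
      have := hlk.add_mul_two (k := k) (by omega)
      rwa [show i + 2 * k = w.length - d by omega] at this
  by_cases hc : Even (w.length + d)
  · rw [parityMove, if_pos hc]
    exact move_of_not_linkAt w fun k => hnone _ (by simp [hc])
  · rw [parityMove, if_neg hc]
    rcases w with _ | ⟨x, w⟩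
    · rfl
    · simp only [tailMove]
      rw [move_of_not_linkAt w fun k hk => hnone (2 * k + 1)
        (iff_of_false (by simp) hc) (linkAt_cons.2 hk)]

end Scan

/-! ### Inspecting a position -/

section Inspect

variable {n : ℕ} {G : SimpleGraph (Fin n)} {B : ℕ} {s s' : State} {w : List (Fin n)} {W : ℕ → ℕ}

/-- The first `n` entries of the array `W` are the letters of `w`. -/
def Holds (w : List (Fin n)) (W : ℕ → ℕ) : Prop := (List.range n).map W = w.map Fin.val

theorem Holds.length_eq (h : Holds w W) : w.length = n := by
  simpa using (congrArg List.length h).symm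

theorem Holds.getElem (h : Holds w W) {a : ℕ} (ha : a < w.length) : W a = (w[a]).val := by
  have h1 : ((List.range n).map W)[a]? = (w.map Fin.val)[a]? := by rw [h]
  have h2 : a < n := h.length_eq ▸ ha
  rw [List.getElem?_map, List.getElem?_map, List.getElem?_range h2,
    List.getElem?_eq_getElem ha] at h1
  simpa using h1

theorem Holds.drop (h : Holds w W) {i : ℕ} {x : Fin n} {r : List (Fin n)}
    (hi : w.drop i = x :: r) : W i = x.val ∧ i < n := by
  have hlt : i < w.length := by
    by_contra hge
    rw [List.drop_eq_nil_of_le (by omega)] at hi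
    simp at hi
  rw [h.getElem hlt]
  rw [List.drop_eq_getElem_cons hlt] at hi
  exact ⟨congrArg Fin.val (List.cons.inj hi).1, h.length_eq ▸ hlt⟩

theorem holds_mem_drop (h : Holds w W) {i : ℕ} {x : Fin n} :
    x ∈ w.drop i ↔ ∃ a, i ≤ a ∧ a < n ∧ W a = x.val := by
  rw [List.mem_drop_iff_getElem]
  constructor
  · rintro ⟨a, ha, rfl⟩
    exact ⟨i + a, by omega, by have := h.length_eq; omega, h.getElem _⟩
  · rintro ⟨a, h1, h2, h3⟩
    have hlen := h.length_eq
    refine ⟨a - i, by omega, Fin.ext ?_⟩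
    rw [← h3, h.getElem (by omega)]
    simp [Nat.add_sub_cancel' h1]

theorem feasibleFrom_iff (h : Holds w W) {i : ℕ} {z : Fin n} (hz : z ∈ w.drop i) :
    FeasibleFrom G W i z.val ↔ Feasible (Between G) (w.drop i) z := by
  constructor
  · refine fun hf => ⟨hz, fun x hx y hy hb => ?_⟩
    obtain ⟨a, ha1, ha2, ha3⟩ := (holds_mem_drop h).1 hx
    obtain ⟨b, hb1, hb2, hb3⟩ := (holds_mem_drop h).1 hy
    refine hf a ha1 ha2 b hb1 hb2 ?_
    rw [ha3, hb3]
    exact ⟨x.2, y.2, z.2, hb⟩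
  · rintro hf a ha1 ha2 b hb1 hb2 ⟨hx, hy, hz', hb⟩
    exact hf.2 _ ((holds_mem_drop h).2 ⟨a, ha1, ha2, rfl⟩) _
      ((holds_mem_drop h).2 ⟨b, hb1, hb2, rfl⟩) hb

theorem comp_hubProg_word (hB : LargeBound B n) (hs : Ready G s) (hw : Holds w (s.arr 1))
    {ri i : ℕ} (hri : ri < 9) (hi : s.reg ri = i) {x : Fin n}
    (hx : Feasible (Between G) (w.drop i) x) :
    Comp B (hubProg ri) s (40 * (n - i + 1) ^ 3) fun s' => Frame 9 s s' ∧
      ∃ h g : Fin n, IsFirst (Between G) (w.drop i) h ∧ IsLast (Between G) (w.drop i) g ∧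
        s'.reg 9 = h.val ∧ s'.reg 10 = g.val := by
  obtain ⟨a, ha1, ha2, ha3⟩ := (holds_mem_drop hw).1 hx.1
  refine (comp_hubProg hB hs hri hi (by omega)
    ⟨a, ha1, ha2, by rw [ha3]; exact (feasibleFrom_iff hw hx.1).2 hx⟩).mono le_rfl ?_
  rintro s' ⟨hf, ⟨b, hb1, hb2, hb3, hb4⟩, ⟨c, hc1, hc2, hc3, hc4⟩, hall⟩
  have hfeas : ∀ b, i ≤ b → (hb2 : b < n) → FeasibleFrom G (s.arr 1) i (s.arr 1 b) →
      Feasible (Between G) (w.drop i) ⟨s.arr 1 b, hs.word_lt b hb2⟩ := by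
    intro b hb1 hb2 hb3
    have hmem : (⟨s.arr 1 b, hs.word_lt b hb2⟩ : Fin n) ∈ w.drop i :=
      (holds_mem_drop hw).2 ⟨b, hb1, hb2, rfl⟩
    exact (feasibleFrom_iff hw hmem).1 hb3
  have hle : ∀ z, Feasible (Between G) (w.drop i) z → s'.reg 9 ≤ z.val ∧ z.val ≤ s'.reg 10 := by
    intro z hz
    obtain ⟨d, hd1, hd2, hd3⟩ := (holds_mem_drop hw).1 hz.1
    rw [← hd3]
    exact hall d hd1 hd2 (by rw [hd3]; exact (feasibleFrom_iff hw hz.1).2 hz)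
  refine ⟨hf, ⟨_, hs.word_lt b hb2⟩, ⟨_, hs.word_lt c hc2⟩, ⟨hfeas b hb1 hb2 hb3, fun z hz => ?_⟩,
    ⟨hfeas c hc1 hc2 hc3, fun z hz => ?_⟩, hb4.symm, hc4.symm⟩
  · rw [Fin.le_def]
    exact hb4.le.trans (hle z hz).1
  · rw [Fin.le_def]
    exact (hle z hz).2.trans hc4.ge

/-- Compare the letters in registers `11` and `12` with the hub and the greatest feasible letter
in registers `9` and `10`. A sum of two truncated differences tells whether two letters differ. -/
def compareProg : Prog :=
  .seq (.sub 14 11 9) <| .seq (.sub 15 9 11) <| .seq (.add 14 14 15) <|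
  .seq (.sub 15 12 9) <| .seq (.sub 16 9 12) <| .seq (.add 15 15 16) <|
  .seq (.sub 16 11 10) <| .seq (.sub 17 10 11) <| .seq (.add 16 16 17) <|
  .seq (.sub 17 12 10) <| .seq (.sub 18 10 12) <| .seq (.add 17 17 18) <|
  .seq (.mul 18 14 15) <| .seq (.add 14 14 17) <| .add 15 15 16

theorem comp_compareProg (hB : LargeBound B n) {a b h g : ℕ} (ha : s.reg 11 = a)
    (hb : s.reg 12 = b) (hh : s.reg 9 = h) (hg : s.reg 10 = g) (han : a < n) (hbn : b < n)
    (hhn : h < n) (hgn : g < n) : Comp B compareProg s 15 fun s' => Frame 14 s s' ∧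
      (s'.reg 18 < 1 ↔ a = h ∨ b = h) ∧ (s'.reg 14 < 1 ↔ a = h ∧ b = g) ∧
      (s'.reg 15 < 1 ↔ b = h ∧ a = g) := by
  have hl := hB.lin
  have hsq := hB.sq
  have hm : (a - h + (h - a)) * (b - h + (h - b)) ≤ n * n :=
    Nat.mul_le_mul (by omega) (by omega)
  refine Comp.sub_seq ?_ <| Comp.sub_seq ?_ <| Comp.add_seq ?_ <|
    Comp.sub_seq ?_ <| Comp.sub_seq ?_ <| Comp.add_seq ?_ <|
    Comp.sub_seq ?_ <| Comp.sub_seq ?_ <| Comp.add_seq ?_ <|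
    Comp.sub_seq ?_ <| Comp.sub_seq ?_ <| Comp.add_seq ?_ <|
    Comp.mul_seq ?_ <| Comp.add_seq ?_ <| Comp.add ?_ ⟨?_, ?_⟩
  rotate_right 2
  · iterate 15 refine Frame.setReg ?_ (by omega)
    exact Frame.refl _ _
  · simp [ha, hb, hh, hg]
    omega
  all_goals
    simp [ha, hb, hh, hg]
    omega

/-- Inspect the position `i` in register `5`: compute whether the letters there may be linked, and
whether they are the first two of a canonical word, in the one order or the other. -/
def inspectProg : Prog :=
  .seq (hubProg 5) <| .seq (.load 11 1 5) <| .seq (.add 12 5 1) <| .seq (.load 12 1 12) <|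
  .seq (feasProg 5 12) compareProg

theorem comp_inspectProg (hB : LargeBound B n) (hs : Ready G s) (hw : Holds w (s.arr 1))
    (hwf : FeasibleWord (Between G) w) {i : ℕ} (hi : s.reg 5 = i) {x y : Fin n}
    {r : List (Fin n)} (hxy : w.drop i = x :: y :: r) :
    Comp B inspectProg s (100 * (n - i + 1) ^ 3) fun s' => Frame 9 s s' ∧
      (0 < s'.reg 13 ∧ s'.reg 18 < 1 ↔ Linkable (Between G) x y r) ∧
      (s'.reg 14 < 1 ↔ IsFirst (Between G) (x :: y :: r) x ∧ IsLast (Between G) (x :: y :: r) y) ∧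
      (s'.reg 15 < 1 ↔
        IsFirst (Between G) (x :: y :: r) y ∧ IsLast (Between G) (x :: y :: r) x) := by
  have hl := hB.lin
  have hfx : Feasible (Between G) (w.drop i) x := by
    have := hwf.drop i
    rw [hxy] at this ⊢
    exact this.1
  obtain ⟨hWx, hin⟩ := hw.drop hxy
  have hxy' : w.drop (i + 1) = y :: r := by
    rw [← List.drop_drop, hxy]
    rfl
  obtain ⟨hWy, hin'⟩ := hw.drop hxy'
  have hpow : 30 * (n - i + 1) ^ 2 ≤ 30 * (n - i + 1) ^ 3 :=
    Nat.mul_le_mul_left _ (Nat.pow_le_pow_right (by omega) (by omega))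
  have hpos : 1 ≤ (n - i + 1) ^ 3 := Nat.one_le_pow _ _ (by omega)
  refine (comp_hubProg_word hB hs hw (ri := 5) (by omega) hi hfx).seq
    (T₂ := 30 * (n - i + 1) ^ 2 + 15 + 1 + 1 + 1) ?_ (by omega)
  rintro s₁ ⟨hf1, h, g, hh, hg, e9, e10⟩
  have hr1 := hs.frame hf1 (by omega)
  have e5 : s₁.reg 5 = i := (hf1.2 5 (by omega)).trans hi
  have harr1 : s₁.arr 1 = s.arr 1 := congrFun hf1.1 1
  refine Comp.load_seq ?_ <| Comp.add_seq ?_ <| Comp.load_seq ?_ ?_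
  · rw [e5, harr1, hWx]
    omega
  · simp [e5, hr1.reg_one]
    omega
  · simp [e5, hr1.reg_one, harr1, hWy]
    omega
  simp only [e5, harr1, hWx]
  have hval : (((s₁.setReg 11 x.val).setReg 12 ((s₁.setReg 11 x.val).reg 5 +
      (s₁.setReg 11 x.val).reg 1)).arr 1 (((s₁.setReg 11 x.val).setReg 12
        ((s₁.setReg 11 x.val).reg 5 + (s₁.setReg 11 x.val).reg 1)).reg 12)) = y.val := by
    simp [e5, hr1.reg_one, harr1, hWy]
  rw [hval]
  set s₂ := ((s₁.setReg 11 x.val).setReg 12 ((s₁.setReg 11 x.val).reg 5 +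
    (s₁.setReg 11 x.val).reg 1)).setReg 12 y.val with hs₂
  have hf2 : Frame 11 s₁ s₂ :=
    (((Frame.refl _ _).setReg le_rfl).setReg (by omega)).setReg (by omega)
  have e11 : s₂.reg 11 = x.val := by simp [hs₂]
  have e12 : s₂.reg 12 = y.val := by simp [hs₂]
  have hr2 := hr1.frame hf2 (by omega)
  have harr2 : s₂.arr 1 = s.arr 1 := (congrFun hf2.1 1).trans harr1
  refine (comp_feasProg hB hr2 (ri := 5) (rv := 12) (i := i) (z := y.val) (by omega) (by omega)
    ((hf2.2 5 (by omega)).trans e5) e12 hin.le y.2).seq (T₂ := 15) ?_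
  rintro s₃ ⟨hf3, -, hfeas⟩
  refine (comp_compareProg hB (a := x.val) (b := y.val) (h := h.val) (g := g.val)
    ((hf3.2 11 (by omega)).trans e11) ((hf3.2 12 (by omega)).trans e12)
    (((hf3.2 9 (by omega)).trans (hf2.2 9 (by omega))).trans e9)
    (((hf3.2 10 (by omega)).trans (hf2.2 10 (by omega))).trans e10) x.2 y.2 h.2 g.2).mono le_rfl ?_
  rintro s₄ ⟨hf4, c18, c14, c15⟩
  have hy : y ∈ w.drop i := by simp [hxy]
  rw [harr2, feasibleFrom_iff hw hy, hxy] at hfeas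
  rw [hxy] at hh hg hfx
  have hfirst : ∀ z, IsFirst (Between G) (x :: y :: r) z ↔ z.val = h.val := fun z =>
    ⟨fun hz => congrArg Fin.val (hz.unique hh), fun hz => Fin.ext hz ▸ hh⟩
  have hlast : ∀ z, IsLast (Between G) (x :: y :: r) z ↔ z.val = g.val := fun z =>
    ⟨fun hz => congrArg Fin.val (hz.unique hg), fun hz => Fin.ext hz ▸ hg⟩
  refine ⟨((hf1.trans hf2 (by omega)).trans hf3 (by omega)).trans hf4 (by omega), ?_, ?_, ?_⟩
  · rw [hf4.2 13 (by omega), hfeas, c18, Linkable, hfirst, hfirst]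
    simp only [hfx, true_and]
  · rw [c14, hfirst, hlast]
  · rw [c15, hfirst, hlast]

end Inspect

/-! ### The program for a move -/

section MoveProgram

variable {n : ℕ} {G : SimpleGraph (Fin n)} {B : ℕ} {s s' : State} {w : List (Fin n)} {e : Bool}

/-- Go on to the position two letters further to the left, if the word from the current position
on is semicanonical and the copy is `false`. Register `8` tells whether the word without its first
two letters is canonical, and is updated. -/
def continueProg : Prog :=
  .branch 3 1 (.branch 2 8 (.seq (.const 16 2) <| .branch 5 16 .skip <|
    .branch 14 1 (.seq (.const 7 1) (.sub 5 5 16)) <|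
    .branch 15 1 (.seq (.const 7 1) (.seq (.const 8 0) (.sub 5 5 16))) .skip) .skip) .skip

/-- Look for the outermost link of the right parity, starting from position `i` in register `5`
close to the end of the word. The position found goes to register `6`. -/
def scanProg : Prog :=
  .loop 2 7 <| .seq (.const 7 0) <| .seq inspectProg <|
    .branch 2 13 (.branch 18 1 (.seq (.add 6 5 2) continueProg) .skip) .skip

/-- The encoding of the copy by a number. -/
def copyCode (e : Bool) : ℕ := if e then 1 else 0

theorem comp_continueProg (hB : LargeBound B n) (hs : Ready G s) (he : s.reg 3 = copyCode e)
    (h7 : s.reg 7 = 0) {c₁ c₂ c₃ : Prop} (h8 : 0 < s.reg 8 ↔ c₁) (h8' : s.reg 8 ≤ 1)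
    (h14 : s.reg 14 < 1 ↔ c₂) (h15 : s.reg 15 < 1 ↔ c₃) {i : ℕ} (hi : s.reg 5 = i)
    (hin : i < n) :
    Comp B continueProg s 9 fun s' => Frame 5 s s' ∧ s'.reg 6 = s.reg 6 ∧
      ((s'.reg 7 = 1 ∧ s'.reg 8 ≤ 1 ∧ e = false ∧ 2 ≤ i ∧ s'.reg 5 = i - 2 ∧ c₁ ∧ (c₂ ∨ c₃) ∧
          (0 < s'.reg 8 ↔ c₂)) ∨
        (s'.reg 7 = 0 ∧ ¬ (e = false ∧ 2 ≤ i ∧ c₁ ∧ (c₂ ∨ c₃)))) := by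
  have hl := hB.lin
  have hr1 := hs.reg_one
  have hr2 := hs.reg_two
  refine Comp.branch (T := 8) (fun h => ?_) fun h => ?_
  · have hef : e = false := by
      cases e
      · rfl
      · rw [he, hr1] at h
        simp [copyCode] at h
    refine Comp.branch (T := 7) (fun h => ?_) fun h => ?_
    · rw [hr2, h8] at h
      refine Comp.const_seq (by omega) (T := 6) ?_
      have hf1 : Frame 5 s (s.setReg 16 2) := (Frame.refl _ _).setReg (by omega)
      refine Comp.branch (T := 5) (fun h => ?_) fun h => ?_
      · simp [hi] at h
        exact Comp.skip ⟨hf1, by simp, .inr ⟨by simpa using h7, fun hc => by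
          have := hc.2.1
          omega⟩⟩
      · simp [hi] at h
        refine Comp.branch (T := 4) (fun h => ?_) fun h => ?_
        · simp [hr1] at h
          have hc₂ := h14.1 (by omega)
          refine Comp.const_seq (by omega) (T := 3) <| Comp.sub ?_ ?_
          · simp [hi]
            omega
          refine ⟨(hf1.setReg (by omega)).setReg (by omega), ?_⟩
          · simp [hi, hc₂, hef, h8', h8]
            exact ⟨by omega, by assumption⟩
        · simp [hr1] at h
          have hc₂ : ¬ c₂ := fun hc => by
            have := h14.2 hc
            omega
          refine Comp.branch (T := 3) (fun h => ?_) fun h => ?_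
          · simp [hr1] at h
            have hc₃ := h15.1 (by omega)
            refine Comp.const_seq (by omega) (T := 2) <| Comp.const_seq (by omega) (T := 1) <|
              Comp.sub ?_ ⟨((hf1.setReg (by omega)).setReg (by omega)).setReg (by omega), ?_⟩
            · simp [hi]
              omega
            · simp [hi, hc₂, hc₃, hef]
              exact ⟨by omega, by assumption⟩
          · simp [hr1] at h
            have hc₃ : ¬ c₃ := fun hc => by
              have := h15.2 hc
              omega
            exact Comp.skip ⟨hf1, by simp, .inr ⟨by simpa using h7, by tauto⟩⟩
    · rw [hr2, h8] at h
      exact Comp.skip ⟨Frame.refl _ _, rfl, .inr ⟨h7, fun hc => h hc.2.2.1⟩⟩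
  · refine Comp.skip ⟨Frame.refl _ _, rfl, .inr ⟨h7, fun hc => h ?_⟩⟩
    rw [he, hr1, hc.1]
    simp [copyCode]

/-- The result of the scan that starts `d` letters before the end: the position of the outermost
link of the right parity, or `n` if there is none. -/
def ScanResult (G : SimpleGraph (Fin n)) (e : Bool) (w : List (Fin n)) (d p : ℕ) : Prop :=
  (p = n ∧ (n < d ∨ ¬ LinkAt (Between G) e w (n - d))) ∨
  ((Even (n + d) ↔ Even p) ∧ LinkAt (Between G) e w p ∧
    (p < 2 ∨ ¬ LinkAt (Between G) e w (p - 2)))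

/-- The state of the scan before round `k`: it goes on at position `n - d - 2 * k`, where the rest
of the word is known to be special, or it has found its result. -/
def ScanInvariant (G : SimpleGraph (Fin n)) (e : Bool) (w : List (Fin n)) (d k : ℕ)
    (s : State) : Prop :=
  s.reg 7 ≤ 1 ∧ (s.reg 7 = 0 → ScanResult G e w d (s.reg 6)) ∧
  (0 < s.reg 7 → d + 2 * k ≤ n ∧ s.reg 5 = n - d - 2 * k ∧ s.reg 8 ≤ 1 ∧
    IsSpecial (Between G) (w.drop (s.reg 5 + 2)) e ∧
    (0 < s.reg 8 ↔ Canonical (Between G) (w.drop (s.reg 5 + 2))) ∧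
    ((k = 0 ∧ s.reg 6 = n) ∨
      (s.reg 6 = s.reg 5 + 2 ∧ LinkAt (Between G) e w (s.reg 6))))

open Classical in
/-- The time for inspecting position `i` during a scan. Past the start, the position is reached
only if the word from position `i + 4` on is canonical. -/
noncomputable def scanCost (G : SimpleGraph (Fin n)) (w : List (Fin n)) (i : ℕ) : ℕ :=
  if Canonical (Between G) (w.drop (i + 4)) then 120 * (n - i + 1) ^ 3 else 0

theorem canonical_drop_of_isSpecial {bt : Fin n → Fin n → Fin n → Prop} {r : List (Fin n)}
    (h : IsSpecial bt r e) : Canonical bt (r.drop 2) := by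
  rcases r with _ | ⟨x, _ | ⟨y, r⟩⟩
  · exact trivial
  · exact trivial
  · exact (h.resolve_left (by simp)).2.1

theorem comp_scanBody (hB : LargeBound B n) (hs : Ready G s) (hw : Holds w (s.arr 1))
    (hwf : FeasibleWord (Between G) w) (he : s.reg 3 = copyCode e) {d k : ℕ} (hd : 2 ≤ d)
    (hI : ScanInvariant G e w d k s) (hgo : 0 < s.reg 7) :
    Comp B (.seq (.const 7 0) <| .seq inspectProg <|
      .branch 2 13 (.branch 18 1 (.seq (.add 6 5 2) continueProg) .skip) .skip) s
      (100 * (n - s.reg 5 + 1) ^ 3 + 13)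
      fun s' => Frame 5 s s' ∧ ScanInvariant G e w d (k + 1) s' := by
  have hl := hB.lin
  obtain ⟨-, -, hI⟩ := hI
  obtain ⟨hdk, h5, h8', hsp, h8, h6⟩ := hI hgo
  set i := s.reg 5 with hi
  have hlen := hw.length_eq
  obtain ⟨x, y, r, hxy⟩ : ∃ x y r, w.drop i = x :: y :: r := by
    have : (w.drop i).length = n - i := by rw [List.length_drop, hlen]
    rcases h : w.drop i with _ | ⟨x, _ | ⟨y, r⟩⟩
    · rw [h] at this
      simp at this
      omega
    · rw [h] at this
      simp at this
      omega
    · exact ⟨x, y, r, rfl⟩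
  have hr : w.drop (i + 2) = r := by
    rw [← List.drop_drop, hxy]
    rfl
  rw [hr] at hsp h8
  have hlinkAt : LinkAt (Between G) e w i ↔ Linkable (Between G) x y r := by
    constructor
    · rintro ⟨x', y', r', h1, h2, -⟩
      rw [hxy] at h1
      simp only [List.cons.injEq] at h1
      obtain ⟨rfl, rfl, rfl⟩ := h1
      exact h2
    · exact fun h => ⟨x, y, r, hxy, h, hsp⟩
  have hparity : Even (n + d) ↔ Even i := by
    rw [h5, Nat.even_sub (by omega), Nat.even_sub (by omega), Nat.even_add]
    simp
  have hf1 : Frame 5 s (s.setReg 7 0) := (Frame.refl _ _).setReg (by omega)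
  have hr1 := hs.frame hf1 (by omega)
  refine Comp.const_seq (by omega) (T := 100 * (n - i + 1) ^ 3 + 12) ?_
  refine (comp_inspectProg hB hr1 (w := w) (by simpa using hw) hwf (i := i) (by simp [hi])
    hxy).seq (T₂ := 12) ?_
  rintro s₁ ⟨hf2, hlink, hc14, hc15⟩
  have hf3 : Frame 5 s s₁ := hf1.trans hf2 (by omega)
  have hr2 := hs.frame hf3 (by omega)
  have e5 : s₁.reg 5 = i := by rw [hf2.2 5 (by omega)]; simp [hi]
  have e6 : s₁.reg 6 = s.reg 6 := by rw [hf2.2 6 (by omega)]; simp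
  have e7 : s₁.reg 7 = 0 := by rw [hf2.2 7 (by omega)]; simp
  have e8 : s₁.reg 8 = s.reg 8 := by rw [hf2.2 8 (by omega)]; simp
  rw [← hlinkAt] at hlink
  have hhalt : ¬ LinkAt (Between G) e w i → ScanInvariant G e w d (k + 1) s₁ := by
    intro hno
    refine ⟨by omega, fun _ => ?_, fun h => by omega⟩
    rw [e6]
    rcases h6 with ⟨rfl, h6⟩ | ⟨h6, h6'⟩
    · left
      refine ⟨h6, .inr ?_⟩
      rwa [h5] at hno
    · right
      rw [h6] at h6' ⊢
      refine ⟨by rw [hparity]; simp [Nat.even_add], h6', .inr ?_⟩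
      simpa using hno
  refine Comp.branch (T := 11) (fun h => ?_) fun h => ?_
  · refine Comp.branch (T := 10) (fun h' => ?_) fun h' => ?_
    · rw [hr2.reg_two] at h
      rw [hr2.reg_one] at h'
      have hlk := hlink.1 ⟨h, h'⟩
      refine Comp.add_seq (by rw [e5, hr2.reg_two]; omega) (T := 9) ?_
      have hf4 : Frame 5 s₁ (s₁.setReg 6 (s₁.reg 5 + s₁.reg 2)) :=
        (Frame.refl _ _).setReg (by omega)
      refine (comp_continueProg (e := e) hB (hr2.frame hf4 (by omega)) (i := i) ?_ (by simp [e7])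
        (c₁ := Canonical (Between G) r) (by simpa [e8] using h8) (by simpa [e8] using h8')
        (by simpa using hc14) (by simpa using hc15) (by simp [e5]) (by omega)).mono le_rfl ?_
      · simpa [hf3.2 3 (by omega)] using he
      rintro s₂ ⟨hf5, f6, hcases⟩
      refine ⟨(hf3.trans hf4 le_rfl).trans hf5 le_rfl, ?_⟩
      have g6 : s₂.reg 6 = i := by rw [f6]; simp [e5, hr2.reg_two]
      rcases hcases with ⟨g7, g8, hef, hi2, g5, hc₁, hc, g8'⟩ | ⟨g7, hno⟩
      · refine ⟨by omega, fun h => by omega, fun _ => ⟨by omega, by omega, g8, ?_, ?_, .inr ?_⟩⟩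
        · rw [g5, show i - 2 + 2 = i by omega, hxy]
          exact .inr ⟨hef, hc₁, hc⟩
        · rw [g5, show i - 2 + 2 = i by omega, hxy, g8']
          exact ⟨fun h => ⟨h.1, h.2, hc₁⟩, fun h => ⟨h.1, h.2.1⟩⟩
        · rw [g6, g5]
          exact ⟨by omega, hlk⟩
      · refine ⟨by omega, fun _ => .inr ?_, fun h => by omega⟩
        rw [g6]
        refine ⟨hparity, hlk, ?_⟩
        by_contra hcon
        push Not at hcon
        obtain ⟨hi2, x', y', r', h1, -, h3⟩ := hcon
        have hr' : r' = x :: y :: r := by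
          have h4 : w.drop (i - 2 + 2) = r' := by
            rw [← List.drop_drop, h1]
            rfl
          rw [← h4, show i - 2 + 2 = i by omega, hxy]
        rw [hr'] at h3
        obtain ⟨hef, hc₁, hc⟩ := h3.resolve_left (by simp)
        exact hno ⟨hef, hi2, hc₁, hc⟩
    · rw [hr2.reg_one] at h'
      exact Comp.skip ⟨hf3, hhalt fun hlk => h' (hlink.2 hlk).2⟩
  · rw [hr2.reg_two] at h
    exact Comp.skip ⟨hf3, hhalt fun hlk => h (hlink.2 hlk).1⟩

theorem comp_scanProg (hB : LargeBound B n) (hs : Ready G s) (hw : Holds w (s.arr 1))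
    (hwf : FeasibleWord (Between G) w) (he : s.reg 3 = copyCode e) {d : ℕ} (hd : 2 ≤ d)
    (hI : ScanInvariant G e w d 0 s) :
    Comp B scanProg s (∑ i ∈ Finset.range (n + 1), scanCost G w i + 1)
      fun s' => Frame 5 s s' ∧ ScanResult G e w d (s'.reg 6) := by
  refine Comp.loop (N := (n - d) / 2 + 1) (C := fun k => scanCost G w (n - d - 2 * k))
    (I := fun k s' => Frame 5 s s' ∧ ScanInvariant G e w d k s') ?_ ⟨Frame.refl _ _, hI⟩ ?_ ?_
  · rintro k s₁ ⟨hf, hI⟩ hgo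
    have hr := hs.frame hf (by omega)
    rw [hr.reg_two] at hgo
    have hcont := hI.2.2 hgo
    have h5 := hcont.2.1
    refine ⟨by omega, _, ?_, (comp_scanBody (e := e) hB hr (w := w) (by rw [hf.1]; exact hw) hwf
      ((hf.2 3 (by omega)).trans he) hd hI hgo).mono le_rfl fun s₂ h => ⟨hf.trans h.1 le_rfl, h.2⟩⟩
    -- The rest of the word is special, so it is canonical from two letters further on; this is what
    -- the amortization relies on.
    have hcan := canonical_drop_of_isSpecial hcont.2.2.2.1
    rw [List.drop_drop] at hcan
    rw [h5] at hcan ⊢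
    rw [scanCost, if_pos (by simpa [add_assoc] using hcan)]
    have hpos : 1 ≤ (n - (n - d - 2 * k) + 1) ^ 3 := Nat.one_le_pow _ _ (by omega)
    omega
  · rintro k s₁ ⟨hf, hI⟩ hgo
    rw [(hs.frame hf (by omega)).reg_two] at hgo
    exact ⟨hf, hI.2.1 (by omega)⟩
  · refine Nat.add_le_add_right ?_ 1
    have hinj : Set.InjOn (fun k => n - d - 2 * k) (Finset.range ((n - d) / 2 + 1)) := by
      intro a ha b hb hab
      simp only [Finset.coe_range, Set.mem_Iio] at ha hb
      simp only at hab
      omega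
    rw [← Finset.sum_image (f := scanCost G w) hinj]
    refine Finset.sum_le_sum_of_subset fun i hi => ?_
    obtain ⟨k, -, rfl⟩ := Finset.mem_image.1 hi
    exact Finset.mem_range.2 (by omega)

/-- Perform the move on the positions with the parity of `n + d`. -/
def moveProg (d : ℕ) : Prog :=
  .seq (.add 6 0 2) <| .seq (.const 8 1) <| .seq (.const 9 d) <|
  .seq (.branch 0 9 (.const 7 0) (.seq (.const 7 1) (.sub 5 0 9))) <|
  .seq scanProg <|
  .branch 6 0
    (.seq (.add 9 6 1) <| .seq (.load 10 1 6) <| .seq (.load 11 1 9) <|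
      .seq (.store 1 6 11) (.store 1 9 10))
    (.sub 3 1 3)

/-- The state represents the vertex `p` of the prism. -/
structure Represents (G : SimpleGraph (Fin n)) (p : List (Fin n) × Bool) (s : State) : Prop where
  ready : Ready G s
  holds : Holds p.1 (s.arr 1)
  copy : s.reg 3 = copyCode p.2

theorem Holds.swap {W : ℕ → ℕ} {w' : List (Fin n)} {i : ℕ} (h : Holds w W)
    (hs : SwappedAt i w w') :
    i + 1 < n ∧ Holds w' fun j => if j = i + 1 then W i else if j = i then W (i + 1) else W j := by
  obtain ⟨p, x, y, r, hp, rfl, rfl⟩ := hs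
  have hlen := h.length_eq
  simp only [List.length_append, List.length_cons] at hlen
  refine ⟨by omega, ?_⟩
  have h1 := h.getElem (a := i) (by simp; omega)
  have h2 := h.getElem (a := i + 1) (by simp; omega)
  unfold Holds at *
  refine List.ext_getElem (by simp; omega) fun j hj hj' => ?_
  have hj2 : j < n := by simpa using hj
  have h3 : W j = ((p ++ x :: y :: r)[j]'(by simp; omega)).val := Holds.getElem h _
  rw [List.getElem_map, List.getElem_map, List.getElem_range]
  split_ifs with c1 c2
  · subst c1
    subst hp
    rw [h1]
    simp
  · subst c2
    subst hp
    rw [h2]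
    simp
  · rw [h3]
    subst hp
    rcases Nat.lt_or_ge j p.length with hlt | hge
    · rw [List.getElem_append_left hlt, List.getElem_append_left hlt]
    · rw [List.getElem_append_right hge, List.getElem_append_right hge]
      obtain ⟨m, rfl⟩ : ∃ m, j = p.length + (m + 2) := ⟨j - p.length - 2, by omega⟩
      simp

theorem Ready.of_arr {s₁ : State} (h : Ready G s) (h0 : ∀ r < 3, s₁.reg r = s.reg r)
    (h3 : s₁.arr 3 = s.arr 3) (h1 : ∀ a < n, s₁.arr 1 a < n) : Ready G s₁ where
  reg_zero := (h0 0 (by omega)).trans h.reg_zero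
  reg_one := (h0 1 (by omega)).trans h.reg_one
  reg_two := (h0 2 (by omega)).trans h.reg_two
  le_one := h3 ▸ h.le_one
  table := h3 ▸ h.table
  word_lt := h1

theorem comp_moveProg (hB : LargeBound B n) {p : List (Fin n) × Bool} (hs : Represents G p s)
    (hwf : FeasibleWord (Between G) p.1) {d : ℕ} (hd : d = 2 ∨ d = 3) :
    Comp B (moveProg d) s (∑ i ∈ Finset.range (n + 1), scanCost G p.1 i + 20) fun s' =>
      Represents G (parityMove (Between G) (n + d) p) s' ∧ s'.arr 2 = s.arr 2 ∧
        s'.reg 4 = s.reg 4 := by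
  obtain ⟨w, e⟩ := p
  have hl := hB.lin
  have hr := hs.ready
  have hlen := hs.holds.length_eq
  simp only at hlen hwf
  set K := ∑ i ∈ Finset.range (n + 1), scanCost G w i with hK
  refine Comp.mono (T := ((3 + ((K + 1) + 8)) + 1) + 1 + 1) ?_ (by omega) fun _ h => h
  refine Comp.add_seq (by rw [hr.reg_zero, hr.reg_two]; omega) <| Comp.const_seq (by omega) <|
    Comp.const_seq (by omega) ?_
  set s₁ := ((s.setReg 6 (s.reg 0 + s.reg 2)).setReg 8 1).setReg 9 d with hs₁
  have hf1 : Frame 5 s s₁ :=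
    (((Frame.refl _ _).setReg (by omega)).setReg (by omega)).setReg (by omega)
  have e6 : s₁.reg 6 = n := by simp [hs₁, hr.reg_zero, hr.reg_two]
  have e8 : s₁.reg 8 = 1 := by simp [hs₁]
  have e9 : s₁.reg 9 = d := by simp [hs₁]
  have hr1 := hr.frame hf1 (by omega)
  refine Comp.seq (T₁ := 3) (T₂ := (K + 1) + 8) (Q₁ := fun s' => Frame 5 s s' ∧
    ScanInvariant G e w d 0 s') ?_ ?_
  · refine Comp.branch (T := 2) (fun h => ?_) fun h => ?_
    · rw [hr1.reg_zero, e9] at h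
      refine Comp.const (by omega) ⟨hf1.setReg (by omega), ?_⟩
      refine ⟨by simp, fun _ => .inl ⟨by simp [e6], .inl h⟩, fun h => by simp at h⟩
    · rw [hr1.reg_zero, e9] at h
      refine Comp.const_seq (by omega) (T := 1) <| Comp.sub (by simp [hr1.reg_zero, e9]; omega)
        ⟨(hf1.setReg (by omega)).setReg (by omega), ?_⟩
      -- As `d ≤ 3`, at most one letter follows, so the rest of the word needs no check.
      have hshort : (w.drop (n - d + 2)).length ≤ 1 := by
        rw [List.length_drop]
        omega
      have hcan : Canonical (Between G) (w.drop (n - d + 2)) := by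
        rcases h : w.drop (n - d + 2) with _ | ⟨x, _ | ⟨y, r⟩⟩
        · exact trivial
        · exact trivial
        · rw [h] at hshort
          simp at hshort
      refine ⟨by simp, fun h => by simp at h, fun _ => ?_⟩
      simp [e6, e8, e9, hr1.reg_zero, hcan, IsSpecial]
      omega
  rintro s₂ ⟨hf2, hI⟩
  refine (comp_scanProg (e := e) hB (hr.frame hf2 (by omega)) (w := w)
    (by rw [hf2.1]; exact hs.holds) hwf ((hf2.2 3 (by omega)).trans hs.copy) (by omega) hI).seq
    (T₂ := 8) ?_
  rintro s₃ ⟨hf3, hres⟩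
  have hf4 := hf2.trans hf3 le_rfl
  have hr4 := hr.frame hf4 (by omega)
  have e3 : s₃.reg 3 = copyCode e := (hf4.2 3 (by omega)).trans hs.copy
  have e4 : s₃.reg 4 = s.reg 4 := hf4.2 4 (by omega)
  have harr : s₃.arr = s.arr := hf4.1
  refine Comp.branch (T := 5) (fun h => ?_) fun h => ?_
  · rw [hr4.reg_zero] at h
    obtain ⟨hpar, hlk, hprev⟩ := hres.resolve_left fun hc => by omega
    obtain ⟨w', hsw, hmove⟩ := parityMove_of_linkAt hpar hlk hprev
    set i := s₃.reg 6 with hi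
    obtain ⟨hin, hholds⟩ := hs.holds.swap hsw
    have hWi := hr.word_lt i h
    have hWi' := hr.word_lt (i + 1) hin
    refine Comp.add_seq ?_ (T := 4) <| Comp.load_seq ?_ (T := 3) <| Comp.load_seq ?_ (T := 2) <|
      Comp.store_seq ?_ (T := 1) <| Comp.store ?_ ?_
    · rw [hr4.reg_one]
      omega
    · simp [harr, ← hi]
      omega
    · simp [harr, ← hi, hr4.reg_one]
      omega
    · simp [harr, ← hi, hr4.reg_one]
      omega
    · simp [harr, ← hi]
      omega
    rw [hmove]
    simp only [State.setReg_reg, State.setArr_reg, State.setReg_arr]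
    simp only [← hi, hr4.reg_one, harr]
    refine ⟨⟨hr.of_arr ?_ ?_ ?_, ?_, ?_⟩, ?_, ?_⟩
    · intro r h3
      have := hf4.2 r (by omega)
      simpa [show r ≠ 9 by omega, show r ≠ 10 by omega, show r ≠ 11 by omega] using this
    · ext j
      simp [harr]
    · intro a ha
      simp [harr]
      split_ifs
      exacts [hWi, hWi', hr.word_lt a ha]
    · refine (congrArg (Holds w') ?_).mp hholds
      ext j
      simp [harr]
    · simp [e3]
    · ext j
      simp [harr]
    · simp [e4]
  · rw [hr4.reg_zero] at h
    obtain ⟨-, hno⟩ := hres.resolve_right fun hc => by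
      have := hc.2.1.lt
      omega
    have hmove : parityMove (Between G) (n + d) (w, e) = (w, !e) := by
      have := parityMove_of_not_linkAt (bt := Between G) (s := e) (w := w) hd (by rwa [hlen])
      rwa [hlen] at this
    rw [hmove]
    refine Comp.sub ?_ ⟨⟨hr.of_arr ?_ ?_ ?_, ?_, ?_⟩, ?_, ?_⟩
    · rw [hr4.reg_one]
      omega
    · intro r h3
      have := hf4.2 r (by omega)
      simpa [show r ≠ 3 by omega] using this
    · simp [harr]
    · simpa [harr] using hr.word_lt
    · simpa [harr] using hs.holds
    · rw [hr4.reg_one, e3]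
      cases e <;> simp [copyCode]
    · simp [harr]
    · simp [e4]

end MoveProgram

/-! ### The test for the end of the cycle -/

section EndOfCycle

variable {n : ℕ} {G : SimpleGraph (Fin n)} {B : ℕ} {s s' : State} {w w₀ : List (Fin n)} {e : Bool}

/-- Compare the output array with array `2`, from the end; register `4` becomes `1` if they
differ. -/
def differProg : Prog :=
  .loop 2 7 <|
    .branch 2 5
      (.seq (.sub 5 5 1) <| .seq (.load 9 1 5) <| .seq (.load 10 2 5) <|
        .branch 9 10 (.seq (.const 4 1) (.const 7 0)) <|
        .branch 10 9 (.seq (.const 4 1) (.const 7 0)) .skip)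
      (.const 7 0)

/-- Test whether the vertex of the prism differs from the vertex where the cycle started, whose
word is kept in array `2` and which lies in the copy `false`; the answer goes to register `4`. -/
def endProg : Prog :=
  .seq (.const 4 0) <|
  .branch 3 1 (.seq (.add 5 0 2) <| .seq (.const 7 1) differProg) (.const 4 1)

/-- The time for comparing the entries in front of position `i`, which happens only if the words
agree from there on. -/
def compareCost (w₀ w : List (Fin n)) (i : ℕ) : ℕ :=
  if w.drop i = w₀.drop i then 10 else 0

theorem drop_eq_drop_iff {a b : List (Fin n)} {i : ℕ} (ha : i < a.length) (hb : i < b.length) :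
    a.drop i = b.drop i ↔ (a[i]).val = (b[i]).val ∧ a.drop (i + 1) = b.drop (i + 1) := by
  rw [List.drop_eq_getElem_cons ha, List.drop_eq_getElem_cons hb, List.cons.injEq, Fin.ext_iff]

theorem comp_differProg (hB : LargeBound B n) (hs : Ready G s) (hw : Holds w (s.arr 1))
    (hw₀ : Holds w₀ (s.arr 2)) (h4 : s.reg 4 = 0) (h5 : s.reg 5 = n) (h7 : s.reg 7 = 1) :
    Comp B differProg s (∑ i ∈ Finset.range (n + 1), compareCost w₀ w i + 1) fun s' =>
      Frame 4 s s' ∧ (0 < s'.reg 4 ↔ w ≠ w₀) := by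
  have hl := hB.lin
  have hlen := hw.length_eq
  have hlen₀ := hw₀.length_eq
  refine Comp.loop (N := n + 1) (C := fun k => compareCost w₀ w (n - k))
    (I := fun k s' => Frame 4 s s' ∧ (s'.reg 7 = 0 → (0 < s'.reg 4 ↔ w ≠ w₀)) ∧
      (0 < s'.reg 7 → s'.reg 4 = 0 ∧ k ≤ n ∧ s'.reg 5 = n - k ∧
        w.drop (n - k) = w₀.drop (n - k))) ?_ ?_ ?_ ?_
  · rintro k s₁ ⟨hf, -, hI⟩ hgo
    have hr := hs.frame hf (by omega)
    rw [hr.reg_two] at hgo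
    obtain ⟨g4, hk, g5, heq⟩ := hI hgo
    have hone := hr.reg_one
    have htwo := hr.reg_two
    refine ⟨by omega, 9, by simp [compareCost, heq], ?_⟩
    refine Comp.branch (T := 8) (fun h => ?_) fun h => ?_
    · rw [htwo, g5] at h
      set i := n - (k + 1) with hi
      have hsucc : n - k = i + 1 := by omega
      have hin : i < n := by omega
      have e1 : s₁.arr 1 i = (w[i]).val := by rw [hf.1]; exact hw.getElem _
      have e2 : s₁.arr 2 i = (w₀[i]).val := by rw [hf.1]; exact hw₀.getElem _
      have hiff := drop_eq_drop_iff (a := w) (b := w₀) (i := i) (by omega) (by omega)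
      rw [hsucc] at heq
      have hv1 := (w[i]).2
      have hv2 := (w₀[i]).2
      have g5' : s₁.reg 5 - s₁.reg 1 = i := by omega
      have hne : (w[i]).val ≠ (w₀[i]).val → w ≠ w₀ := by
        rintro h rfl
        exact h rfl
      refine Comp.sub_seq (by omega) (T := 7) <| Comp.load_seq (T := 6) ?_ <|
        Comp.load_seq (T := 5) ?_ ?_
      · simp only [State.setReg_reg, State.setReg_arr, g5', if_true, e1]
        omega
      · simp only [State.setReg_reg, State.setReg_arr, g5', if_true]
        norm_num
        rw [e2]
        omega
      have hhalt : ∀ s₂ : State, Frame 4 s s₂ → (w[i]).val ≠ (w₀[i]).val →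
          Comp B (.seq (.const 4 1) (.const 7 0)) s₂ 2 fun s' => Frame 4 s s' ∧
            (s'.reg 7 = 0 → (0 < s'.reg 4 ↔ w ≠ w₀)) ∧
            (0 < s'.reg 7 → s'.reg 4 = 0 ∧ k + 1 ≤ n ∧ s'.reg 5 = i ∧
              w.drop i = w₀.drop i) := by
        intro s₂ hf₂ h
        refine Comp.const_seq (by omega) (T := 1) <| Comp.const (by omega)
          ⟨(hf₂.setReg (by omega)).setReg (by omega), ?_, ?_⟩
        · simpa using hne h
        · simp
      rw [g5']
      simp only [State.setReg_reg, State.setReg_arr]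
      norm_num
      rw [e1, e2]
      have hf₂ : Frame 4 s (((s₁.setReg 5 i).setReg 9 (w[i]).val).setReg 10 (w₀[i]).val) :=
        ((hf.setReg (by omega)).setReg (by omega)).setReg (by omega)
      refine Comp.branch (T := 4) (fun h' => ?_) fun h' => ?_
      · exact (hhalt _ hf₂ (by simp at h'; omega)).mono (by omega) fun _ h => h
      refine Comp.branch (T := 3) (fun h'' => ?_) fun h'' => ?_
      · exact (hhalt _ hf₂ (by simp at h''; omega)).mono (by omega) fun _ h => h
      refine Comp.skip ⟨hf₂, fun h => ?_, fun _ => ⟨by simpa using g4, by omega, by simp, ?_⟩⟩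
      · simp at h
        omega
      · refine hiff.2 ⟨?_, heq⟩
        simp at h' h''
        omega
    · rw [htwo, g5] at h
      refine Comp.const (by omega) ⟨hf.setReg (by omega), fun _ => ?_, fun h => by simp at h⟩
      obtain h0 : n - k = 0 := by omega
      rw [h0] at heq
      simpa [g4] using heq
  · refine ⟨Frame.refl _ _, by omega, fun _ => ⟨h4, by omega, by omega, ?_⟩⟩
    rw [List.drop_eq_nil_of_le (by omega), List.drop_eq_nil_of_le (by omega)]
  · rintro k s₁ ⟨hf, hI, -⟩ hgo
    rw [(hs.frame hf (by omega)).reg_two] at hgo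
    exact ⟨hf, hI (by omega)⟩
  · refine Nat.add_le_add_right (le_of_eq ?_) 1
    have := Finset.sum_range_reflect (compareCost w₀ w) (n + 1)
    simpa only [Nat.add_sub_cancel] using this

theorem comp_endProg (hB : LargeBound B n) {p : List (Fin n) × Bool} (hs : Represents G p s)
    (hw₀ : Holds w₀ (s.arr 2)) :
    Comp B endProg s (∑ i ∈ Finset.range (n + 1), compareCost w₀ p.1 i + 5) fun s' =>
      Represents G p s' ∧ s'.arr = s.arr ∧ (0 < s'.reg 4 ↔ p ≠ (w₀, false)) := by
  obtain ⟨w, e⟩ := p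
  have hl := hB.lin
  have hr := hs.ready
  set K := ∑ i ∈ Finset.range (n + 1), compareCost w₀ w i with hK
  have hrep : ∀ s', Frame 4 s s' → Represents G (w, e) s' := fun s' hf =>
    ⟨hr.frame hf (by omega), by rw [hf.1]; exact hs.holds, (hf.2 3 (by omega)).trans hs.copy⟩
  refine Comp.const_seq (by omega) (T := K + 4) ?_
  have hf : Frame 4 s (s.setReg 4 0) := (Frame.refl _ _).setReg le_rfl
  have hcopy := hs.copy
  refine Comp.branch (T := K + 3) (fun h => ?_) fun h => ?_
  · have hef : e = false := by
      cases e
      · rfl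
      · simp [hcopy, hr.reg_one, copyCode] at h
    refine Comp.add_seq ?_ (T := K + 2) <| Comp.const_seq (by omega) (T := K + 1) ?_
    · simp [hr.reg_zero, hr.reg_two]
      omega
    have hf' := (hf.setReg (x := 5) (v := n) (by omega)).setReg (x := 7) (v := 1) (by omega)
    simp only [State.setReg_reg, hr.reg_zero, hr.reg_two]
    refine (comp_differProg (w := w) (w₀ := w₀) hB (hr.frame hf' (by omega)) hs.holds hw₀
      (by simp) (by simp) (by simp)).mono le_rfl fun s' h => ?_
    have hf'' := hf'.trans h.1 le_rfl
    refine ⟨hrep s' hf'', hf''.1, ?_⟩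
    rw [h.2, hef]
    simp
  · refine Comp.const (by omega) ⟨hrep _ (hf.setReg le_rfl), rfl, ?_⟩
    cases e
    · simp [hcopy, hr.reg_one, copyCode] at h
    · simp

end EndOfCycle

/-! ### The loop over the cycle and its amortized time -/

section Cycle

variable {n : ℕ} {G : SimpleGraph (Fin n)} {B : ℕ} {s : State} {w₀ : List (Fin n)}

/-- Report every second vertex of the cycle through the prism. -/
def cycleProg : Prog :=
  .loop 2 4 <| .seq .visit <| .seq (moveProg 2) <| .seq (moveProg 3) endProg

/-- The time for finding the outermost link of a word. -/
noncomputable def moveCost (G : SimpleGraph (Fin n)) (w : List (Fin n)) : ℕ :=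
  ∑ i ∈ Finset.range (n + 1), scanCost G w i

/-- The time for comparing a word with the start of the cycle. -/
def endCost (w₀ w : List (Fin n)) : ℕ :=
  ∑ i ∈ Finset.range (n + 1), compareCost w₀ w i

/-- One round of the loop: report the current word, make the two moves, and test for the end. -/
theorem exec_round (hB : LargeBound B n) {p : List (Fin n) × Bool}
    (hp : p ∈ prismVertices (Between G) (List.finRange n)) (hs : Represents G p s)
    (hw₀ : Holds w₀ (s.arr 2)) :
    ∃ t s', Exec B (.seq .visit <| .seq (moveProg 2) <| .seq (moveProg 3) endProg) s t
        [s.arr 1] s' ∧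
      t ≤ moveCost G p.1 + moveCost G (firstMove (Between G) n p).1 +
        endCost w₀ (secondMove (Between G) n (firstMove (Between G) n p)).1 + 46 ∧
      Represents G (secondMove (Between G) n (firstMove (Between G) n p)) s' ∧
      Holds w₀ (s'.arr 2) ∧
      (0 < s'.reg 4 ↔ secondMove (Between G) n (firstMove (Between G) n p) ≠ (w₀, false)) := by
  have alt := alternatingPair_moves (bt := Between G) (List.nodup_finRange n) n
  have hp' := alt.maps_left _ hp
  have hcomp : Comp B (.seq (moveProg 2) <| .seq (moveProg 3) endProg) s
      (moveCost G p.1 + moveCost G (firstMove (Between G) n p).1 +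
        endCost w₀ (secondMove (Between G) n (firstMove (Between G) n p)).1 + 45)
      fun s' => Represents G (secondMove (Between G) n (firstMove (Between G) n p)) s' ∧
      Holds w₀ (s'.arr 2) ∧
      (0 < s'.reg 4 ↔ secondMove (Between G) n (firstMove (Between G) n p) ≠ (w₀, false)) := by
    rw [secondMove_eq_parityMove]
    refine (comp_moveProg hB hs hp.2 (.inl rfl)).seq
      (T₂ := moveCost G (firstMove (Between G) n p).1 + endCost w₀ (parityMove (Between G) (n + 3)
        (firstMove (Between G) n p)).1 + 25) ?_ (by simp only [moveCost]; omega)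
    rintro s₁ ⟨h1, h2, -⟩
    rw [← firstMove_eq_parityMove] at h1
    refine (comp_moveProg hB h1 hp'.2 (.inr rfl)).seq
      (T₂ := endCost w₀ (parityMove (Between G) (n + 3) (firstMove (Between G) n p)).1 + 5) ?_
      (by simp only [moveCost]; omega)
    rintro s₂ ⟨h3, h4, -⟩
    refine (comp_endProg hB h3 (w₀ := w₀) (by rw [h4, h2]; exact hw₀)).mono le_rfl ?_
    rintro s₃ ⟨h5, h6, h7⟩
    exact ⟨h5, by rw [h6, h4, h2]; exact hw₀, h7⟩
  obtain ⟨t, s', ht, he, h⟩ := hcomp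
  exact ⟨1 + t, s', by simpa using Exec.seq (Exec.visit s) he, by omega, h⟩

/-- The time for going on from the vertex number `2 * i` of the cycle. -/
noncomputable def roundCost (G : SimpleGraph (Fin n)) (w₀ : List (Fin n)) (i : ℕ) : ℕ :=
  moveCost G (evenVertex (Between G) n (w₀, false) i).1 +
    moveCost G (firstMove (Between G) n (evenVertex (Between G) n (w₀, false) i)).1 +
    endCost w₀ (evenVertex (Between G) n (w₀, false) (i + 1)).1 + 47

/-- The last `m` rounds of the loop. -/
theorem exec_cycleProg_aux (hB : LargeBound B n)
    (hp : (w₀, false) ∈ prismVertices (Between G) (List.finRange n)) (m : ℕ) :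
    ∀ (i : ℕ) (s : State), i + m = cyclePeriod (Between G) n (w₀, false) →
      Represents G (evenVertex (Between G) n (w₀, false) i) s → Holds w₀ (s.arr 2) →
      (0 < s.reg 4 ↔ 0 < m) →
      ∃ t trace s', Exec B cycleProg s t trace s' ∧
        t ≤ ∑ j ∈ Finset.range m, roundCost G w₀ (i + j) + 1 ∧
        trace.map (fun f => (List.range n).map f) = (List.range m).map fun j =>
          (evenVertex (Between G) n (w₀, false) (i + j)).1.map Fin.val := by
  induction m with
  | zero =>
    intro i s hi hs hw₀ h4
    refine ⟨1, [], s, Exec.loop_false ?_, by simp, by simp⟩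
    rw [hs.ready.reg_two]
    omega
  | succ m ih =>
    intro i s hi hs hw₀ h4
    have hv := evenVertex_mem (n := n) (List.nodup_finRange n) hp i
    obtain ⟨t, s₁, he, ht, h1, h2, h3⟩ := exec_round hB hv hs hw₀
    rw [← evenVertex_succ] at ht h1 h3
    have hgo : 0 < s₁.reg 4 ↔ 0 < m := by
      rw [h3]
      constructor
      · intro hne
        by_contra hm
        obtain rfl : m = 0 := by omega
        refine hne ?_
        rw [hi]
        exact evenVertex_period
      · exact fun hm => evenVertex_ne (by omega) (by omega)
    obtain ⟨t', trace, s₂, he', ht', htr⟩ := ih (i + 1) s₁ (by omega) h1 h2 hgo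
    refine ⟨t + t' + 1, [s.arr 1] ++ trace, s₂, Exec.loop_true ?_ he he', ?_, ?_⟩
    · rw [hs.ready.reg_two]
      omega
    · rw [Finset.sum_range_succ', add_zero]
      have hsum : ∑ j ∈ Finset.range m, roundCost G w₀ (i + (j + 1)) =
          ∑ j ∈ Finset.range m, roundCost G w₀ (i + 1 + j) :=
        Finset.sum_congr rfl fun j _ => by rw [add_assoc, add_comm 1 j]
      rw [hsum, roundCost]
      omega
    · rw [List.range_succ_eq_map, List.map_cons, List.map_map, List.map_append, htr]
      simp only [List.map_cons, List.map_nil, List.cons_append, List.nil_append, add_zero]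
      congr 1
      · exact hs.holds
      · refine List.map_congr_left fun j _ => ?_
        simp [add_assoc, add_comm 1 j]

theorem exec_cycleProg (hB : LargeBound B n)
    (hp : (w₀, false) ∈ prismVertices (Between G) (List.finRange n))
    (hs : Represents G (w₀, false) s) (hw₀ : Holds w₀ (s.arr 2)) (h4 : 0 < s.reg 4) :
    ∃ t trace s', Exec B cycleProg s t trace s' ∧
      t ≤ ∑ j ∈ Finset.range (cyclePeriod (Between G) n (w₀, false)), roundCost G w₀ j + 1 ∧
      trace.map (fun f => (List.range n).map f) =
        (listing (Between G) n (w₀, false)).map fun w => w.map Fin.val := by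
  have h := exec_cycleProg_aux hB hp _ 0 s (zero_add _) hs hw₀
    ⟨fun _ => cyclePeriod_pos (List.nodup_finRange n) hp, fun _ => h4⟩
  simp only [zero_add] at h
  rw [listing, List.map_map]
  exact h

section Amortization

variable {P : ℕ} {f : ℕ → List (Fin n)}

/-- A sum over distinct words is at most the sum over all words. -/
theorem sum_le_sum_feasibleWords (hf : ∀ i, f i ∈ feasibleWords (Between G) (List.finRange n))
    (hinj : ∀ i < P, ∀ j < P, f i = f j → i = j) (F : List (Fin n) → ℕ) :
    ∑ i ∈ Finset.range P, F (f i) ≤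
      ∑ w ∈ (feasibleWords_finite (bt := Between G) (List.finRange n)).toFinset, F w := by
  classical
  have h : Set.InjOn f (Finset.range P) := fun i hi j hj =>
    hinj i (by simpa using hi) j (by simpa using hj)
  rw [← Finset.sum_image (f := F) h]
  refine Finset.sum_le_sum_of_subset fun w hw => ?_
  obtain ⟨i, -, rfl⟩ := Finset.mem_image.1 hw
  simpa using hf i

/-- Canonical suffixes are determined by their letters, so the search for the links takes constant
amortized time. -/
theorem exists_sum_moveCost_le : ∃ C, ∀ (n : ℕ) (G : SimpleGraph (Fin n)), IsATFree G →
    ∑ w ∈ (feasibleWords_finite (bt := Between G) (List.finRange n)).toFinset, moveCost G w ≤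
      C * (feasibleWords (Between G) (List.finRange n)).ncard := by
  classical
  obtain ⟨C, hC⟩ := exists_geometricBound 120 3
  refine ⟨C * 2 ^ 5, fun n G hG => ?_⟩
  have h := (isConvexBetweenness_between hG).sum_suffix_le (List.nodup_finRange n)
    (Q := Canonical (Between G)) (fun r r' h1 h2 h3 => h1.eq_of_perm h2 h3) hC 4
  rw [List.length_finRange] at h
  refine le_trans (le_of_eq ?_) h
  refine Finset.sum_congr rfl fun w _ => Finset.sum_congr rfl fun i _ => ?_
  rw [scanCost]

/-- A common suffix with a fixed word is determined by its length, so the comparisons with this word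
take constant amortized time. -/
theorem exists_sum_endCost_le : ∃ C, ∀ (n : ℕ) (G : SimpleGraph (Fin n)) (w₀ : List (Fin n)),
    IsATFree G → w₀.length = n →
    ∑ w ∈ (feasibleWords_finite (bt := Between G) (List.finRange n)).toFinset, endCost w₀ w ≤
      C * (feasibleWords (Between G) (List.finRange n)).ncard := by
  classical
  obtain ⟨C, hC⟩ := exists_geometricBound 10 0
  refine ⟨C * 2 ^ 1, fun n G w₀ hG hlen₀ => ?_⟩
  have h := (isConvexBetweenness_between hG).sum_suffix_le (List.nodup_finRange n)
    (Q := fun r => r = w₀.drop (n - r.length))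
    (fun r r' h1 h2 h3 => by rw [h1, h2, h3.length_eq]) hC 0
  rw [List.length_finRange] at h
  refine le_trans (le_of_eq ?_) h
  refine Finset.sum_congr rfl fun w hw => Finset.sum_congr rfl fun i hi => ?_
  have hlen : w.length = n := by
    rw [Set.Finite.mem_toFinset] at hw
    simpa using hw.1.length_eq
  have hi' : n - (w.drop (i + 0)).length = i := by
    have := Finset.mem_range.1 hi
    rw [List.length_drop]
    omega
  simp only [hi']
  simp [compareCost]

theorem exists_sum_roundCost_le : ∃ C, ∀ (n : ℕ) (G : SimpleGraph (Fin n)) (w₀ : List (Fin n)),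
    IsATFree G → (w₀, false) ∈ prismVertices (Between G) (List.finRange n) →
    ∑ j ∈ Finset.range (cyclePeriod (Between G) n (w₀, false)), roundCost G w₀ j ≤
      C * (feasibleWords (Between G) (List.finRange n)).ncard := by
  obtain ⟨C₁, h₁⟩ := exists_sum_moveCost_le
  obtain ⟨C₂, h₂⟩ := exists_sum_endCost_le
  refine ⟨C₁ + C₁ + C₂ + 47, fun n G w₀ hG hp => ?_⟩
  have hnd := List.nodup_finRange n
  have alt := alternatingPair_moves (bt := Between G) hnd n
  set N := (feasibleWords (Between G) (List.finRange n)).ncard with hN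
  set P := cyclePeriod (Between G) n (w₀, false) with hP
  have hPN : P = N := (isConvexBetweenness_between hG).cyclePeriod_eq hnd hp
  have hmem := evenVertex_mem (n := n) hnd hp
  have hinj : ∀ i < P, ∀ j < P, (evenVertex (Between G) n (w₀, false) i).1 =
      (evenVertex (Between G) n (w₀, false) j).1 → i = j := fun i hi j hj h =>
    evenVertex_fst_injOn hnd hp hi hj h
  have k₁ := (sum_le_sum_feasibleWords hmem hinj (moveCost G)).trans (h₁ n G hG)
  have k₂ := (sum_le_sum_feasibleWords (fun i => alt.maps_left _ (hmem i))
    (fun i hi j hj h => firstMove_fst_injOn hnd hp hi hj h) (moveCost G)).trans (h₁ n G hG)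
  have k₃ := (sum_le_sum_feasibleWords hmem hinj (endCost w₀)).trans
    (h₂ n G w₀ hG (by simpa using hp.1.length_eq))
  have hshift : ∑ j ∈ Finset.range P, endCost w₀ (evenVertex (Between G) n (w₀, false) (j + 1)).1 =
      ∑ j ∈ Finset.range P, endCost w₀ (evenVertex (Between G) n (w₀, false) j).1 := by
    -- the sum runs over a full period
    set g := fun j => endCost w₀ (evenVertex (Between G) n (w₀, false) j).1 with hg
    have e1 := Finset.sum_range_succ g P
    have e2 := Finset.sum_range_succ' g P
    have e3 : evenVertex (Between G) n (w₀, false) P = evenVertex (Between G) n (w₀, false) 0 :=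
      evenVertex_period
    have e4 : g P = g 0 := by simp only [hg, e3]
    change ∑ j ∈ Finset.range P, g (j + 1) = ∑ j ∈ Finset.range P, g j
    omega
  simp only [roundCost, Finset.sum_add_distrib, hshift, Finset.sum_const, Finset.card_range,
    smul_eq_mul]
  calc _ ≤ C₁ * N + C₁ * N + C₂ * N + P * 47 := by gcongr
    _ = _ := by rw [hPN]; ring

end Amortization

end Cycle

/-! ### Computing the table of paths that avoid a closed neighbourhood -/

section Paths

variable {n : ℕ} {G : SimpleGraph (Fin n)}

/-- The vertices `x` and `z` are equal or adjacent. -/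
def Near (G : SimpleGraph (Fin n)) (x z : ℕ) : Prop :=
  x = z ∨ ∃ (hx : x < n) (hz : z < n), G.Adj ⟨x, hx⟩ ⟨z, hz⟩

/-- There is a path from `a` to `b` outside the closed neighbourhood of `y` whose inner vertices
are smaller than the first argument. As in the algorithm of Floyd and Warshall, the path may be
split at its largest inner vertex. -/
def PathBelow (G : SimpleGraph (Fin n)) : ℕ → ℕ → ℕ → ℕ → Prop
  | 0, y, a, b => (¬ Near G y a ∧ ¬ Near G y b) ∧ Near G a b
  | k + 1, y, a, b => PathBelow G k y a b ∨ (PathBelow G k y a k ∧ PathBelow G k y k b)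

/-- Paths can be joined at a vertex that is allowed as an inner vertex. -/
theorem PathBelow.trans {y a b c : ℕ} : ∀ {k : ℕ}, c < k → PathBelow G k y a c →
    PathBelow G k y c b → PathBelow G k y a b
  | k + 1, hc, h1, h2 => by
    rcases Nat.lt_or_eq_of_le (Nat.le_of_lt_succ hc) with hc | rfl
    · rcases h1 with h1 | ⟨h1, h1'⟩ <;> rcases h2 with h2 | ⟨h2, h2'⟩
      · exact .inl (h1.trans hc h2)
      · exact .inr ⟨h1.trans hc h2, h2'⟩
      · exact .inr ⟨h1, h1'.trans hc h2⟩
      · exact .inr ⟨h1, h2'⟩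
    · exact .inr ⟨h1.elim id (·.1), h2.elim id (·.2)⟩

theorem PathBelow.of_zero {y a b : ℕ} (h : PathBelow G 0 y a b) : ∀ k, PathBelow G k y a b
  | 0 => h
  | k + 1 => .inl (h.of_zero k)

theorem pathBelow_succ_self_right {k y a : ℕ} :
    PathBelow G (k + 1) y a k ↔ PathBelow G k y a k :=
  ⟨fun h => h.elim id (·.1), .inl⟩

theorem pathBelow_succ_self_left {k y b : ℕ} :
    PathBelow G (k + 1) y k b ↔ PathBelow G k y k b :=
  ⟨fun h => h.elim id (·.2), .inl⟩

theorem near_val {x z : Fin n} : Near G x z ↔ x = z ∨ G.Adj x z := by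
  simp [Near, Fin.ext_iff]

theorem not_near_val {y v : Fin n} : ¬ Near G y v ↔ v ≠ y ∧ ¬ G.Adj y v := by
  rw [near_val, not_or, eq_comm]

theorem PathBelow.joinedAvoiding {y : Fin n} : ∀ {k : ℕ}, k ≤ n → ∀ {a b : Fin n},
    PathBelow G k y a b → JoinedAvoiding G a b y
  | 0, _, a, b, ⟨⟨h1, h2⟩, h3⟩ => by
    rw [not_near_val] at h1 h2
    rcases near_val.1 h3 with rfl | h3
    exacts [.refl h1.1 h1.2, .of_adj h1 h2 h3]
  | k + 1, hk, a, b, h => by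
    rcases h with h | ⟨h1, h2⟩
    · exact h.joinedAvoiding (by omega)
    · exact (PathBelow.joinedAvoiding (b := ⟨k, hk⟩) (by omega) h1).trans
        (PathBelow.joinedAvoiding (a := ⟨k, hk⟩) (by omega) h2)

theorem pathBelow_iff {y a b : Fin n} : PathBelow G n y a b ↔ JoinedAvoiding G a b y := by
  refine ⟨PathBelow.joinedAvoiding le_rfl, ?_⟩
  rintro ⟨p, hp⟩
  induction p with
  | @nil a =>
    have h := not_near_val.2 (hp a (by simp))
    exact PathBelow.of_zero ⟨⟨h, h⟩, .inl rfl⟩ n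
  | @cons a c b hac p ih =>
    have h1 := not_near_val.2 (hp a (by simp))
    have h2 := not_near_val.2 (hp c (by simp))
    refine PathBelow.trans c.2 (PathBelow.of_zero ⟨⟨h1, h2⟩, near_val.2 (.inr hac)⟩ n)
      (ih fun v hv => hp v (by simp [hv]))

theorem natBetween_iff {x y z : ℕ} (hx : x < n) (hy : y < n) (hz : z < n) :
    natBetween G x y z ↔ PathBelow G n y z x ∧ PathBelow G n x z y := by
  have h1 := pathBelow_iff (G := G) (y := ⟨y, hy⟩) (a := ⟨z, hz⟩) (b := ⟨x, hx⟩)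
  have h2 := pathBelow_iff (G := G) (y := ⟨x, hx⟩) (a := ⟨z, hz⟩) (b := ⟨y, hy⟩)
  simp only at h1 h2
  rw [h1, h2]
  exact ⟨fun ⟨_, _, _, h⟩ => h, fun h => ⟨hx, hy, hz, h⟩⟩

end Paths

section Table

variable {n : ℕ} {G : SimpleGraph (Fin n)} {B : ℕ} {s s' : State} {T T' : ℕ → ℕ → ℕ → Prop}

/-- The constants and the adjacency matrix are loaded, and array `3` holds a table of the
predicate `T`. -/
structure TableState (G : SimpleGraph (Fin n)) (T : ℕ → ℕ → ℕ → Prop) (s : State) : Prop where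
  reg_zero : s.reg 0 = n
  reg_one : s.reg 1 = 1
  reg_two : s.reg 2 = 0
  adj_le_one : ∀ k, s.arr 0 k ≤ 1
  adj : ∀ a b, a < n → b < n → (a = b ∨ 0 < s.arr 0 (a * n + b) ↔ Near G a b)
  le_one : ∀ k, s.arr 3 k ≤ 1
  table : ∀ y a b, y < n → a < n → b < n → (0 < s.arr 3 ((y * n + a) * n + b) ↔ T y a b)

theorem TableState.frame {b : ℕ} (h : TableState G T s) (hf : Frame b s s') (hb : 3 ≤ b) :
    TableState G T s' where
  reg_zero := (hf.2 0 (by omega)).trans h.reg_zero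
  reg_one := (hf.2 1 (by omega)).trans h.reg_one
  reg_two := (hf.2 2 (by omega)).trans h.reg_two
  adj_le_one := hf.1 ▸ h.adj_le_one
  adj := hf.1 ▸ h.adj
  le_one := hf.1 ▸ h.le_one
  table := hf.1 ▸ h.table

theorem TableState.congr (h : TableState G T s)
    (hT : ∀ y a b, y < n → a < n → b < n → (T y a b ↔ T' y a b)) : TableState G T' s where
  __ := h
  table y a b hy ha hb := (h.table y a b hy ha hb).trans (hT y a b hy ha hb)

theorem index_inj {x y z x' y' z' : ℕ} (hy : y < n) (hz : z < n) (hy' : y' < n) (hz' : z' < n)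
    (h : (x * n + y) * n + z = (x' * n + y') * n + z') : x = x' ∧ y = y' ∧ z = z' := by
  obtain ⟨h1, h2⟩ := pair_inj hz hz' h
  obtain ⟨h3, h4⟩ := pair_inj hy hy' h1
  exact ⟨h3, h4, h2⟩

theorem TableState.setArr (h : TableState G T s) {y a b v : ℕ} (hy : y < n) (ha : a < n)
    (hb : b < n) (hv : v ≤ 1) (hvT : 0 < v ↔ T' y a b)
    (hT : ∀ y' a' b', y' < n → a' < n → b' < n → (y', a', b') ≠ (y, a, b) →
      (T y' a' b' ↔ T' y' a' b')) :
    TableState G T' (s.setArr 3 ((y * n + a) * n + b) v) where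
  reg_zero := h.reg_zero
  reg_one := h.reg_one
  reg_two := h.reg_two
  adj_le_one k := by simpa using h.adj_le_one k
  adj := by simpa using h.adj
  le_one k := by
    have := h.le_one k
    rw [State.setArr_arr]
    split_ifs <;> omega
  table y' a' b' hy' ha' hb' := by
    rw [State.setArr_arr]
    split_ifs with hc
    · obtain ⟨rfl, rfl, rfl⟩ := index_inj ha' hb' ha hb hc.2
      exact hvT
    · rw [h.table y' a' b' hy' ha' hb']
      refine hT _ _ _ hy' ha' hb' fun he => hc ?_
      simp only [Prod.mk.injEq] at he
      obtain ⟨rfl, rfl, rfl⟩ := he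
      exact ⟨rfl, rfl⟩

/-- Run `p` for all triples of vertices, in registers `5`, `6` and `7`. -/
def tripleProg (p : Prog) : Prog :=
  .seq (.const 5 0) <| .loop 5 0 <| .seq
    (.seq (.const 6 0) <| .loop 6 0 <| .seq
      (.seq (.const 7 0) <| .loop 7 0 <| .seq p (.add 7 7 1))
      (.add 6 6 1))
    (.add 5 5 1)

/-- The invariant `I m` holds when `p` has been run for the first `m` triples. -/
theorem comp_tripleProg (hB : LargeBound B n) {p : Prog} {c : ℕ} {I : ℕ → State → Prop}
    (hreg : ∀ m s, I m s → s.reg 0 = n ∧ s.reg 1 = 1)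
    (hframe : ∀ m s s', I m s → Frame 5 s s' → I m s')
    (hp : ∀ y a b s, y < n → a < n → b < n → I ((y * n + a) * n + b) s → s.reg 5 = y →
      s.reg 6 = a → s.reg 7 = b → Comp B p s c fun s' => I ((y * n + a) * n + b + 1) s' ∧
        s'.reg 5 = y ∧ s'.reg 6 = a ∧ s'.reg 7 = b)
    (hI : I 0 s) : Comp B (tripleProg p) s ((c + 20) * (n + 1) ^ 3) (I (n * n * n)) := by
  have hl := hB.lin
  have hset : ∀ m s r v, I m s → 5 ≤ r → I m (s.setReg r v) := fun m s r v h hr =>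
    hframe m s _ h ((Frame.refl _ _).setReg hr)
  refine Comp.mono (T := n * ((n * ((n * (c + 1 + 1) + 1 + 1) + 1 + 1) + 1 + 1) + 1 + 1) + 1 + 1)
    ?_ ?_ fun _ h => h
  · refine Comp.const_seq (by omega) <| Comp.forLoop (e := n)
      (c := (n * ((n * (c + 1 + 1) + 1 + 1) + 1 + 1) + 1 + 1) + 1) (b := 0)
      (I := fun y s' => s'.reg 5 = y ∧ I (y * n * n) s') ?_ (Nat.zero_le _) ?_ ?_ ?_ le_rfl
    · rintro y s' ⟨h1, h2⟩
      exact ⟨h1, (hreg _ _ h2).1⟩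
    · rintro y s' - hyn ⟨h5, hIy⟩
      refine Comp.seq (T₁ := n * ((n * (c + 1 + 1) + 1 + 1) + 1 + 1) + 1 + 1) (T₂ := 1)
        (Q₁ := fun s' => s'.reg 5 = y ∧ I ((y + 1) * n * n) s') ?_ ?_
      · refine Comp.const_seq (by omega) <| Comp.forLoop (e := n)
          (c := (n * (c + 1 + 1) + 1 + 1) + 1) (b := 0)
          (I := fun a s' => s'.reg 6 = a ∧ s'.reg 5 = y ∧ I ((y * n + a) * n) s') ?_
          (Nat.zero_le _) ?_ ?_ ?_ le_rfl
        · rintro a s' ⟨h1, -, h2⟩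
          exact ⟨h1, (hreg _ _ h2).1⟩
        · rintro a s' - han ⟨h6, h5, hIa⟩
          refine Comp.seq (T₁ := n * (c + 1 + 1) + 1 + 1) (T₂ := 1)
            (Q₁ := fun s' => s'.reg 6 = a ∧ s'.reg 5 = y ∧ I ((y * n + (a + 1)) * n) s') ?_ ?_
          · refine Comp.const_seq (by omega) <| Comp.forLoop (e := n) (c := c + 1) (b := 0)
              (I := fun b s' => s'.reg 7 = b ∧ s'.reg 6 = a ∧ s'.reg 5 = y ∧
                I ((y * n + a) * n + b) s') ?_ (Nat.zero_le _) ?_ ?_ ?_ le_rfl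
            · rintro b s' ⟨h1, -, -, h2⟩
              exact ⟨h1, (hreg _ _ h2).1⟩
            · rintro b s' - hbn ⟨h7, h6, h5, hIb⟩
              refine (hp y a b s' hyn han hbn hIb h5 h6 h7).seq (T₂ := 1) ?_
              rintro s'' ⟨k1, k5, k6, k7⟩
              have h1 := (hreg _ _ k1).2
              refine Comp.add (by omega) ⟨by simp [k7, h1], by simpa using k6, by simpa using k5,
                hset _ _ _ _ k1 (by omega)⟩
            · exact ⟨by simp, by simpa using h6, by simpa using h5, hset _ _ _ _ hIa (by omega)⟩
            · rintro s'' ⟨-, h6, h5, h⟩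
              exact ⟨h6, h5, by convert h using 1; ring⟩
          · rintro s'' ⟨k6, k5, k⟩
            have h1 := (hreg _ _ k).2
            exact Comp.add (by omega) ⟨by simp [k6, h1], by simpa using k5,
              hset _ _ _ _ k (by omega)⟩
        · exact ⟨by simp, by simpa using h5, by simpa using hset _ _ _ _ hIy (by omega)⟩
        · rintro s'' ⟨-, h5, h⟩
          exact ⟨h5, by convert h using 1; ring⟩
      · rintro s'' ⟨k5, k⟩
        have h1 := (hreg _ _ k).2
        exact Comp.add (by omega) ⟨by simp [k5, h1], hset _ _ _ _ k (by omega)⟩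
    · exact ⟨by simp, by simpa using hset _ _ _ _ hI (by omega)⟩
    · rintro s'' ⟨-, h⟩
      exact h
  · have h1 : (n + 1) ^ 3 = n ^ 3 + 3 * n ^ 2 + 3 * n + 1 := by ring
    rw [h1]
    nlinarith [Nat.zero_le (c * n ^ 2), Nat.zero_le (c * n), Nat.zero_le (n ^ 3),
      Nat.zero_le (n ^ 2)]

/-- Test whether the vertices in the registers `x` and `z` are equal or adjacent; then register `r`
becomes positive. -/
def nearProg (x z r : ℕ) : Prog :=
  .seq (.sub 8 x z) <| .seq (.sub 9 z x) <| .seq (.add 8 8 9) <| .seq (.sub 8 1 8) <|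
  .seq (.mul 9 x 0) <| .seq (.add 9 9 z) <| .seq (.load 9 0 9) <| .add r 8 9

theorem comp_nearProg (hB : LargeBound B n) (hs : TableState G T s) {x z r a b : ℕ} (hx : x < 8)
    (hz : z < 8) (ha : s.reg x = a) (hb : s.reg z = b) (han : a < n) (hbn : b < n) :
    Comp B (nearProg x z r) s 8 fun s' => s'.arr = s.arr ∧
      (∀ q, q ≠ 8 → q ≠ 9 → q ≠ r → s'.reg q = s.reg q) ∧ (0 < s'.reg r ↔ Near G a b) := by
  have hl := hB.lin
  have hsq := hB.sq
  have h0 := hs.reg_zero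
  have h1 := hs.reg_one
  have hp := pair_lt han hbn
  have hle := hs.adj_le_one (a * n + b)
  have hadj := hs.adj a b han hbn
  have hx8 : x ≠ 8 := by omega
  have hx9 : x ≠ 9 := by omega
  have hz8 : z ≠ 8 := by omega
  have hz9 : z ≠ 9 := by omega
  refine Comp.sub_seq ?_ <| Comp.sub_seq ?_ <| Comp.add_seq ?_ <| Comp.sub_seq ?_ <|
    Comp.mul_seq ?_ <| Comp.add_seq ?_ <| Comp.load_seq ?_ <| Comp.add ?_ ⟨rfl, ?_, ?_⟩
  rotate_right 2
  · intro q h8 h9 hr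
    simp [h8, h9, hr]
  · simp [h0, h1, ha, hb, hx8, hx9, hz8, hz9, ← hadj]
    omega
  all_goals
    simp [h0, h1, ha, hb, hx8, hx9, hz8, hz9]
    omega

/-- Enter into the table whether there is a path without inner vertices. -/
def edgeProg : Prog :=
  .seq (nearProg 5 6 10) <| .seq (nearProg 5 7 11) <| .seq (nearProg 6 7 12) <|
  .seq (.sub 10 1 10) <| .seq (.sub 11 1 11) <| .seq (.sub 12 1 12) <| .seq (.sub 12 1 12) <|
  .seq (.mul 10 10 11) <| .seq (.mul 10 10 12) <|
  .seq (.mul 9 5 0) <| .seq (.add 9 9 6) <| .seq (.mul 9 9 0) <| .seq (.add 9 9 7) <|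
  .store 3 9 10

theorem comp_edgeProg (hB : LargeBound B n) {y a b : ℕ} (hy : y < n) (ha : a < n) (hb : b < n)
    (hs : TableState G (fun y' a' b' => (y' * n + a') * n + b' < (y * n + a) * n + b ∧
      PathBelow G 0 y' a' b') s) (h5 : s.reg 5 = y) (h6 : s.reg 6 = a) (h7 : s.reg 7 = b) :
    Comp B edgeProg s 35 fun s' => TableState G (fun y' a' b' =>
      (y' * n + a') * n + b' < (y * n + a) * n + b + 1 ∧ PathBelow G 0 y' a' b') s' ∧
      s'.reg 5 = y ∧ s'.reg 6 = a ∧ s'.reg 7 = b := by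
  have hl := hB.lin
  have hsq := hB.sq
  have hcube := hB.cube
  have hframe : ∀ {s s' : State} {r : ℕ}, 10 ≤ r → s'.arr = s.arr →
      (∀ q, q ≠ 8 → q ≠ 9 → q ≠ r → s'.reg q = s.reg q) → Frame 8 s s' := fun hr h1 h2 =>
    ⟨h1, fun q hq => h2 q (by omega) (by omega) (by omega)⟩
  refine (comp_nearProg hB hs (r := 10) (by omega) (by omega) h5 h6 hy ha).seq (T₂ := 27) ?_
  rintro s₁ ⟨k1, k2, k3⟩
  have hf1 := hframe le_rfl k1 k2
  refine (comp_nearProg hB (hs.frame hf1 (by omega)) (r := 11) (by omega) (by omega)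
    ((hf1.2 5 (by omega)).trans h5) ((hf1.2 7 (by omega)).trans h7) hy hb).seq (T₂ := 19) ?_
  rintro s₂ ⟨k4, k5, k6⟩
  have hf2 := hf1.trans (hframe (by omega) k4 k5) le_rfl
  refine (comp_nearProg hB (hs.frame hf2 (by omega)) (r := 12) (by omega) (by omega)
    ((hf2.2 6 (by omega)).trans h6) ((hf2.2 7 (by omega)).trans h7) ha hb).seq (T₂ := 11) ?_
  rintro s₃ ⟨k7, k8, k9⟩
  have hf3 := hf2.trans (hframe (by omega) k7 k8) le_rfl
  have hs3 := hs.frame hf3 (by omega)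
  rw [← k5 10 (by omega) (by omega) (by omega), ← k8 10 (by omega) (by omega) (by omega)] at k3
  rw [← k8 11 (by omega) (by omega) (by omega)] at k6
  have e0 := hs3.reg_zero
  have e1 := hs3.reg_one
  have e5 := (hf3.2 5 (by omega)).trans h5
  have e6 := (hf3.2 6 (by omega)).trans h6
  have e7 := (hf3.2 7 (by omega)).trans h7
  have i1 := index_lt hy ha hb
  have p1 := pair_lt hy ha
  have m1 := Nat.mul_lt_mul_of_pos_right p1 (show 0 < n by omega)
  obtain ⟨u, hu⟩ : ∃ u, s₃.reg 10 = u := ⟨_, rfl⟩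
  obtain ⟨v, hv⟩ : ∃ v, s₃.reg 11 = v := ⟨_, rfl⟩
  obtain ⟨w, hw⟩ : ∃ w, s₃.reg 12 = w := ⟨_, rfl⟩
  rw [hu] at k3
  rw [hv] at k6
  rw [hw] at k9
  have b1 : (1 - u) * (1 - v) ≤ 1 :=
    Nat.mul_le_mul (show 1 - u ≤ 1 by omega) (show 1 - v ≤ 1 by omega)
  have b2 : (1 - u) * (1 - v) * (1 - (1 - w)) ≤ 1 :=
    Nat.mul_le_mul b1 (show 1 - (1 - w) ≤ 1 by omega)
  have hpos : 0 < (1 - u) * (1 - v) * (1 - (1 - w)) ↔ PathBelow G 0 y a b := by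
    simp only [PathBelow, ← k3, ← k6, ← k9, Nat.pos_iff_ne_zero,
      mul_ne_zero_iff]
    omega
  have key : ∀ S : State, Frame 8 s₃ S → S.reg 9 = (y * n + a) * n + b →
      S.reg 10 = (1 - u) * (1 - v) * (1 - (1 - w)) → TableState G (fun y' a' b' =>
        (y' * n + a') * n + b' < (y * n + a) * n + b + 1 ∧ PathBelow G 0 y' a' b')
          (S.setArr 3 (S.reg 9) (S.reg 10)) ∧ S.reg 5 = y ∧ S.reg 6 = a ∧ S.reg 7 = b := by
    intro S hS h9 h10
    rw [h9, h10]
    refine ⟨(hs3.frame hS (by omega)).setArr hy ha hb b2 (by simp [hpos]) ?_,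
      (hS.2 5 (by omega)).trans e5, (hS.2 6 (by omega)).trans e6, (hS.2 7 (by omega)).trans e7⟩
    intro y' a' b' hy' ha' hb' hne
    have : (y' * n + a') * n + b' ≠ (y * n + a) * n + b := fun h => hne <| by
      obtain ⟨rfl, rfl, rfl⟩ := index_inj ha' hb' ha hb h
      rfl
    simp only [and_congr_left_iff]
    omega
  refine Comp.sub_seq ?_ <| Comp.sub_seq ?_ <| Comp.sub_seq ?_ <| Comp.sub_seq ?_ <|
    Comp.mul_seq ?_ <| Comp.mul_seq ?_ <| Comp.mul_seq ?_ <| Comp.add_seq ?_ <|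
    Comp.mul_seq ?_ <| Comp.add_seq ?_ <| Comp.store ?_ (key _ ?_ ?_ ?_)
  rotate_right 3
  · iterate 10 refine Frame.setReg ?_ (by omega)
    exact Frame.refl _ _
  all_goals
    simp [e0, e1, e5, e6, e7, hu, hv, hw]
  all_goals omega

/-- Look up whether there is a path through the vertex in register `4`. -/
def throughProg : Prog :=
  .seq (.mul 8 5 0) <| .seq (.add 8 8 6) <| .seq (.mul 8 8 0) <| .seq (.add 9 8 4) <|
  .seq (.load 10 3 9) <|
  .seq (.mul 9 5 0) <| .seq (.add 9 9 4) <| .seq (.mul 9 9 0) <| .seq (.add 9 9 7) <|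
  .seq (.load 11 3 9) <| .mul 10 10 11

/-- Allow the vertex in register `4` as an inner vertex of the path. The two subtractions from `1`
turn a positive number into `1`. -/
def extendProg : Prog :=
  .seq throughProg <| .seq (.add 8 8 7) <| .seq (.load 11 3 8) <| .seq (.add 10 10 11) <|
  .seq (.sub 10 1 10) <| .seq (.sub 10 1 10) <| .store 3 8 10

open Classical in
theorem comp_extendProg (hB : LargeBound B n) {k y a b : ℕ} (hk : k < n) (hy : y < n) (ha : a < n)
    (hb : b < n)
    (hs : TableState G (fun y' a' b' => if (y' * n + a') * n + b' < (y * n + a) * n + b then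
      PathBelow G (k + 1) y' a' b' else PathBelow G k y' a' b') s) (h4 : s.reg 4 = k)
    (h5 : s.reg 5 = y) (h6 : s.reg 6 = a) (h7 : s.reg 7 = b) :
    Comp B extendProg s 17 fun s' => (TableState G (fun y' a' b' =>
      if (y' * n + a') * n + b' < (y * n + a) * n + b + 1 then
        PathBelow G (k + 1) y' a' b' else PathBelow G k y' a' b') s' ∧ s'.reg 4 = k) ∧
      s'.reg 5 = y ∧ s'.reg 6 = a ∧ s'.reg 7 = b := by
  have hl := hB.lin
  have hsq := hB.sq
  have hcube := hB.cube
  have e0 := hs.reg_zero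
  have e1 := hs.reg_one
  have i1 := index_lt hy ha hb
  have i2 := index_lt hy ha hk
  have i3 := index_lt hy hk hb
  have p1 := pair_lt hy ha
  have p2 := pair_lt hy hk
  have m1 := Nat.mul_lt_mul_of_pos_right p1 (show 0 < n by omega)
  have m2 := Nat.mul_lt_mul_of_pos_right p2 (show 0 < n by omega)
  obtain ⟨u, hu⟩ : ∃ u, s.arr 3 ((y * n + a) * n + k) = u := ⟨_, rfl⟩
  obtain ⟨v, hv⟩ : ∃ v, s.arr 3 ((y * n + k) * n + b) = v := ⟨_, rfl⟩
  obtain ⟨w, hw⟩ : ∃ w, s.arr 3 ((y * n + a) * n + b) = w := ⟨_, rfl⟩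
  have l1 := hs.le_one ((y * n + a) * n + k)
  have l2 := hs.le_one ((y * n + k) * n + b)
  have l3 := hs.le_one ((y * n + a) * n + b)
  -- The entries for paths from or to `k` are the same before and after they are updated.
  have t1 := hs.table y a k hy ha hk
  have t2 := hs.table y k b hy hk hb
  have t3 := hs.table y a b hy ha hb
  simp only [pathBelow_succ_self_right, pathBelow_succ_self_left, ite_self, lt_irrefl,
    if_false] at t1 t2 t3
  rw [hu] at l1 t1
  rw [hv] at l2 t2
  rw [hw] at l3 t3
  have b1 : u * v ≤ 1 := Nat.mul_le_mul l1 l2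
  have hpos : 0 < 1 - (1 - (u * v + w)) ↔ PathBelow G (k + 1) y a b := by
    have : 0 < u * v ↔ 0 < u ∧ 0 < v := by simp [Nat.pos_iff_ne_zero]
    rw [PathBelow, ← t1, ← t2, ← t3, ← this]
    omega
  have key : ∀ S : State, Frame 8 s S → S.reg 8 = (y * n + a) * n + b →
      S.reg 10 = 1 - (1 - (u * v + w)) → (TableState G (fun y' a' b' =>
        if (y' * n + a') * n + b' < (y * n + a) * n + b + 1 then
          PathBelow G (k + 1) y' a' b' else PathBelow G k y' a' b')
          (S.setArr 3 (S.reg 8) (S.reg 10)) ∧ S.reg 4 = k) ∧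
        S.reg 5 = y ∧ S.reg 6 = a ∧ S.reg 7 = b := by
    intro S hS h8 h10
    rw [h8, h10]
    refine ⟨⟨(hs.frame hS (by omega)).setArr hy ha hb (by omega) (by simp [hpos]) ?_,
      (hS.2 4 (by omega)).trans h4⟩, (hS.2 5 (by omega)).trans h5, (hS.2 6 (by omega)).trans h6,
      (hS.2 7 (by omega)).trans h7⟩
    intro y' a' b' hy' ha' hb' hne
    have hne' : (y' * n + a') * n + b' ≠ (y * n + a) * n + b := fun h => hne <| by
      obtain ⟨rfl, rfl, rfl⟩ := index_inj ha' hb' ha hb h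
      rfl
    have hiff : (y' * n + a') * n + b' < (y * n + a) * n + b + 1 ↔
      (y' * n + a') * n + b' < (y * n + a) * n + b := by omega
    simp only [hiff]
  refine Comp.seq (T₁ := 11) (T₂ := 6) (Q₁ := fun s' => Frame 8 s s' ∧
    s'.reg 8 = (y * n + a) * n ∧ s'.reg 10 = u * v) ?_ ?_
  · refine Comp.mul_seq ?_ <| Comp.add_seq ?_ <| Comp.mul_seq ?_ <| Comp.add_seq ?_ <|
      Comp.load_seq ?_ <| Comp.mul_seq ?_ <| Comp.add_seq ?_ <| Comp.mul_seq ?_ <|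
      Comp.add_seq ?_ <| Comp.load_seq ?_ <| Comp.mul ?_ ⟨?_, ?_⟩
    rotate_right 2
    · iterate 11 refine Frame.setReg ?_ (by omega)
      exact Frame.refl _ _
    all_goals
      simp [e0, h4, h5, h6, h7, hu, hv]
    all_goals omega
  rintro s₁ ⟨hf, k8, k10⟩
  have f1 := (hf.2 1 (by omega)).trans e1
  have f7 := (hf.2 7 (by omega)).trans h7
  refine Comp.add_seq ?_ <| Comp.load_seq ?_ <| Comp.add_seq ?_ <| Comp.sub_seq ?_ <|
    Comp.sub_seq ?_ <| Comp.store ?_ (key _ ?_ ?_ ?_)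
  rotate_right 3
  · iterate 5 refine Frame.setReg ?_ (by omega)
    exact hf
  all_goals
    simp [hf.1, f1, f7, k8, k10, hw]
  all_goals omega

/-- Compute the table of paths. -/
def tableProg : Prog :=
  .seq (tripleProg edgeProg) <| .seq (.const 4 0) <|
    .loop 4 0 <| .seq (tripleProg extendProg) (.add 4 4 1)

theorem comp_tableProg (hB : LargeBound B n) (hs : TableState G (fun _ _ _ => False) s) :
    Comp B tableProg s (100 * (n + 1) ^ 4) (TableState G (PathBelow G n)) := by
  classical
  have hl := hB.lin
  refine Comp.mono (T := 55 * (n + 1) ^ 3 + (n * (37 * (n + 1) ^ 3 + 1 + 1) + 1 + 1)) ?_ ?_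
    fun _ h => h
  · refine (comp_tripleProg hB (c := 35) (I := fun m s' => TableState G (fun y' a' b' =>
      (y' * n + a') * n + b' < m ∧ PathBelow G 0 y' a' b') s') (fun m s' h =>
      ⟨h.reg_zero, h.reg_one⟩) (fun m s' s'' h hf => h.frame hf (by omega))
      (fun y a b s' hy ha hb h h5 h6 h7 => comp_edgeProg hB hy ha hb h h5 h6 h7)
      (hs.congr (by simp))).seq (T₂ := n * (37 * (n + 1) ^ 3 + 1 + 1) + 1 + 1) ?_
    intro s₁ hs₁
    have hs₁' : TableState G (PathBelow G 0) s₁ := hs₁.congr fun y a b hy ha hb => by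
      simp [index_lt hy ha hb]
    refine Comp.const_seq (by omega) <| Comp.forLoop (e := n) (c := 37 * (n + 1) ^ 3 + 1) (b := 0)
      (I := fun k s' => s'.reg 4 = k ∧ TableState G (PathBelow G k) s') ?_ (Nat.zero_le _) ?_ ?_ ?_
      le_rfl
    · exact fun k s' h => ⟨h.1, h.2.reg_zero⟩
    · rintro k s₂ - hk ⟨h4, hs₂⟩
      refine (comp_tripleProg hB (c := 17) (I := fun m s' => TableState G (fun y' a' b' =>
        if (y' * n + a') * n + b' < m then PathBelow G (k + 1) y' a' b' else
          PathBelow G k y' a' b') s' ∧ s'.reg 4 = k) (fun m s' h =>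
        ⟨h.1.reg_zero, h.1.reg_one⟩) (fun m s' s'' h hf => ⟨h.1.frame hf (by omega),
          (hf.2 4 (by omega)).trans h.2⟩)
        (fun y a b s' hy ha hb h h5 h6 h7 => comp_extendProg hB hk hy ha hb h.1 h.2 h5 h6 h7)
        ⟨hs₂.congr (by simp), h4⟩).seq (T₂ := 1) ?_
      rintro s₃ ⟨hs₃, g4⟩
      refine Comp.add (by rw [g4, hs₃.reg_one]; omega) ⟨by simp [g4, hs₃.reg_one], ?_⟩
      have hf : Frame 4 s₃ (s₃.setReg 4 (s₃.reg 4 + s₃.reg 1)) :=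
        (Frame.refl _ _).setReg le_rfl
      exact (hs₃.frame hf (by omega)).congr fun y a b hy ha hb => by simp [index_lt hy ha hb]
    · exact ⟨by simp, hs₁'.frame ((Frame.refl 4 s₁).setReg le_rfl) (by omega)⟩
    · exact fun s' h => h.2
  · have h1 : (n + 1) ^ 4 = n * (n + 1) ^ 3 + (n + 1) ^ 3 := by ring
    have h2 : 1 ≤ (n + 1) ^ 3 := Nat.one_le_pow _ _ (by omega)
    have h3 : n ≤ n * (n + 1) ^ 3 := Nat.le_mul_of_pos_right _ h2
    rw [h1]
    nlinarith

end Table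

/-! ### Preprocessing: the first order -/

section FirstWord

variable {n : ℕ} {G : SimpleGraph (Fin n)} {B : ℕ} {s s' : State} {W : ℕ → ℕ}

/-- The entries of `W` before position `n` are distinct vertices, and those before position `i` are
feasible for the suffix that they start. -/
structure GreedyWord (G : SimpleGraph (Fin n)) (W : ℕ → ℕ) (i : ℕ) : Prop where
  lt : ∀ a < n, W a < n
  inj : ∀ a < n, ∀ b < n, W a = W b → a = b
  feasible : ∀ a < i, FeasibleFrom G W a (W a)

/-- Feasibility depends only on the set of entries from position `i` on. -/
theorem FeasibleFrom.swap {i a b z : ℕ} (h : FeasibleFrom G W i z) (ha : i ≤ a) (han : a < n)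
    (hb : i ≤ b) (hbn : b < n) : FeasibleFrom G (fun j => W (Equiv.swap a b j)) i z := by
  have key : ∀ c, i ≤ c → c < n → i ≤ Equiv.swap a b c ∧ Equiv.swap a b c < n := by
    intro c hc hcn
    rw [Equiv.swap_apply_def]
    split_ifs <;> omega
  exact fun c hc hcn d hd hdn =>
    h _ (key c hc hcn).1 (key c hc hcn).2 _ (key d hd hdn).1 (key d hd hdn).2

theorem GreedyWord.swap {i p : ℕ} (h : GreedyWord G W i) (hin : i < n) (hip : i ≤ p) (hpn : p < n)
    (hp : FeasibleFrom G W i (W p)) :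
    GreedyWord G (fun j => W (Equiv.swap i p j)) (i + 1) := by
  have key : ∀ c < n, Equiv.swap i p c < n := by
    intro c hcn
    rw [Equiv.swap_apply_def]
    split_ifs <;> omega
  refine ⟨fun a ha => h.lt _ (key a ha), fun a ha b hb hab =>
    (Equiv.swap i p).injective (h.inj _ (key a ha) _ (key b hb) hab), fun a ha => ?_⟩
  rcases Nat.lt_or_eq_of_le (Nat.le_of_lt_succ ha) with ha | rfl
  · rw [Equiv.swap_apply_of_ne_of_ne (by omega) (by omega)]
    exact (h.feasible a ha).swap (by omega) hin (by omega) hpn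
  · rw [Equiv.swap_apply_left]
    exact hp.swap le_rfl hin hip hpn

theorem GreedyWord.exists_feasible (hG : IsATFree G) {i : ℕ} (h : GreedyWord G W i)
    (hin : i < n) : ∃ p, i ≤ p ∧ p < n ∧ FeasibleFrom G W i (W p) := by
  by_cases hi : i + 1 < n
  · obtain ⟨z, ⟨p, hip, hpn, hz⟩, -, hbet⟩ := exists_extreme_ne hG
      {v : Fin n | ∃ p, i ≤ p ∧ p < n ∧ W p = v} ⟨W i, h.lt i hin⟩
      ⟨⟨W (i + 1), h.lt _ hi⟩, ⟨i + 1, by omega, hi, rfl⟩, fun he => by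
        have := h.inj _ hi _ hin (congrArg Fin.val he)
        omega⟩
    refine ⟨p, hip, hpn, fun a ha han b hb hbn hab => ?_⟩
    rw [hz] at hab
    obtain ⟨hx, hy, hz', hab⟩ := hab
    exact hbet _ ⟨a, ha, han, rfl⟩ _ ⟨b, hb, hbn, rfl⟩ hab
  · refine ⟨i, le_rfl, hin, fun a ha han b hb hbn hab => ?_⟩
    obtain rfl : a = i := by omega
    obtain rfl : b = a := by omega
    obtain ⟨hx, hy, hz, hab⟩ := hab
    exact not_between_self hab

theorem feasibleWord_of_drop {V : Type*} {bt : V → V → V → Prop} : ∀ {w : List V},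
    (∀ i x r, w.drop i = x :: r → Feasible bt (x :: r) x) → FeasibleWord bt w
  | [], _ => trivial
  | x :: r, h => ⟨h 0 x r rfl, feasibleWord_of_drop fun i y r' hr => h (i + 1) y r' hr⟩

theorem GreedyWord.exists_word (h : GreedyWord G W n) :
    ∃ w, Holds w W ∧ (w, false) ∈ prismVertices (Between G) (List.finRange n) := by
  have hholds : Holds (List.ofFn fun j : Fin n => (⟨W j, h.lt j j.2⟩ : Fin n)) W := by
    refine List.ext_getElem (by simp) fun j hj hj' => by simp
  refine ⟨_, hholds, ?_, ?_⟩
  · have hnd : (List.ofFn fun j : Fin n => (⟨W j, h.lt j j.2⟩ : Fin n)).Nodup := by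
      rw [List.nodup_ofFn]
      intro a b hab
      exact Fin.ext (h.inj _ a.2 _ b.2 (congrArg Fin.val hab))
    refine (List.subperm_of_subset hnd fun v _ => List.mem_finRange v).perm_of_length_le ?_
    simp
  · refine feasibleWord_of_drop fun i x r hr => ?_
    obtain ⟨h1, h2⟩ := hholds.drop hr
    rw [← hr]
    refine (feasibleFrom_iff hholds (by simp [hr])).1 ?_
    rw [← h1]
    exact h.feasible i h2

/-- Write the vertices to the output array in their natural order. -/
def fillProg : Prog :=
  .seq (.const 5 0) <| .loop 5 0 <| .seq (.store 1 5 5) (.add 5 5 1)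

theorem comp_fillProg (hB : LargeBound B n) (hs : TableState G (PathBelow G n) s) :
    Comp B fillProg s (3 * n + 2) fun s' => Ready G s' ∧ GreedyWord G (s'.arr 1) 0 := by
  have hl := hB.lin
  refine Comp.mono (T := n * (2 + 1) + 1 + 1) ?_ (by omega) fun _ h => h
  refine Comp.const_seq (by omega) <| Comp.forLoop (e := n) (c := 2) (b := 0)
    (I := fun k s' => s'.reg 5 = k ∧ (∀ r < 3, s'.reg r = s.reg r) ∧ s'.arr 3 = s.arr 3 ∧
      ∀ a < k, s'.arr 1 a = a) ?_ (Nat.zero_le _) ?_ ?_ ?_ le_rfl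
  · rintro k s₁ ⟨h1, h2, -⟩
    exact ⟨h1, (h2 0 (by omega)).trans hs.reg_zero⟩
  · rintro k s₁ - hk ⟨h1, h2, h3, h4⟩
    have e1 := (h2 1 (by omega)).trans hs.reg_one
    refine Comp.store_seq (by omega) (T := 1) <| Comp.add (by simp [h1, e1]; omega)
      ⟨by simp [h1, e1], ?_, ?_, ?_⟩
    · intro r hr
      simp [show r ≠ 5 by omega, h2 r hr]
    · funext j
      simp [h3]
    · intro a ha
      simp only [State.setReg_arr, State.setArr_arr, h1, true_and]
      split_ifs with hc
      exacts [hc.symm, h4 a (by omega)]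
  · exact ⟨by simp, fun r hr => by simp; omega, rfl, fun a ha => by omega⟩
  · rintro s₁ ⟨-, h2, h3, h4⟩
    refine ⟨⟨(h2 0 (by omega)).trans hs.reg_zero, (h2 1 (by omega)).trans hs.reg_one,
      (h2 2 (by omega)).trans hs.reg_two, h3 ▸ hs.le_one, fun x y z hx hy hz => ?_,
      fun a ha => by rw [h4 a ha]; exact ha⟩, fun a ha => by rw [h4 a ha]; exact ha,
      fun a ha b hb hab => ?_, fun a ha => by omega⟩
    · rw [h3, natBetween_iff hx hy hz, ← hs.table y z x hy hz hx, ← hs.table x z y hx hz hy]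
      simp [Nat.pos_iff_ne_zero]
    · rwa [h4 a ha, h4 b hb] at hab

/-- Find a position from the one in register `5` on whose entry is feasible; it goes to register
`6`. -/
def searchProg : Prog :=
  .seq (.add 6 5 2) <| .seq (.const 7 1) <|
  .loop 2 7 <| .seq (.load 12 1 6) <| .seq (feasProg 5 12) <|
    .branch 2 13 (.const 7 0) (.add 6 6 1)

theorem comp_searchProg (hB : LargeBound B n) (hs : Ready G s) {i : ℕ} (h5 : s.reg 5 = i)
    (hin : i < n) (hex : ∃ p, i ≤ p ∧ p < n ∧ FeasibleFrom G (s.arr 1) i (s.arr 1 p)) :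
    Comp B searchProg s (40 * (n + 1) ^ 3) fun s' => Frame 6 s s' ∧ i ≤ s'.reg 6 ∧
      s'.reg 6 < n ∧ FeasibleFrom G (s.arr 1) i (s.arr 1 (s'.reg 6)) := by
  have hl := hB.lin
  set W := s.arr 1 with hW
  refine Comp.mono (T := (n * (30 * (n + 1) ^ 2 + 4) + 1) + 1 + 1) ?_ ?_ fun _ h => h
  · refine Comp.add_seq (by rw [h5, hs.reg_two]; omega) <| Comp.const_seq (by omega) ?_
    refine Comp.loop (N := n) (C := fun _ => 30 * (n + 1) ^ 2 + 4)
      (I := fun k s' => Frame 6 s s' ∧ (s'.reg 7 = 0 → i ≤ s'.reg 6 ∧ s'.reg 6 < n ∧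
        FeasibleFrom G W i (W (s'.reg 6))) ∧ (0 < s'.reg 7 → s'.reg 7 = 1 ∧ s'.reg 6 = i + k ∧
          ∀ q, i ≤ q → q < i + k → ¬ FeasibleFrom G W i (W q))) ?_ ?_ ?_ (by simp)
    · rintro k s₁ ⟨hf, -, hI⟩ hgo
      have hr := hs.frame hf (by omega)
      rw [hr.reg_two] at hgo
      obtain ⟨h7, h6, hno⟩ := hI hgo
      obtain ⟨p, hip, hpn, hp⟩ := hex
      have hkn : i + k < n := by
        by_contra hc
        exact hno p hip (by omega) hp
      refine ⟨by omega, 30 * (n + 1) ^ 2 + 3, by omega, ?_⟩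
      have harr : s₁.arr 1 = W := congrFun hf.1 1
      have hWk : W (i + k) < n := hs.word_lt _ hkn
      refine Comp.load_seq (T := 30 * (n + 1) ^ 2 + 2) (by rw [h6, harr]; omega) ?_
      rw [h6, harr]
      have hf1 : Frame 8 s₁ (s₁.setReg 12 (W (i + k))) := (Frame.refl _ _).setReg (by omega)
      refine (comp_feasProg hB (hr.frame hf1 (by omega)) (ri := 5) (rv := 12) (i := i)
        (z := W (i + k)) (by omega) (by omega) ?_ (by simp) hin.le hWk).seq (T₂ := 2) ?_ ?_
      · rw [hf1.2 5 (by omega), hf.2 5 (by omega), h5]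
      · rintro s₂ ⟨hf2, -, h13⟩
        have hf3 := hf.trans (hf1.trans hf2 (by omega)) (by omega)
        have hr2 := hs.frame hf3 (by omega)
        have g6 : s₂.reg 6 = i + k := by rw [hf2.2 6 (by omega), hf1.2 6 (by omega), h6]
        have g7 : s₂.reg 7 = 1 := by rw [hf2.2 7 (by omega), hf1.2 7 (by omega), h7]
        rw [hf1.1, harr] at h13
        refine Comp.branch (T := 1) (fun h => ?_) fun h => ?_
        · rw [hr2.reg_two, h13] at h
          refine Comp.const (by omega) ⟨hf3.setReg (by omega), fun _ => ?_, by simp⟩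
          rw [State.setReg_reg, if_neg (by omega), g6]
          exact ⟨by omega, hkn, h⟩
        · rw [hr2.reg_two, h13] at h
          refine Comp.add (by rw [g6, hr2.reg_one]; omega) ⟨hf3.setReg (by omega), ?_, ?_⟩
          · simp [g7]
          · refine fun _ => ⟨by simp [g7], by simp [g6, hr2.reg_one, add_assoc], ?_⟩
            intro q hq hqk
            rcases Nat.lt_or_eq_of_le (Nat.le_of_lt_succ hqk) with hlt | rfl
            exacts [hno q hq hlt, h]
      · have : 30 * (n - i + 1) ^ 2 ≤ 30 * (n + 1) ^ 2 := by gcongr; omega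
        omega
    · refine ⟨((Frame.refl _ _).setReg (by omega)).setReg (by omega), by simp, fun _ => ?_⟩
      refine ⟨by simp, by simp [h5, hs.reg_two], fun q h1 h2 => by omega⟩
    · rintro k s₁ ⟨hf, hI, -⟩ hgo
      rw [(hs.frame hf (by omega)).reg_two] at hgo
      exact ⟨hf, hI (by omega)⟩
  · have h1 : (n + 1) ^ 3 = n * (n + 1) ^ 2 + (n + 1) ^ 2 := by ring
    have h2 : 1 ≤ (n + 1) ^ 2 := Nat.one_le_pow _ _ (by omega)
    have h3 : n ≤ n * (n + 1) ^ 2 := Nat.le_mul_of_pos_right _ h2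
    rw [h1]
    nlinarith

/-- Rearrange the output array: for every position, search for a feasible entry and swap it to
the front. -/
def greedyProg : Prog :=
  .seq (.const 5 0) <| .loop 5 0 <| .seq searchProg <|
    .seq (.load 9 1 5) <| .seq (.load 10 1 6) <| .seq (.store 1 5 10) <| .seq (.store 1 6 9) <|
    .add 5 5 1

theorem comp_greedyProg (hG : IsATFree G) (hB : LargeBound B n) (hs : Ready G s)
    (hW : GreedyWord G (s.arr 1) 0) :
    Comp B greedyProg s (50 * (n + 1) ^ 4) fun s' => Ready G s' ∧ GreedyWord G (s'.arr 1) n := by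
  have hl := hB.lin
  refine Comp.mono (T := n * (40 * (n + 1) ^ 3 + 5 + 1) + 1 + 1) ?_ ?_ fun _ h => h
  · refine Comp.const_seq (by omega) <| Comp.forLoop (e := n) (c := 40 * (n + 1) ^ 3 + 5) (b := 0)
      (I := fun i s' => s'.reg 5 = i ∧ Ready G s' ∧ GreedyWord G (s'.arr 1) i) ?_ (Nat.zero_le _)
      ?_ ?_ ?_ le_rfl
    · exact fun i s₁ h => ⟨h.1, h.2.1.reg_zero⟩
    · rintro i s₁ - hin ⟨h5, hr, hW₁⟩
      refine (comp_searchProg hB hr h5 hin (hW₁.exists_feasible hG hin)).seq (T₂ := 5) ?_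
      rintro s₂ ⟨hf, hip, hpn, hp⟩
      have g5 := (hf.2 5 (by omega)).trans h5
      have hr2 := hr.frame hf (by omega)
      have hone := hr2.reg_one
      obtain ⟨p, h6⟩ : ∃ p, s₂.reg 6 = p := ⟨_, rfl⟩
      rw [h6] at hip hpn hp
      rw [← hf.1] at hp hW₁
      have hsw := hW₁.swap hin hip hpn hp
      obtain ⟨W, hWs⟩ : ∃ W, s₂.arr 1 = W := ⟨_, rfl⟩
      have hWi := hr2.word_lt i hin
      have hWp := hr2.word_lt p hpn
      have key : ∀ S : State, (∀ r < 3, S.reg r = s₂.reg r) → S.arr 3 = s₂.arr 3 →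
          (∀ j, S.arr 1 j = if j = p then W i else if j = i then W p else W j) →
          Ready G S ∧ GreedyWord G (S.arr 1) (i + 1) := by
        intro S h1 h2 h3
        have h4 : S.arr 1 = fun j => s₂.arr 1 (Equiv.swap i p j) := by
          funext j
          rw [h3, hWs, Equiv.swap_apply_def]
          split_ifs with c1 c2 c2
          · rw [← c1, c2]
          · rfl
          · rfl
          · rfl
        rw [h4]
        exact ⟨hr2.of_arr h1 h2 (h4 ▸ hsw.lt), hsw⟩
      rw [hWs] at hWi hWp
      refine Comp.load_seq ?_ <| Comp.load_seq ?_ <| Comp.store_seq ?_ <| Comp.store_seq ?_ <|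
        Comp.add ?_ ⟨?_, key _ ?_ ?_ ?_⟩
      rotate_right 3
      · intro r hr
        simp [show r ≠ 5 by omega, show r ≠ 9 by omega, show r ≠ 10 by omega]
      · funext j
        simp
      · intro j
        simp [g5, h6, hWs]
      all_goals
        simp [g5, h6, hWs, hone]
      all_goals omega
    · exact ⟨by simp, hs.frame ((Frame.refl 5 s).setReg le_rfl) (by omega), hW⟩
    · exact fun s₁ h => h.2
  · have h1 : (n + 1) ^ 4 = n * (n + 1) ^ 3 + (n + 1) ^ 3 := by ring
    have h2 : 1 ≤ (n + 1) ^ 3 := Nat.one_le_pow _ _ (by omega)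
    have h3 : n ≤ n * (n + 1) ^ 3 := Nat.le_mul_of_pos_right _ h2
    rw [h1]
    nlinarith

/-- Copy the output array to array `2`. -/
def saveProg : Prog :=
  .seq (.const 5 0) <| .loop 5 0 <| .seq (.load 9 1 5) <| .seq (.store 2 5 9) (.add 5 5 1)

theorem comp_saveProg (hB : LargeBound B n) (hs : Ready G s) {w : List (Fin n)}
    (hw : Holds w (s.arr 1)) :
    Comp B saveProg s (4 * n + 2) fun s' => Ready G s' ∧ Holds w (s'.arr 1) ∧
      Holds w (s'.arr 2) := by
  have hl := hB.lin
  refine Comp.mono (T := n * (3 + 1) + 1 + 1) ?_ (by omega) fun _ h => h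
  refine Comp.const_seq (by omega) <| Comp.forLoop (e := n) (c := 3) (b := 0)
    (I := fun k s' => s'.reg 5 = k ∧ (∀ r < 3, s'.reg r = s.reg r) ∧ s'.arr 3 = s.arr 3 ∧
      s'.arr 1 = s.arr 1 ∧ ∀ a < k, s'.arr 2 a = s.arr 1 a) ?_ (Nat.zero_le _) ?_ ?_ ?_ le_rfl
  · rintro k s₁ ⟨h1, h2, -⟩
    exact ⟨h1, (h2 0 (by omega)).trans hs.reg_zero⟩
  · rintro k s₁ - hk ⟨h1, h2, h3, h4, h5⟩
    have e1 := (h2 1 (by omega)).trans hs.reg_one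
    have hlt := hs.word_lt k hk
    refine Comp.load_seq (by rw [h1, h4]; omega) (T := 2) <|
      Comp.store_seq (by simp [h1, h4]; omega) (T := 1) <|
      Comp.add (by simp [h1, e1]; omega) ⟨by simp [h1, e1], ?_, ?_, ?_, ?_⟩
    · intro r hr
      simp [show r ≠ 5 by omega, show r ≠ 9 by omega, h2 r hr]
    · funext j
      simp [h3]
    · funext j
      simp [h4]
    · intro a ha
      by_cases hc : a = k
      · simp [h1, h4, hc]
      · simp only [State.setReg_arr, State.setArr_arr, h4]
        rw [if_neg (by simpa [h1] using hc)]
        exact h5 a (by omega)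
  · exact ⟨by simp, fun r hr => by simp; omega, rfl, rfl, fun a ha => by omega⟩
  · rintro s₁ ⟨-, h2, h3, h4, h5⟩
    refine ⟨hs.of_arr h2 h3 (h4 ▸ hs.word_lt), h4 ▸ hw, ?_⟩
    rw [Holds, ← hw]
    exact List.map_congr_left fun a ha => h5 a (List.mem_range.1 ha)

/-- Prepare the run through the cycle. -/
def prepareProg : Prog :=
  .seq (.const 1 1) <| .seq tableProg <| .seq fillProg <| .seq greedyProg <| .seq saveProg <|
  .seq (.const 3 0) (.const 4 1)

theorem comp_prepareProg (hG : IsATFree G) (hB : LargeBound B n) :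
    Comp B prepareProg (inputState G) (170 * (n + 1) ^ 4) fun s =>
      ∃ w, (w, false) ∈ prismVertices (Between G) (List.finRange n) ∧
        Represents G (w, false) s ∧ Holds w (s.arr 2) ∧ 0 < s.reg 4 := by
  have hl := hB.lin
  refine Comp.mono (T := 100 * (n + 1) ^ 4 + ((3 * n + 2) + (50 * (n + 1) ^ 4 +
    ((4 * n + 2) + 2))) + 1) ?_ ?_ fun _ h => h
  · refine Comp.const_seq (by omega) ?_
    have hs : TableState G (fun _ _ _ => False) ((inputState G).setReg 1 1) := by
      refine ⟨by simp [inputState], by simp, by simp [inputState], ?_, ?_, ?_, ?_⟩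
      · intro k
        simp only [inputState, State.setReg_arr]
        split_ifs <;> omega
      · intro a b ha hb
        have : 0 < ((inputState G).setReg 1 1).arr 0 (a * n + b) ↔
            ∃ (hx : a < n) (hz : b < n), G.Adj ⟨a, hx⟩ ⟨b, hz⟩ := by
          simp only [inputState, State.setReg_arr, true_and]
          constructor
          · intro h
            split_ifs at h with hc
            · obtain ⟨-, i, j, hij, he⟩ := hc
              obtain ⟨rfl, rfl⟩ := pair_inj hb j.2 he
              exact ⟨i.2, j.2, hij⟩
            · omega
          · rintro ⟨hx, hz, h⟩
            rw [if_pos ⟨rfl, _, _, h, rfl⟩]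
            omega
        rw [this, Near]
      · intro k
        simp [inputState]
      · intro y a b _ _ _
        simp [inputState]
    refine (comp_tableProg hB hs).seq (T₂ := (3 * n + 2) + (50 * (n + 1) ^ 4 +
      ((4 * n + 2) + 2))) ?_
    intro s₁ hs₁
    refine (comp_fillProg hB hs₁).seq (T₂ := 50 * (n + 1) ^ 4 + ((4 * n + 2) + 2)) ?_
    rintro s₂ ⟨hs₂, hW₂⟩
    refine (comp_greedyProg hG hB hs₂ hW₂).seq (T₂ := (4 * n + 2) + 2) ?_
    rintro s₃ ⟨hs₃, hW₃⟩
    obtain ⟨w, hw, hmem⟩ := hW₃.exists_word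
    refine (comp_saveProg hB hs₃ hw).seq (T₂ := 2) ?_
    rintro s₄ ⟨hs₄, h1, h2⟩
    refine Comp.const_seq (by omega) (T := 1) <| Comp.const (by omega) ⟨w, hmem, ⟨?_, h1, ?_⟩,
      h2, by simp⟩
    · exact hs₄.frame (((Frame.refl 3 s₄).setReg le_rfl).setReg (by omega)) le_rfl
    · simp [copyCode]
  · have h1 : n + 1 ≤ (n + 1) ^ 4 := Nat.le_self_pow (by norm_num) _
    omega

end FirstWord

end ATFreeGray

/-! ### Generating the AT-free orders -/

open ATFreeGray

theorem mainTheorem2 :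
    ∃ (P : ATFreeGray.Prog) (c d : ℕ), ∀ (n : ℕ) (G : SimpleGraph (Fin n)),
      ATFreeGray.IsATFree G →
      ∃ (t : ℕ) (trace : List (ℕ → ℕ)) (s : ATFreeGray.State) (orders : List (List (Fin n))),
        -- the program halts after `t` steps, working with numbers at most `(n + 2) ^ d`
        ATFreeGray.Exec ((n + 2) ^ d) P (ATFreeGray.inputState G) t trace s ∧
        -- constant amortized time
        t ≤ c * Set.ncard {w : List (Fin n) | ATFreeGray.IsATFreeOrder G w} ∧
        -- the reported contents of the output array are the words in `orders`
        trace.map (fun f => (List.range n).map f) = orders.map (fun w => w.map Fin.val) ∧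
        -- every AT-free order is listed exactly once, and nothing else is listed
        orders.Nodup ∧ (∀ w, w ∈ orders ↔ ATFreeGray.IsATFreeOrder G w) ∧
        -- Gray code property
        orders.IsChain ATFreeGray.OneOrTwoTranspositions ∧
        -- the listing follows a Hamiltonian cycle of the prism, reporting every second vertex
        (2 ≤ n → ∃ (u : ATFreeGray.BasicWord (ATFreeGray.orderLanguage G) × Bool)
          (p : (ATFreeGray.prism (ATFreeGray.orderLanguage G)).Walk u u),
          p.IsHamiltonianCycle ∧
          orders = (List.range (p.length / 2)).map (fun i => (p.getVert (2 * i)).1.1)) := by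
  obtain ⟨C₁, hC₁⟩ := exists_geometricBound 170 4
  obtain ⟨C₂, hC₂⟩ := exists_sum_roundCost_le
  refine ⟨.seq prepareProg cycleProg, 2 * C₁ + C₂ + 1, 3, fun n G hG => ?_⟩
  have hB := largeBound n
  have hbt := isConvexBetweenness_between hG
  have hnd := List.nodup_finRange n
  obtain ⟨t₁, s₁, ht₁, he₁, w, hw, hs₁, hw₁, h4⟩ := comp_prepareProg hG hB
  obtain ⟨t₂, trace, s₂, he₂, ht₂, htr⟩ := exec_cycleProg hB hw hs₁ hw₁ h4
  have hset : {w : List (Fin n) | IsATFreeOrder G w} =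
      feasibleWords (Between G) (List.finRange n) := Set.ext fun _ => isATFreeOrder_iff
  refine ⟨t₁ + t₂, [] ++ trace, s₂, listing (Between G) n (w, false), he₁.seq he₂, ?_, htr,
    nodup_listing hnd hw, fun v => by rw [hbt.mem_listing hnd hw, isATFreeOrder_iff],
    hbt.isChain_listing hnd hw (List.length_finRange), fun hn => exists_prism_cycle hG hn hw⟩
  rw [hset]
  set N := (feasibleWords (Between G) (List.finRange n)).ncard
  have h1 : 2 ^ (n - 1) ≤ N := by simpa using hbt.two_pow_le_ncard hnd
  have h2 : 170 * (n + 1) ^ 4 ≤ C₁ * 2 ^ n := hC₁.le n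
  -- The preprocessing is paid for by the number of orders.
  have h3 : 2 ^ n ≤ 2 * N := by
    calc 2 ^ n ≤ 2 ^ (n - 1 + 1) := Nat.pow_le_pow_right (by norm_num) (by omega)
      _ = 2 * 2 ^ (n - 1) := by ring
      _ ≤ 2 * N := by omega
  have h5 : 1 ≤ N := le_trans Nat.one_le_two_pow h1
  calc t₁ + t₂ ≤ C₁ * (2 * N) + (C₂ * N + 1) :=
        add_le_add (ht₁.trans (h2.trans (Nat.mul_le_mul_left _ h3)))
          (ht₂.trans (Nat.add_le_add_right (hC₂ n G w hG hw) 1))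
    _ ≤ (2 * C₁ + C₂ + 1) * N := by nlinarith
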